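/- Conventions. Let $X$ be a finite poset. For a subposet $A\subseteq X$, $\mathcal K(A)$ denotes its order complex, i.e. the simplicial complex of nonempty chains of $A$ (and also its geometric realization). Write $x\prec y$ if $x$ is covered by $y$, i.e. $x<y$ and there is no $z$ with $x<z<y$; these pairs are the edges of the Hasse diagram $\mathcal H(X)$. The descending link of $x$ is $\hat U_x=\{y\in X : y<x\}$. If $L$ is a simplicial complex and $x$ is not a vertex of $L$, $xL$ is the simplicial cone with apex $x$ and base $L$ (so $x\emptyset=\{x\}$). A function $f:X\to\mathbb R$ is a Morse function if $f(x)<f(y)$ whenever $x\prec y$. An edge $(x,y)$ of $\mathcal H(X)$ is admissible for $f$ if $\mathcal K(\hat U_y\setminus\{x\})$ is contractible and there is no $z\in X$ with $f(x)<f(z)<f(y)$. A matching $M$ on $\mathcal H(X)$ (a set of edges no two of which share an endpoint) is a Morse matching if the digraph obtained from $\mathcal H(X)$, with edges oriented upwards, by reversing the edges that are not in $M$ has no directed cycles; it is admissible for $f$ if all its edges are admissible for $f$. A point is critical if it is not incident to any edge of $M$. **Theorem.** Let $f:X\to\mathbb R$ be a Morse function on a nonempty finite poset $X$ and let $M$ be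 a Morse matching that is admissible for $f$. Let $t_0<t_1<\dots<t_r$ be the values of $f$ and let $C_i$ be the set of critical points $x$ with $f(x)=t_i$. Then there is a filtration of $X$ by subposets $$X_0\subseteq \tilde X_0\subseteq X_1\subseteq\tilde X_1\subseteq\dots\subseteq \tilde X_{r-1}\subseteq X_r=X$$ such that, with $\tilde X_{-1}=\emptyset$: 1. for $0\le i\le r$, $\mathcal K(X_i)=\mathcal K(\tilde X_{i-1})\cup\bigcup_{x\in C_i}x\,\mathcal K(\hat U_x)$, where $\mathcal K(\tilde X_{i-1})\cap x\,\mathcal K(\hat U_x)=\mathcal K(\hat U_x)$ for every $x\in C_i$; 2. for $0\le i<r$, $\mathcal K(X_i)$ is a strong deformation retract of $\mathcal K(\tilde X_i)$. Moreover, $\mathcal K(X)$ is homotopy equivalent to a finite CW-complex constructed by inductively gluing cones over the order complexes of the descending links of the critical points: there is a finite CW-complex $Y$ with subcomplexes $\emptyset=Y_{-1}\subseteq Y_0\subseteq Y_1\subseteq\dots\subseteq Y_r=Y$ such that, for $0\le i\le r$, $Y_i$ is obtained from $Y_{i-1}$ by gluing the cones $x\,\mathcal K(\hat U_x)$, $x\in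 C_i$, along continuous maps $\mathcal K(\hat U_x)\to Y_{i-1}$ from their bases (a pushout of topological spaces), and $\mathcal K(X_i)$ is homotopy equivalent to $Y_i$. In particular $\mathcal K(X)\simeq Y$. -/

import Mathlib

universe u

namespace PosetMorse

section Complexes

variable {X : Type u}

/-- The order complex of the subposet `A` of `X` (with the induced order): the simplicial complex
of nonempty finite chains of elements of `A`. All complexes have their vertices in `X`, so that
order complexes of subposets of `X` can be compared as subcomplexes. -/
def orderComplex [PartialOrder X] (A : Set X) : PreAbstractSimplicialComplex X where
  faces := {s | s.Nonempty ∧ (s : Set X) ⊆ A ∧ IsChain (· ≤ ·) (s : Set X)}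
  isRelLowerSet_faces := by
    rintro s ⟨hs, hA, hc⟩
    refine ⟨hs, fun t hts ht => ⟨ht, ?_, ?_⟩⟩
    · exact (Finset.coe_subset.mpr hts).trans hA
    · exact hc.mono (Finset.coe_subset.mpr hts)

/-- The simplicial cone `xL` with apex `x` and base `L` (used when `x` is not a vertex of `L`).
Its faces are the nonempty sets of vertices contained in `{x} ∪ t`, where `t` is empty or a face
of `L`. In particular the cone on the empty complex is the single vertex `x`. -/
def cone (x : X) (L : PreAbstractSimplicialComplex X) : PreAbstractSimplicialComplex X where
  faces := {s | s.Nonempty ∧ ∃ t : Finset X, (t = ∅ ∨ t ∈ L.faces) ∧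
    (s : Set X) ⊆ insert x (t : Set X)}
  isRelLowerSet_faces := by
    rintro s ⟨hs, t, ht, hst⟩
    exact ⟨hs, fun s' hs' hne => ⟨hne, t, ht, (Finset.coe_subset.mpr hs').trans hst⟩⟩

theorem le_cone (x : X) (L : PreAbstractSimplicialComplex X) : L ≤ cone x L :=
  fun s hs => ⟨(L.isRelLowerSet_faces hs).1, s, Or.inr hs, Set.subset_insert _ _⟩

/-- The geometric realization of a finite simplicial complex with vertices in the finite set `X`:
the points of the standard simplex spanned by `X` whose barycentric coordinates vanish outside
some face, with the topology induced from `X → ℝ`. -/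
def realization [Fintype X] (K : PreAbstractSimplicialComplex X) : Set (X → ℝ) :=
  {w | w ∈ stdSimplex ℝ X ∧ ∃ s ∈ K.faces, ∀ v, v ∉ s → w v = 0}

theorem realization_mono [Fintype X] {K L : PreAbstractSimplicialComplex X} (h : K ≤ L) :
    realization K ⊆ realization L :=
  fun _ ⟨hw, s, hs, hv⟩ => ⟨hw, s, h hs, hv⟩

end Complexes

/-- `A` is a strong deformation retract of `B`, for subspaces `A ⊆ B` of a topological space: there
is a retraction `ρ : B → A` such that, in `B`, the identity is homotopic relative to `A` to `ρ`. -/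
def IsStrongDeformationRetract {E : Type*} [TopologicalSpace E] (A B : Set E) : Prop :=
  ∃ hAB : A ⊆ B, ∃ ρ : C(B, A), (∀ a : A, ρ (Set.inclusion hAB a) = a) ∧
    (ContinuousMap.id B).HomotopicRel
      ((⟨Set.inclusion hAB, continuous_inclusion hAB⟩ : C(A, B)).comp ρ)
      (Set.range (Set.inclusion hAB))

section Morse

variable {X : Type u} [PartialOrder X]

/-- A Morse function on a poset. -/
def IsMorseFunction (f : X → ℝ) : Prop :=
  ∀ x y : X, x ⋖ y → f x < f y

/-- A matching on the Hasse diagram: a set of edges `(x, y)`, `x` covered by `y`, no two distinct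
ones of which share an endpoint. -/
structure IsMatching (M : Set (X × X)) : Prop where
  covBy : ∀ e ∈ M, e.1 ⋖ e.2
  eq_of_share : ∀ e ∈ M, ∀ e' ∈ M,
    (e.1 = e'.1 ∨ e.1 = e'.2 ∨ e.2 = e'.1 ∨ e.2 = e'.2) → e = e'

/-- The edges `a → b` of the digraph obtained from the Hasse diagram (whose edges go from an
element to an element covering it) by reversing the edges that are not in `M`. -/
def modifiedHasse (M : Set (X × X)) (a b : X) : Prop :=
  (a ⋖ b ∧ (a, b) ∈ M) ∨ (b ⋖ a ∧ (b, a) ∉ M)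

/-- A Morse matching: the modified Hasse diagram has no directed cycle. -/
structure IsMorseMatching (M : Set (X × X)) : Prop extends IsMatching M where
  acyclic : ∀ x : X, ¬ Relation.TransGen (modifiedHasse M) x x

/-- The critical points: those not incident to any edge of the matching. -/
def IsCritical (M : Set (X × X)) (x : X) : Prop :=
  ∀ e ∈ M, e.1 ≠ x ∧ e.2 ≠ x

variable [Fintype X]

/-- The edge `(x, y)` of the Hasse diagram is admissible for `f`. -/
structure IsAdmissibleEdge (f : X → ℝ) (x y : X) : Prop where
  covBy : x ⋖ y
  contractible : ContractibleSpace (realization (orderComplex (Set.Iio y \ {x})))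
  no_value_between : ¬ ∃ z : X, f x < f z ∧ f z < f y

/-- A Morse matching is admissible for `f` if all its edges are. -/
structure IsAdmissibleMorseMatching (f : X → ℝ) (M : Set (X × X)) : Prop
    extends IsMorseMatching M where
  admissible : ∀ e ∈ M, IsAdmissibleEdge f e.1 e.2

/-- The disjoint union, over `x ∈ C`, of the realizations of the order complexes of the descending
links `{y | y < x}`. -/
abbrev LinkSum (C : Set X) : Type u :=
  Σ x : C, realization (orderComplex (Set.Iio (x : X)))

/-- The disjoint union, over `x ∈ C`, of the realizations of the cones with apex `x` over the order
complexes of the descending links. -/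
abbrev ConeSum (C : Set X) : Type u :=
  Σ x : C, realization (cone (x : X) (orderComplex (Set.Iio (x : X))))

/-- The inclusion of the bases into the cones. -/
def linkInclusion (C : Set X) : C(LinkSum C, ConeSum C) where
  toFun := Sigma.map id fun _ => Set.inclusion (realization_mono (le_cone _ _))
  continuous_toFun := Continuous.sigma_map fun _ =>
    continuous_inclusion (realization_mono (le_cone _ _))

/-- For subspaces `P ⊆ Q` of a space `Y`: `Q` is obtained from `P` by gluing, for each `x ∈ C`, the
cone over the descending link of `x` along a continuous map from its base to `P`. That is, the
square formed by the inclusions `P ⊆ Q` and of the bases into the cones is a pushout of topological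
spaces. -/
def IsGluingOfCones {Y : Type u} [TopologicalSpace Y] (C : Set X) (P Q : Set Y) : Prop :=
  ∃ (hPQ : P ⊆ Q) (φ : C(LinkSum C, P)) (Φ : C(ConeSum C, Q)),
    CategoryTheory.IsPushout (TopCat.ofHom φ) (TopCat.ofHom (linkInclusion C))
      (TopCat.ofHom (⟨Set.inclusion hPQ, continuous_inclusion hPQ⟩ : C(P, Q))) (TopCat.ofHom Φ)

end Morse

end PosetMorse

/-!
The subposets are the level sets of `f`, in two versions. At a value `t`, `levelSet f M t` consists
of the points of value at most `t` except the lower ends of the edges of `M` that start at the level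
`t`, and `thickLevelSet f M t` contains these lower ends and their partners. Because `f` takes no
value between the ends of an admissible edge, passing from a thick level set to the next level set
adds exactly the critical points of the new value (`levelSet_eq_union`). These are maximal, so their
cones are glued along their descending links (`orderComplex_eq_sup_cones`, `isGlue_cones`).
Conversely, a thick level set is reduced to the level set by removing the edges `(x, y)` of `M` that
start there, one after the other (`isStrongDeformationRetract_endpoints`): by acyclicity there is an
edge for which `y` is the only remaining point above `x`, so that `x` can be pushed into `y`, and then
`y` is a maximal point whose descending link is the contractible complex of the definition of
admissibility.

The CW complex is built by induction on the levels (`exists_cwComplex_tower`), together with an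
equivalence between the order complex of the last stage and the complex `Y` constructed so far.
Attaching the cones over the links of the next critical points to the order complex or to `Y` gives
equivalent spaces, for a suitable choice of attaching maps (`RetractEquiv.exists_adj`). This uses the
homotopy extension property of the base of a cone and is carried out for the equivalence relation
`RetractEquiv` generated by inclusions of strong deformation retracts. The attaching maps can be
changed by a homotopy, hence may be assumed cellular (`exists_homotopic_isCellular`), and then the
space obtained from `Y` has a CW structure whose additional cells are the open simplices of the cones
that contain the apex (`exists_cwComplex_adj`).

Cellular approximation is proved one simplex at a time: a map from a simplex of dimension less than
`n` into a complex of dimension `n` is homotopic to one that misses the center of a given `n`-cell,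
because a `C¹` map does not raise the Hausdorff dimension; from there it is pushed radially to the
boundary of the cell (`IsCellOver.exists_homotopicRel`). The homotopy is extended from a subcomplex
to the whole complex by `hasExtension_realization`. This and the homotopy extension property for
cones are both cases of `IsConical.hasExtension`: a simplicial complex is obtained from the complement
of an open simplex, and a cone from its base, by adding straight segments towards one point.
-/

universe v

open Topology unitInterval Metric

namespace PosetMorse

/-! ### Homotopies as maps into path spaces -/

section Paths

variable {X Y : Type*} [TopologicalSpace X] [TopologicalSpace Y]

theorem homotopicRel_of_path {f g : C(X, Y)} {S : Set X} (h : C(X, C(I, Y)))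
    (h0 : ∀ x, h x 0 = f x) (h1 : ∀ x, h x 1 = g x) (hS : ∀ x ∈ S, ∀ t, h x t = f x) :
    f.HomotopicRel g S :=
  ⟨{ toFun := fun p => h p.2 p.1
     continuous_toFun := by fun_prop
     map_zero_left := h0
     map_one_left := h1
     prop' := fun t x hx => hS x hx t }⟩

theorem exists_path_of_homotopicRel {f g : C(X, Y)} {S : Set X} (h : f.HomotopicRel g S) :
    ∃ H : C(X, C(I, Y)), (∀ x, H x 0 = f x) ∧ (∀ x, H x 1 = g x) ∧
      ∀ x ∈ S, ∀ t, H x t = f x := by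
  obtain ⟨F⟩ := h
  refine ⟨ContinuousMap.curry ⟨fun p : X × I => F (p.2, p.1), by fun_prop⟩, fun x => ?_,
    fun x => ?_, fun x hx t => ?_⟩
  · simp
  · simp
  · exact F.eq_fst t hx

/-- The point `(1 - s) a + s b` of the unit interval. -/
def mix (s a b : I) : I :=
  ⟨(1 - (s : ℝ)) * a + s * b, (convex_Icc (0 : ℝ) 1) a.2 b.2 (sub_nonneg.2 s.2.2) s.2.1 (by ring)⟩

theorem mix_zero (a b : I) : mix 0 a b = a := by ext; simp [mix]
theorem mix_one (a b : I) : mix 1 a b = b := by ext; simp [mix]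
theorem mix_self (s a : I) : mix s a a = a := by ext; simp only [mix]; ring

@[fun_prop]
theorem Continuous.mix {f g h : X → I} (hf : Continuous f) (hg : Continuous g)
    (hh : Continuous h) : Continuous fun x => mix (f x) (g x) (h x) := by
  unfold PosetMorse.mix
  fun_prop

end Paths

/-! ### Inclusions of strong deformation retracts -/

section Retract

variable {A B D : Type*} [TopologicalSpace A] [TopologicalSpace B] [TopologicalSpace D]

/-- `i : A → B` has a left inverse `ρ` such that `i ∘ ρ` is homotopic to the identity relative to
the image of `i`: up to the name of its source, `i` is the inclusion of a strong deformation
retract. -/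
def IsRetractInclusion (i : C(A, B)) : Prop :=
  ∃ ρ : C(B, A), (∀ a, ρ (i a) = a) ∧
    (ContinuousMap.id B).HomotopicRel (i.comp ρ) (Set.range i)

theorem IsRetractInclusion.of_homeomorph (e : A ≃ₜ B) :
    IsRetractInclusion (⟨e, e.continuous⟩ : C(A, B)) := by
  refine ⟨⟨e.symm, e.symm.continuous⟩, fun a => e.symm_apply_apply a, ?_⟩
  have : (⟨e, e.continuous⟩ : C(A, B)).comp ⟨e.symm, e.symm.continuous⟩ = ContinuousMap.id B := by
    ext b; exact e.apply_symm_apply b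
  rw [this]
  exact .refl _

theorem IsRetractInclusion.nonempty_homotopyEquiv {i : C(A, B)} (h : IsRetractInclusion i) :
    Nonempty (ContinuousMap.HomotopyEquiv A B) := by
  obtain ⟨ρ, h1, h2⟩ := h
  refine ⟨⟨i, ρ, ?_, h2.homotopic.symm⟩⟩
  have : ρ.comp i = ContinuousMap.id A := by ext a; exact h1 a
  rw [this]

end Retract

/-- The relation between spaces generated by: `A` is a strong deformation retract of `B`. It implies
homotopy equivalence. In contrast to the latter, it reduces the homotopy invariance of gluing
(`RetractEquiv.exists_adj`) to the case of the inclusion of a strong deformation retract. -/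
def RetractEquiv (A B : TopCat.{v}) : Prop :=
  Relation.EqvGen (fun A B : TopCat.{v} => ∃ i : C(A, B), IsRetractInclusion i) A B

theorem RetractEquiv.nonempty_homotopyEquiv {A B : TopCat.{v}} (h : RetractEquiv A B) :
    Nonempty (ContinuousMap.HomotopyEquiv A B) := by
  induction h with
  | rel A B h => obtain ⟨i, hi⟩ := h; exact hi.nonempty_homotopyEquiv
  | refl A => exact ⟨.refl _⟩
  | symm A B _ ih => exact ih.map .symm
  | trans A B D _ _ ih1 ih2 => exact ⟨ih1.some.trans ih2.some⟩

theorem RetractEquiv.symm {A B : TopCat.{v}} (h : RetractEquiv A B) : RetractEquiv B A :=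
  Relation.EqvGen.symm _ _ h

theorem RetractEquiv.trans {A B D : TopCat.{v}} (h : RetractEquiv A B) (h' : RetractEquiv B D) :
    RetractEquiv A D :=
  Relation.EqvGen.trans _ _ _ h h'

theorem RetractEquiv.of_isRetractInclusion {A B : Type v} [TopologicalSpace A] [TopologicalSpace B]
    {i : C(A, B)} (h : IsRetractInclusion i) : RetractEquiv (TopCat.of A) (TopCat.of B) :=
  .rel _ _ ⟨i, h⟩

theorem RetractEquiv.of_homeomorph {A B : Type v} [TopologicalSpace A] [TopologicalSpace B]
    (e : A ≃ₜ B) : RetractEquiv (TopCat.of A) (TopCat.of B) :=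
  .of_isRetractInclusion (.of_homeomorph e)

/-! ### Gluing along a subspace -/

section Gluing

variable {W Z A P : Type v} [TopologicalSpace W] [TopologicalSpace Z] [TopologicalSpace A]
  [TopologicalSpace P]

/-- The square `jA ∘ f = jZ ∘ i` is a pushout of topological spaces: `P` is obtained from `A` by
gluing `Z` along `f`, where `i : W → Z`. Since `jA` and `jZ` are jointly surjective, the maps provided
by `lift` are unique. -/
structure IsGlue (i : C(W, Z)) (f : C(W, A)) (jA : C(A, P)) (jZ : C(Z, P)) : Prop where
  comm : ∀ w, jA (f w) = jZ (i w)
  lift : ∀ {T : Type v} [TopologicalSpace T] (a : C(A, T)) (c : C(Z, T)),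
    (∀ w, a (f w) = c (i w)) → ∃ h : C(P, T), (∀ x, h (jA x) = a x) ∧ ∀ z, h (jZ z) = c z
  surj : ∀ p, (∃ x, jA x = p) ∨ ∃ z, jZ z = p

theorem IsGlue.ext {i : C(W, Z)} {f : C(W, A)} {jA : C(A, P)} {jZ : C(Z, P)}
    (hP : IsGlue i f jA jZ) {T : Type*} {g h : P → T} (h1 : ∀ x, g (jA x) = h (jA x))
    (h2 : ∀ z, g (jZ z) = h (jZ z)) : g = h := by
  funext p
  obtain ⟨x, rfl⟩ | ⟨z, rfl⟩ := hP.surj p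
  exacts [h1 x, h2 z]

theorem IsGlue.isPushout {i : C(W, Z)} {f : C(W, A)} {jA : C(A, P)} {jZ : C(Z, P)}
    (hP : IsGlue i f jA jZ) : CategoryTheory.IsPushout (TopCat.ofHom f) (TopCat.ofHom i)
      (TopCat.ofHom jA) (TopCat.ofHom jZ) := by
  refine ⟨⟨?_⟩, ⟨CategoryTheory.Limits.PushoutCocone.IsColimit.mk _
    (fun s => TopCat.ofHom (hP.lift s.inl.hom s.inr.hom
      fun w => congrArg (fun g => g.hom w) s.condition).choose) ?_ ?_ ?_⟩⟩
  · ext w; exact hP.comm w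
  · intro s
    ext x
    exact (hP.lift s.inl.hom s.inr.hom
      fun w => congrArg (fun g => g.hom w) s.condition).choose_spec.1 x
  · intro s
    ext x
    exact (hP.lift s.inl.hom s.inr.hom
      fun w => congrArg (fun g => g.hom w) s.condition).choose_spec.2 x
  · intro s m h1 h2
    obtain ⟨e1, e2⟩ := (hP.lift s.inl.hom s.inr.hom
      fun w => congrArg (fun g => g.hom w) s.condition).choose_spec
    ext p
    refine congrFun (hP.ext (g := m.hom) (h := (hP.lift s.inl.hom s.inr.hom
      fun w => congrArg (fun g => g.hom w) s.condition).choose) (fun x => ?_) (fun z => ?_)) p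
    · rw [e1, ← h1]; rfl
    · rw [e2, ← h2]; rfl

theorem IsGlue.nonempty_homeomorph {P' : Type v} [TopologicalSpace P']
    {i : C(W, Z)} {f : C(W, A)} {jA : C(A, P)} {jZ : C(Z, P)} {jA' : C(A, P')} {jZ' : C(Z, P')}
    (hP : IsGlue i f jA jZ) (hP' : IsGlue i f jA' jZ') : Nonempty (P ≃ₜ P') := by
  obtain ⟨g, g1, g2⟩ := hP.lift jA' jZ' hP'.comm
  obtain ⟨h, h1, h2⟩ := hP'.lift jA jZ hP.comm
  refine ⟨⟨⟨g, h, ?_, ?_⟩, g.continuous, h.continuous⟩⟩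
  · exact congrFun (hP.ext (g := h ∘ g) (h := id) (by simp [g1, h1]) (by simp [g2, h2]))
  · exact congrFun (hP'.ext (g := g ∘ h) (h := id) (by simp [g1, h1]) (by simp [g2, h2]))

/-- Homotopies of maps out of a gluing can be defined on the two pieces. -/
theorem IsGlue.homotopicRel {i : C(W, Z)} {f : C(W, A)} {jA : C(A, P)} {jZ : C(Z, P)}
    (hP : IsGlue i f jA jZ) {T : Type v} [TopologicalSpace T] {g h : C(P, T)} {S : Set P}
    (HA : C(A, C(I, T))) (HZ : C(Z, C(I, T))) (hAZ : ∀ w, HA (f w) = HZ (i w))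
    (a0 : ∀ x, HA x 0 = g (jA x)) (a1 : ∀ x, HA x 1 = h (jA x))
    (z0 : ∀ z, HZ z 0 = g (jZ z)) (z1 : ∀ z, HZ z 1 = h (jZ z))
    (aS : ∀ x, jA x ∈ S → ∀ t, HA x t = g (jA x)) (zS : ∀ z, jZ z ∈ S → ∀ t, HZ z t = g (jZ z)) :
    g.HomotopicRel h S := by
  obtain ⟨H, H1, H2⟩ := hP.lift HA HZ hAZ
  refine homotopicRel_of_path H (fun p => ?_) (fun p => ?_) (fun p hp t => ?_)
  · obtain ⟨x, rfl⟩ | ⟨z, rfl⟩ := hP.surj p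
    · rw [H1, a0]
    · rw [H2, z0]
  · obtain ⟨x, rfl⟩ | ⟨z, rfl⟩ := hP.surj p
    · rw [H1, a1]
    · rw [H2, z1]
  · obtain ⟨x, rfl⟩ | ⟨z, rfl⟩ := hP.surj p
    · rw [H1, aS x hp]
    · rw [H2, zS z hp]

end Gluing

section Adjunction

variable {W Z A : Type v} [TopologicalSpace W] [TopologicalSpace Z] [TopologicalSpace A]

/-- The space obtained from `A` by gluing `Z` along `f : W → A`, where `i : W → Z` is injective.
Its points are those of `A` and those of `Z` outside the image of `i`; its topology is the quotient
topology of the disjoint union of `A` and `Z`. -/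
def Adj (i : C(W, Z)) (_f : C(W, A)) : Type v := A ⊕ {z : Z // z ∉ Set.range i}

open Classical in
/-- The projection of the disjoint union of `A` and `Z` onto the space obtained by gluing. -/
noncomputable def Adj.proj (i : C(W, Z)) (f : C(W, A)) : A ⊕ Z → Adj i f :=
  Sum.elim Sum.inl fun z => if h : z ∈ Set.range i then .inl (f h.choose) else .inr ⟨z, h⟩

noncomputable instance (i : C(W, Z)) (f : C(W, A)) : TopologicalSpace (Adj i f) :=
  .coinduced (Adj.proj i f) inferInstance

theorem Adj.continuous_proj (i : C(W, Z)) (f : C(W, A)) : Continuous (Adj.proj i f) :=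
  continuous_coinduced_rng

/-- The canonical map from `A` to the space obtained by gluing. -/
noncomputable def Adj.inA (i : C(W, Z)) (f : C(W, A)) : C(A, Adj i f) :=
  ⟨fun a => Adj.proj i f (.inl a), (Adj.continuous_proj i f).comp continuous_inl⟩

/-- The canonical map from `Z` to the space obtained by gluing. -/
noncomputable def Adj.inZ (i : C(W, Z)) (f : C(W, A)) : C(Z, Adj i f) :=
  ⟨fun z => Adj.proj i f (.inr z), (Adj.continuous_proj i f).comp continuous_inr⟩

theorem Adj.inA_injective (i : C(W, Z)) (f : C(W, A)) : Function.Injective (Adj.inA i f) :=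
  fun _ _ h => Sum.inl_injective h

theorem Adj.inZ_range {i : C(W, Z)} (f : C(W, A)) (hi : Function.Injective i) (w : W) :
    Adj.inZ i f (i w) = Adj.inA i f (f w) := by
  have h : i w ∈ Set.range i := ⟨w, rfl⟩
  have h2 : h.choose = w := hi h.choose_spec
  refine (dif_pos h).trans ?_
  rw [h2]
  rfl

theorem Adj.inZ_eq_inr {i : C(W, Z)} (f : C(W, A)) {z : Z} (hz : z ∉ Set.range i) :
    Adj.inZ i f z = Sum.inr ⟨z, hz⟩ :=
  dif_neg hz

theorem Adj.isQuotientMap_proj (i : C(W, Z)) (f : C(W, A)) : IsQuotientMap (Adj.proj i f) := by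
  refine ⟨⟨rfl⟩, ?_⟩
  rintro (a | ⟨z, hz⟩)
  · exact ⟨.inl a, rfl⟩
  · exact ⟨.inr z, dif_neg hz⟩

theorem Adj.isGlue {i : C(W, Z)} (f : C(W, A)) (hi : Function.Injective i) :
    IsGlue i f (Adj.inA i f) (Adj.inZ i f) where
  comm w := (Adj.inZ_range f hi w).symm
  surj p := by
    obtain ⟨a | z, rfl⟩ := (Adj.isQuotientMap_proj i f).surjective p
    exacts [.inl ⟨a, rfl⟩, .inr ⟨z, rfl⟩]
  lift {T} _ a c hac := by
    let h : Adj i f → T := Sum.elim a fun z => c z.1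
    have key : h ∘ Adj.proj i f = Sum.elim a c := by
      funext p
      obtain x | z := p
      · rfl
      · by_cases hz : z ∈ Set.range i
        · obtain ⟨w, rfl⟩ := hz
          change h (Adj.inZ i f (i w)) = c (i w)
          rw [Adj.inZ_range f hi, ← hac]
          rfl
        · change h (Adj.inZ i f z) = c z
          rw [Adj.inZ_eq_inr f hz]
          rfl
    refine ⟨⟨h, (Adj.isQuotientMap_proj i f).continuous_iff.2 ?_⟩, fun x => rfl, fun z =>
      congrFun key (.inr z)⟩
    rw [key]
    exact a.continuous.sumElim c.continuous

end Adjunction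

/-! ### Homotopy extension -/

section Extension

variable {W Z : Type v} [TopologicalSpace W] [TopologicalSpace Z]

/-- The homotopy extension property of `i : W → Z`, for homotopies prescribed on `Z` at the time
`e` (which is an end of the unit interval in the applications). -/
def HasExtension (i : C(W, Z)) (e : I) : Prop :=
  ∀ {T : Type v} [TopologicalSpace T] (c : C(Z, T)) (η : C(W × I, T)), (∀ w, η (w, e) = c (i w)) →
    ∃ E : C(Z × I, T), (∀ z, E (z, e) = c z) ∧ ∀ w t, E (i w, t) = η (w, t)

theorem HasExtension.one {i : C(W, Z)} (h : HasExtension i 0) : HasExtension i 1 := by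
  intro T _ c η hη
  obtain ⟨E, E1, E2⟩ := h c ⟨fun p => η (p.1, σ p.2), by fun_prop⟩ (fun w => by simpa using hη w)
  exact ⟨⟨fun p => E (p.1, σ p.2), by fun_prop⟩, fun z => by simpa using E1 z,
    fun w t => by simpa using E2 w (σ t)⟩

/-- The homotopy extension property, applied to the cylinder itself, gives a retraction `r` of
`Z × I` onto `Z × {e} ∪ i(W) × I`. -/
theorem HasExtension.exists_retraction {i : C(W, Z)} {e : I} (h : HasExtension i e) :
    ∃ r : C(Z × I, Z × I), (∀ z, r (z, e) = (z, e)) ∧ (∀ w t, r (i w, t) = (i w, t)) ∧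
      ∀ p, (r p).2 = e ∨ ∃ w, i w = (r p).1 := by
  let S : Set (Z × I) := {p | p.2 = e ∨ ∃ w, i w = p.1}
  obtain ⟨E, E1, E2⟩ := h (T := S) ⟨fun z => ⟨(z, e), Or.inl rfl⟩, by fun_prop⟩
    ⟨fun p => ⟨(i p.1, p.2), Or.inr ⟨p.1, rfl⟩⟩, by fun_prop⟩ (fun w => rfl)
  exact ⟨⟨fun p => (E p).1, by fun_prop⟩, fun z => congrArg Subtype.val (E1 z),
    fun w t => congrArg Subtype.val (E2 w t), fun p => (E p).2⟩

end Extension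

section Homotopic

variable {W Z B : Type v} [TopologicalSpace W] [TopologicalSpace Z] [TopologicalSpace B]

/-- The map `i × id` of cylinders. -/
def cylinderMap (i : C(W, Z)) : C(W × I, Z × I) := i.prodMap (ContinuousMap.id I)

theorem cylinderMap_injective {i : C(W, Z)} (hi : Function.Injective i) :
    Function.Injective (cylinderMap i) :=
  hi.prodMap Function.injective_id

/-- Gluing the cylinder `Z × I` along a homotopy of attaching maps gives a space of which the space
obtained by gluing `Z` along either end of the homotopy is a strong deformation retract. -/
theorem retractEquiv_adj_cylinder {i : C(W, Z)} (hi : Function.Injective i) {e : I}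
    (he : HasExtension i e) (η : C(W × I, B)) (f : C(W, B)) (hf : ∀ w, η (w, e) = f w) :
    RetractEquiv (TopCat.of (Adj i f)) (TopCat.of (Adj (cylinderMap i) η)) := by
  have G := Adj.isGlue f hi
  have GM := Adj.isGlue η (cylinderMap_injective hi)
  set jB := Adj.inA i f
  set jZ := Adj.inZ i f
  set kB := Adj.inA (cylinderMap i) η
  set kZ := Adj.inZ (cylinderMap i) η
  obtain ⟨r, r1, r2, r3⟩ := he.exists_retraction
  obtain ⟨E, E1, E2⟩ := he jZ (jB.comp η) (fun w => by simp [hf, G.comm])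
  -- the inclusion of the end and the retraction onto it
  obtain ⟨ι, ι1, ι2⟩ := G.lift kB ⟨fun z => kZ (z, e), by fun_prop⟩
    (fun w => by rw [← hf]; exact GM.comm (w, e))
  obtain ⟨ρ, ρ1, ρ2⟩ := GM.lift jB (E.comp r) (fun p => by
    change jB (η p) = E (r (i p.1, p.2))
    rw [r2, E2]; rfl)
  have hιE : ∀ p, ι (E (r p)) = kZ (r p) := by
    intro p
    obtain h | ⟨w, h⟩ := r3 p
    · have : r p = ((r p).1, e) := Prod.ext rfl h
      rw [this, E1, ι2]; rfl
    · have : r p = (i w, (r p).2) := Prod.ext h.symm rfl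
      rw [this, E2]
      exact (ι1 _).trans (GM.comm (w, (r p).2))
  refine .of_isRetractInclusion (i := ι) ⟨ρ, congrFun (G.ext (g := ρ ∘ ι) (h := id) ?_ ?_), ?_⟩
  · intro x; simp [ι1, ρ1]
  · intro z; simp [ι2, ρ2, r1, E1]
  let K : C((Z × I) × I, Adj (cylinderMap i) η) :=
    ⟨fun q => kZ ((r (q.1.1, mix q.2 e q.1.2)).1, mix q.2 q.1.2 (r q.1).2), by fun_prop⟩
  refine GM.homotopicRel (ContinuousMap.curry ⟨fun p : B × I => kB p.1, by fun_prop⟩) K.curry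
    ?_ ?_ ?_ ?_ ?_ ?_ ?_
  · intro p
    ext t
    change kB (η p) = kZ ((r (i p.1, mix t e p.2)).1, mix t p.2 (r (i p.1, p.2)).2)
    rw [r2, r2]
    simp only [mix_self]
    exact GM.comm p
  · intro x; rfl
  · intro x
    change kB x = ι (ρ (kB x))
    rw [ρ1, ι1]
  · intro p
    change kZ ((r (p.1, mix 0 e p.2)).1, mix 0 p.2 (r p).2) = kZ p
    rw [mix_zero, mix_zero, r1]
  · intro p
    change kZ ((r (p.1, mix 1 e p.2)).1, mix 1 p.2 (r p).2) = ι (ρ (kZ p))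
    rw [mix_one, mix_one, ρ2]
    exact (hιE p).symm
  · intro x _ t; rfl
  · rintro p ⟨q, hq⟩ t
    have key : p.2 = e ∨ ∃ w, i w = p.1 := by
      by_contra hcon
      push Not at hcon
      have hp : p ∉ Set.range (cylinderMap i) := by
        rintro ⟨w, rfl⟩
        exact hcon.2 w.1 rfl
      have h1 : kZ p = Sum.inr ⟨p, hp⟩ := Adj.inZ_eq_inr η hp
      obtain ⟨x, rfl⟩ | ⟨z, rfl⟩ := G.surj q
      · rw [ι1, h1] at hq
        exact Sum.inl_ne_inr hq
      · rw [ι2] at hq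
        change kZ (z, e) = kZ p at hq
        by_cases hz : (z, e) ∈ Set.range (cylinderMap i)
        · obtain ⟨w, hw⟩ := hz
          rw [← hw, ← GM.comm w, h1] at hq
          exact Sum.inl_ne_inr hq
        · rw [h1, show kZ (z, e) = Sum.inr ⟨(z, e), hz⟩ from Adj.inZ_eq_inr η hz] at hq
          exact hcon.1 (congrArg (fun p => p.1.2) (Sum.inr_injective hq)).symm
    change kZ ((r (p.1, mix t e p.2)).1, mix t p.2 (r p).2) = kZ p
    obtain ⟨z, s⟩ := p
    obtain h | ⟨w, h⟩ := key
    · simp only at h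
      subst h
      simp [mix_self, r1]
    · simp only at h
      subst h
      simp [mix_self, r2]

/-- Gluing along homotopic maps gives equivalent spaces: both are strong deformation retracts of the
space obtained by gluing a cylinder along the homotopy. -/
theorem retractEquiv_adj_of_homotopic {i : C(W, Z)} (hi : Function.Injective i)
    (he : HasExtension i 0) {f g : C(W, B)} (h : f.Homotopic g) :
    RetractEquiv (TopCat.of (Adj i f)) (TopCat.of (Adj i g)) := by
  obtain ⟨F⟩ := h
  let η : C(W × I, B) := ⟨fun p => F (p.2, p.1), by fun_prop⟩
  exact (retractEquiv_adj_cylinder hi he η f fun w => F.map_zero_left w).trans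
    (retractEquiv_adj_cylinder hi he.one η g fun w => F.map_one_left w).symm

/-- A strong deformation retraction of `B` onto `A` extends by the identity over the glued `Z`. -/
theorem retractEquiv_adj_of_isRetractInclusion {A : Type v} [TopologicalSpace A] {i : C(W, Z)}
    (hi : Function.Injective i) {j : C(A, B)} (hj : IsRetractInclusion j) (f : C(W, A)) :
    RetractEquiv (TopCat.of (Adj i f)) (TopCat.of (Adj i (j.comp f))) := by
  obtain ⟨ρ, h1, h2⟩ := hj
  obtain ⟨H, H0, H1, H2⟩ := exists_path_of_homotopicRel h2
  have G := Adj.isGlue f hi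
  have G' := Adj.isGlue (j.comp f) hi
  set jA := Adj.inA i f
  set jZ := Adj.inZ i f
  set kB := Adj.inA i (j.comp f)
  set kZ := Adj.inZ i (j.comp f)
  obtain ⟨ι, ι1, ι2⟩ := G.lift (kB.comp j) kZ (fun w => G'.comm w)
  obtain ⟨r, r1, r2⟩ := G'.lift (jA.comp ρ) jZ (fun w => by
    simp only [ContinuousMap.comp_apply, h1]; exact G.comm w)
  refine .of_isRetractInclusion (i := ι) ⟨r, congrFun (G.ext (g := r ∘ ι) (h := id) ?_ ?_), ?_⟩
  · intro x; simp [ι1, r1, h1]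
  · intro z; simp [ι2, r2]
  refine G'.homotopicRel (ContinuousMap.curry ⟨fun p : B × I => kB (H p.1 p.2), by fun_prop⟩)
    (ContinuousMap.curry ⟨fun p : Z × I => kZ p.1, by fun_prop⟩) ?_ ?_ ?_ ?_ ?_ ?_ ?_
  · intro w
    ext t
    change kB (H (j (f w)) t) = kZ (i w)
    rw [H2 _ ⟨_, rfl⟩]
    exact G'.comm w
  · intro x
    change kB (H x 0) = kB x
    rw [H0]; rfl
  · intro x
    change kB (H x 1) = ι (r (kB x))
    rw [H1, r1]; exact (ι1 _).symm
  · intro z; rfl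
  · intro z
    change kZ z = ι (r (kZ z))
    rw [r2, ι2]
  · rintro x ⟨q, hq⟩ t
    change kB (H x t) = kB x
    suffices x ∈ Set.range j by rw [H2 x this]; rfl
    obtain ⟨a, rfl⟩ | ⟨z, rfl⟩ := G.surj q
    · rw [ι1] at hq
      exact ⟨a, Adj.inA_injective _ _ hq⟩
    · rw [ι2] at hq
      by_cases hz : z ∈ Set.range i
      · obtain ⟨w, rfl⟩ := hz
        rw [← G'.comm w] at hq
        exact ⟨f w, Adj.inA_injective _ _ hq⟩
      · rw [show kZ z = Sum.inr ⟨z, hz⟩ from Adj.inZ_eq_inr _ hz] at hq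
        exact (Sum.inr_ne_inl hq).elim
  · intro z _ t; rfl

/-- Gluing `Z` to equivalent spaces gives equivalent spaces, for suitable attaching maps. -/
theorem RetractEquiv.exists_adj {i : C(W, Z)} (hi : Function.Injective i)
    (he : HasExtension i 0) {A B : TopCat.{v}} (h : RetractEquiv A B) (f : C(W, A)) :
    ∃ φ : C(W, B), RetractEquiv (TopCat.of (Adj i f)) (TopCat.of (Adj i φ)) := by
  suffices (∀ f : C(W, A), ∃ φ : C(W, B),
      RetractEquiv (TopCat.of (Adj i f)) (TopCat.of (Adj i φ))) ∧ (∀ φ : C(W, B), ∃ f : C(W, A),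
      RetractEquiv (TopCat.of (Adj i φ)) (TopCat.of (Adj i f))) from this.1 f
  clear f
  induction h with
  | rel A B h =>
    obtain ⟨j, hj⟩ := h
    refine ⟨fun f => ⟨j.comp f, retractEquiv_adj_of_isRetractInclusion hi hj f⟩, fun φ => ?_⟩
    obtain ⟨ρ, h1, h2⟩ := id hj
    refine ⟨ρ.comp φ, (retractEquiv_adj_of_homotopic hi he
      (g := j.comp (ρ.comp φ)) ?_).trans (retractEquiv_adj_of_isRetractInclusion hi hj _).symm⟩
    exact h2.homotopic.comp (.refl φ)
  | refl A => exact ⟨fun f => ⟨f, .refl _⟩, fun f => ⟨f, .refl _⟩⟩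
  | symm A B _ ih => exact ih.symm
  | trans A B D _ _ ih1 ih2 =>
    constructor
    · intro f
      obtain ⟨g, hg⟩ := ih1.1 f
      obtain ⟨h, hh⟩ := ih2.1 g
      exact ⟨h, hg.trans hh⟩
    · intro f
      obtain ⟨g, hg⟩ := ih2.2 f
      obtain ⟨h, hh⟩ := ih1.2 g
      exact ⟨h, hg.trans hh⟩

end Homotopic

/-! ### Strong deformation retracts of subspaces -/

section Subspaces

theorem exists_glue_of_isClosed {X T : Type*} [TopologicalSpace X] [TopologicalSpace T]
    {F G : Set X} (hF : IsClosed F) (hG : IsClosed G) (hFG : ∀ x, x ∈ F ∨ x ∈ G)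
    (f : C(F, T)) (g : C(G, T)) (h : ∀ x (h1 : x ∈ F) (h2 : x ∈ G), f ⟨x, h1⟩ = g ⟨x, h2⟩) :
    ∃ k : C(X, T), (∀ x : F, k x = f x) ∧ ∀ x : G, k x = g x := by
  classical
  let k : X → T := fun x => if h : x ∈ F then f ⟨x, h⟩ else g ⟨x, (hFG x).resolve_left h⟩
  have k1 : ∀ x : F, k x = f x := fun x => dif_pos x.2
  have k2 : ∀ x : G, k x = g x := fun x => by
    by_cases hx : (x : X) ∈ F
    · exact (dif_pos hx).trans (h _ hx x.2)
    · exact dif_neg hx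
  refine ⟨⟨k, continuous_iff_isClosed.2 fun K hK => ?_⟩, k1, k2⟩
  have : k ⁻¹' K = Subtype.val '' (f ⁻¹' K) ∪ Subtype.val '' (g ⁻¹' K) := by
    ext x
    constructor
    · intro hx
      obtain h1 | h2 := hFG x
      · exact .inl ⟨⟨x, h1⟩, by simpa [← k1] using hx, rfl⟩
      · exact .inr ⟨⟨x, h2⟩, by simpa [← k2] using hx, rfl⟩
    · rintro (⟨y, hy, rfl⟩ | ⟨y, hy, rfl⟩)
      · simpa [k1] using hy
      · simpa [k2] using hy
  rw [this]
  exact (hF.isClosedEmbedding_subtypeVal.isClosedMap _ (hK.preimage f.continuous)).union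
    (hG.isClosedEmbedding_subtypeVal.isClosedMap _ (hK.preimage g.continuous))

variable {E : Type*} [TopologicalSpace E]

/-- The inclusion of a subspace in a larger one. -/
def incl {A B : Set E} (h : A ⊆ B) : C(A, B) := ⟨Set.inclusion h, continuous_inclusion h⟩

theorem IsStrongDeformationRetract.isRetractInclusion {A B : Set E}
    (h : IsStrongDeformationRetract A B) : IsRetractInclusion (incl h.choose) := by
  obtain ⟨hAB, ρ, h1, h2⟩ := h
  exact ⟨ρ, h1, h2⟩

theorem isStrongDeformationRetract_of_path {A B : Set E} (hAB : A ⊆ B) (H : C(B, C(I, B)))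
    (H0 : ∀ b, H b 0 = b) (H1 : ∀ b, (H b 1 : E) ∈ A) (HA : ∀ b : B, (b : E) ∈ A → ∀ t, H b t = b) :
    IsStrongDeformationRetract A B := by
  refine ⟨hAB, ⟨fun b => ⟨H b 1, H1 b⟩, by fun_prop⟩, fun a => ?_,
    homotopicRel_of_path H H0 (fun b => rfl) ?_⟩
  · refine Subtype.ext ?_
    change (H (Set.inclusion hAB a) 1 : E) = a
    rw [HA _ a.2]
  · rintro _ ⟨a, rfl⟩ t
    exact HA _ a.2 t

theorem IsStrongDeformationRetract.exists_path {A B : Set E}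
    (h : IsStrongDeformationRetract A B) : A ⊆ B ∧ ∃ H : C(B, C(I, B)), (∀ b, H b 0 = b) ∧
      (∀ b, (H b 1 : E) ∈ A) ∧ ∀ b : B, (b : E) ∈ A → ∀ t, H b t = b := by
  obtain ⟨hAB, ρ, h1, h2⟩ := h
  obtain ⟨H, H0, H1, H2⟩ := exists_path_of_homotopicRel h2
  refine ⟨hAB, H, H0, fun b => ?_, fun b hb t => H2 b ⟨⟨b, hb⟩, rfl⟩ t⟩
  rw [H1]
  exact (ρ b).2

theorem IsStrongDeformationRetract.refl (A : Set E) : IsStrongDeformationRetract A A :=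
  isStrongDeformationRetract_of_path subset_rfl
    (ContinuousMap.curry ⟨fun p : A × I => p.1, by fun_prop⟩) (fun _ => rfl) (fun b => b.2)
    (fun _ _ _ => rfl)

theorem IsStrongDeformationRetract.trans {A B D : Set E} (h : IsStrongDeformationRetract A B)
    (h' : IsStrongDeformationRetract B D) : IsStrongDeformationRetract A D := by
  obtain ⟨hAB, ρ, a1, a2⟩ := h
  obtain ⟨hBD, ρ', b1, b2⟩ := h'
  refine ⟨hAB.trans hBD, ρ.comp ρ', fun a => ?_, ?_⟩
  · have := b1 (Set.inclusion hAB a)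
    rw [ContinuousMap.comp_apply, show Set.inclusion (hAB.trans hBD) a =
      Set.inclusion hBD (Set.inclusion hAB a) from rfl, this, a1]
  · obtain ⟨H, H0, H1, H2⟩ := exists_path_of_homotopicRel a2
    have b3 : (ContinuousMap.id D).HomotopicRel ((incl hBD).comp ρ')
        (Set.range (Set.inclusion (hAB.trans hBD))) :=
      b2.map fun F => ⟨F.toHomotopy, fun t x hx => F.prop' t x (by
        obtain ⟨a, rfl⟩ := hx; exact ⟨Set.inclusion hAB a, rfl⟩)⟩
    refine b3.trans (homotopicRel_of_path (ContinuousMap.curry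
      ⟨fun p : D × I => incl hBD (H (ρ' p.1) p.2), by fun_prop⟩) (fun x => ?_) (fun x => ?_) ?_)
    · change incl hBD (H (ρ' x) 0) = _
      rw [H0]; rfl
    · change incl hBD (H (ρ' x) 1) = _
      rw [H1]; rfl
    · rintro _ ⟨a, rfl⟩ t
      change incl hBD (H (ρ' (Set.inclusion hBD (Set.inclusion hAB a))) t) =
        incl hBD (ρ' (Set.inclusion hBD (Set.inclusion hAB a)))
      rw [b1, H2 _ ⟨a, rfl⟩]; rfl

/-- A deformation of `B` onto `A ∩ B` extends to `A ∪ B` by the identity on `A`. -/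
theorem IsStrongDeformationRetract.union {A B : Set E} (hA : IsClosed A) (hB : IsClosed B)
    (h : IsStrongDeformationRetract (A ∩ B) B) : IsStrongDeformationRetract A (A ∪ B) := by
  obtain ⟨_, H, H0, H1, H2⟩ := h.exists_path
  let F : Set ↥(A ∪ B) := {x | (x : E) ∈ A}
  let G : Set ↥(A ∪ B) := {x | (x : E) ∈ B}
  let j : C(B, ↥(A ∪ B)) := incl Set.subset_union_right
  obtain ⟨k, k1, k2⟩ := exists_glue_of_isClosed (F := F) (G := G)
    (hA.preimage continuous_subtype_val) (hB.preimage continuous_subtype_val) (fun x => x.2)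
    (ContinuousMap.curry ⟨fun p : F × I => (p.1 : ↥(A ∪ B)), by fun_prop⟩)
    (ContinuousMap.curry ⟨fun p : G × I => j (H ⟨p.1.1, p.1.2⟩ p.2), by fun_prop⟩) (by
      intro x h1 h2
      ext t
      change (x : E) = (H ⟨x, h2⟩ t)
      rw [H2 ⟨x, h2⟩ ⟨h1, h2⟩])
  refine isStrongDeformationRetract_of_path Set.subset_union_left k (fun b => ?_) (fun b => ?_) ?_
  · obtain hb | hb := b.2
    · rw [k1 ⟨b, hb⟩]; rfl
    · rw [k2 ⟨b, hb⟩]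
      change j (H ⟨b, hb⟩ 0) = b
      rw [H0]; rfl
  · by_cases hb : (b : E) ∈ A
    · rw [k1 ⟨b, hb⟩]; exact hb
    · rw [k2 ⟨b, b.2.resolve_left hb⟩]; exact (H1 _).1
  · intro b hb t
    rw [k1 ⟨b, hb⟩]; rfl

end Subspaces

/-! ### Conical pairs -/

section Conical

variable {E : Type v} [NormedAddCommGroup E] [NormedSpace ℝ E]

/-- `P` is obtained from its subspace `Q` by adding (part of) a cone with apex `b`. The height
function `S` vanishes exactly on `Q`, is `1` at the apex only, and the points off `Q` can be moved
along the line through `b` to every height. -/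
structure IsConical (P Q : Set E) (b : E) (S : E → ℝ) : Prop where
  subset : Q ⊆ P
  continuous : Continuous S
  nonneg : ∀ w ∈ P, 0 ≤ S w
  le_one : ∀ w ∈ P, S w ≤ 1
  mem_iff : ∀ w ∈ P, w ∈ Q ↔ S w = 0
  apex : ∀ w ∈ P, S w = 1 → w = b
  move : ∀ w ∈ P, 0 < S w → S w < 1 → ∀ s ∈ Set.Icc (0 : ℝ) 1,
    ((1 - s) / (1 - S w)) • (w - S w • b) + s • b ∈ P ∧
      S (((1 - s) / (1 - S w)) • (w - S w • b) + s • b) = s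

/-- The inclusion of the base of a conical pair has the homotopy extension property. In the
coordinates given by the height `s` and the time `t`, the retraction of `P × I` onto
`P × {0} ∪ Q × I` sends `(s, t)` to `(σ, 0)` or to `(0, -σ)`, according to the sign of
`σ = s - t (1 - s)`. -/
theorem IsConical.hasExtension {P Q : Set E} {b : E} {S : E → ℝ} (h : IsConical P Q b S) :
    HasExtension (incl h.subset) 0 := by
  intro T _ c η hη
  let sg : P × I → ℝ := fun p => S p.1 - p.2 * (1 - S p.1)
  -- the factor `(1 - σ⁺) / (1 - s)`, in a form that is visibly continuous at the apex
  let fac : P × I → ℝ := fun p => min (1 + (p.2 : ℝ)) (1 / max (1 - S p.1) (1 / 2))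
  let m : P × I → E := fun p => fac p • ((p.1 : E) - S p.1 • b) + max (sg p) 0 • b
  have hS := h.continuous
  have hsg : Continuous sg := by fun_prop
  have hfac : Continuous fac := by
    refine Continuous.min (by fun_prop) (Continuous.div₀ (by fun_prop) (by fun_prop) fun p => ?_)
    have := le_max_right (1 - S p.1) (1 / 2)
    positivity
  have hm : Continuous m := by fun_prop
  have facs : ∀ p : P × I, S p.1 < 1 → fac p = (1 - max (sg p) 0) / (1 - S p.1) := by
    intro p hp
    have t0 := p.2.2.1
    have t1 := p.2.2.2
    have hp' : 0 < 1 - S p.1 := by linarith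
    rw [eq_div_iff hp'.ne']
    obtain hs | hs := le_total 0 (sg p)
    · have e1 : fac p = 1 + p.2 := by
        refine min_eq_left ?_
        rw [le_div_iff₀ (lt_max_of_lt_left hp')]
        obtain h2 | h2 := max_cases (1 - S p.1) (1 / 2)
        · rw [h2.1]; simp only [sg] at hs; linarith
        · rw [h2.1]; linarith
      rw [e1, max_eq_left hs]
      simp only [sg]; ring
    · have h3 : 1 / 2 ≤ 1 - S p.1 := by
        simp only [sg] at hs; nlinarith
      have e1 : fac p = 1 / (1 - S p.1) := by
        simp only [fac]
        rw [max_eq_left h3]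
        refine min_eq_right ?_
        rw [div_le_iff₀ hp']
        simp only [sg] at hs; linarith
      rw [e1, max_eq_right hs]
      field_simp
      ring
  have m0 : ∀ p : P × I, S p.1 = 0 → m p = p.1 := by
    intro p hp
    have t0 := p.2.2.1
    have : sg p ≤ 0 := by simp [sg, hp, t0]
    simp only [m, max_eq_right this, facs p (by rw [hp]; norm_num), hp]
    simp
  have m1 : ∀ p : P × I, m p ∈ P ∧ S (m p) = max (sg p) 0 := by
    intro p
    have t0 := p.2.2.1
    have t1 := p.2.2.2
    obtain h0 | h0 := (h.nonneg _ p.1.2).eq_or_lt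
    · rw [m0 p h0.symm]
      refine ⟨p.1.2, ?_⟩
      rw [max_eq_right, ← h0]
      simp [sg, ← h0, t0]
    obtain h1 | h1 := (h.le_one _ p.1.2).lt_or_eq
    · simp only [m, facs p h1]
      refine h.move _ p.1.2 h0 h1 _ ⟨le_max_right _ _, max_le ?_ zero_le_one⟩
      simp only [sg]; nlinarith
    · have e1 := h.apex _ p.1.2 h1
      have e2 : m p = p.1 := by
        simp [m, sg, h1, ← e1]
      rw [e2, h1]
      exact ⟨p.1.2, by simp [sg, h1]⟩
  have sgneg : ∀ p : P × I, -sg p ≤ 1 := by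
    intro p
    have t0 := p.2.2.1
    have t1 := p.2.2.2
    have := h.nonneg _ p.1.2
    have := h.le_one _ p.1.2
    simp only [sg]; nlinarith
  obtain ⟨k, k1, k2⟩ := exists_glue_of_isClosed (X := P × I) (F := {p | 0 ≤ sg p})
    (G := {p | sg p ≤ 0}) (isClosed_le continuous_const hsg) (isClosed_le hsg continuous_const)
    (fun p => le_total 0 (sg p)) ⟨fun p => c ⟨m p.1, (m1 p.1).1⟩, by fun_prop⟩
    ⟨fun p => η (⟨m p.1, (h.mem_iff _ (m1 p.1).1).2 (by rw [(m1 p.1).2]; exact max_eq_right p.2)⟩,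
      ⟨-sg p.1, neg_nonneg.2 p.2, sgneg p.1⟩), by fun_prop⟩ (by
      intro p h1 h2
      have h3 : sg p = 0 := le_antisymm h2 h1
      have h4 : m p ∈ Q := (h.mem_iff _ (m1 p).1).2 (by rw [(m1 p).2, h3, max_self])
      have := hη ⟨m p, h4⟩
      refine this.symm.trans ?_
      simp only [ContinuousMap.coe_mk]
      congr 2
      ext
      simp [h3])
  refine ⟨k, fun z => ?_, fun w t => ?_⟩
  · have h1 : 0 ≤ sg (z, 0) := by simpa [sg] using h.nonneg _ z.2
    rw [k1 ⟨(z, 0), h1⟩]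
    simp only [ContinuousMap.coe_mk]
    congr 1
    ext1
    have e0 : sg (z, 0) = S z := by simp [sg]
    obtain h2 | h2 := (h.le_one _ z.2).lt_or_eq
    · have h3 : 1 - S z ≠ 0 := by linarith
      simp only [m, facs (z, 0) h2, e0, max_eq_left (h.nonneg _ z.2)]
      simp [div_self h3]
    · have e1 := h.apex _ z.2 h2
      simp [m, e0, h2, ← e1]
  · have e0 : S (incl h.subset w) = 0 := (h.mem_iff _ (h.subset w.2)).1 w.2
    have h1 : sg (incl h.subset w, t) ≤ 0 := by simp [sg, e0, t.2.1]
    rw [k2 ⟨_, h1⟩]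
    simp only [ContinuousMap.coe_mk]
    congr 2
    · ext1
      exact m0 _ e0
    · ext; simp [sg, e0]

theorem exists_lift_of_isQuotientMap {X Y T : Type*} [TopologicalSpace X] [TopologicalSpace Y]
    [TopologicalSpace T] {q : C(X, Y)} (hq : IsQuotientMap q) (g : C(X, T))
    (h : ∀ x x', q x = q x' → g x = g x') : ∃ k : C(Y, T), ∀ x, k (q x) = g x :=
  ⟨hq.lift g h, fun x => DFunLike.congr_fun (hq.lift_comp g h) x⟩

/-- If the base `Q` of a cone `P` is contractible, it is a strong deformation retract of the cone.
A contraction `H` of `Q` to a point gives the retraction `[w, s] ↦ H(w, s)`, where `s` is the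
height. -/
theorem IsConical.isStrongDeformationRetract {P Q : Set E} {b : E} {S : E → ℝ}
    (h : IsConical P Q b S) (hP : IsCompact P) [ContractibleSpace Q]
    (hfull : ∀ w ∈ Q, ∀ s ∈ Set.Icc (0 : ℝ) 1, (1 - s) • w + s • b ∈ P ∧
      S ((1 - s) • w + s • b) = s) : IsStrongDeformationRetract Q P := by
  have hQ : IsCompact Q := by
    have : Q = P ∩ S ⁻¹' {0} := by
      ext w
      exact ⟨fun hw => ⟨h.subset hw, (h.mem_iff w (h.subset hw)).1 hw⟩,
        fun hw => (h.mem_iff w hw.1).2 hw.2⟩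
    rw [this]
    exact hP.inter_right (isClosed_singleton.preimage h.continuous)
  have : CompactSpace Q := isCompact_iff_compactSpace.1 hQ
  let q : C(Q × I, P) := ⟨fun p => ⟨(1 - (p.2 : ℝ)) • (p.1 : E) + (p.2 : ℝ) • b,
    (hfull _ p.1.2 _ p.2.2).1⟩, by fun_prop⟩
  have hSq : ∀ p, S (q p) = p.2 := fun p => (hfull _ p.1.2 _ p.2.2).2
  have hq : IsQuotientMap q := by
    refine IsClosedMap.isQuotientMap q.continuous.isClosedMap q.continuous fun w => ?_
    obtain h0 | h0 := (h.nonneg _ w.2).eq_or_lt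
    · exact ⟨(⟨w, (h.mem_iff _ w.2).2 h0.symm⟩, 0), by ext1; simp [q]⟩
    obtain h1 | h1 := (h.le_one _ w.2).lt_or_eq
    · have h2 := h.move _ w.2 h0 h1 0 ⟨le_rfl, zero_le_one⟩
      refine ⟨(⟨_, (h.mem_iff _ h2.1).2 h2.2⟩, ⟨S w, h0.le, h1.le⟩), ?_⟩
      ext1
      have h3 : 1 - S w ≠ 0 := by linarith
      simp [q, smul_smul, mul_inv_cancel₀ h3]
    · obtain ⟨x⟩ : Nonempty Q := inferInstance
      exact ⟨(x, 1), by ext1; simp [q, h.apex _ w.2 h1]⟩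
  have hq2 : ∀ p p', q p = q p' → p = p' ∨ p.2 = 1 ∧ p'.2 = 1 := by
    rintro ⟨w, s⟩ ⟨w', s'⟩ hp
    have h1 : s = s' := by
      ext
      rw [← hSq (w, s), ← hSq (w', s'), hp]
    subst h1
    by_cases hs : s = 1
    · exact .inr ⟨hs, hs⟩
    left
    have h2 : (1 - (s : ℝ)) ≠ 0 := fun h => hs (Subtype.ext (by simpa using (sub_eq_zero.1 h).symm))
    have h3 := congrArg Subtype.val hp
    simp only [q, ContinuousMap.coe_mk, add_left_inj] at h3
    rw [smul_right_injective E h2 h3 |> Subtype.ext]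
  obtain ⟨p₀, ⟨H⟩⟩ := id_nullhomotopic Q
  have H0 : ∀ w, H (0, w) = w := fun w => H.map_zero_left w
  have H1 : ∀ w, H (1, w) = p₀ := fun w => H.map_one_left w
  obtain ⟨ρ, hρ⟩ := exists_lift_of_isQuotientMap hq
    (⟨fun p => H (p.2, p.1), by fun_prop⟩ : C(Q × I, Q)) (by
    intro p p' hp
    obtain rfl | ⟨h1, h2⟩ := hq2 p p' hp
    · rfl
    · simp [h1, h2, H1])
  -- the first stage slides the base coordinate along the contraction and fixes the height
  obtain ⟨K1, hK1'⟩ := exists_lift_of_isQuotientMap hq (ContinuousMap.curry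
    ⟨fun p : (Q × I) × I => q (H (p.2 * p.1.2, p.1.1), p.1.2), by fun_prop⟩) (by
    intro p p' hp
    obtain rfl | ⟨h1, h2⟩ := hq2 p p' hp
    · rfl
    · ext t
      simp [q, h1, h2])
  have hK1 : ∀ p t, K1 (q p) t = q (H (t * p.2, p.1), p.2) := fun p t =>
    DFunLike.congr_fun (hK1' p) t
  -- the second stage lowers the height to zero
  obtain ⟨K2, hK2'⟩ := exists_lift_of_isQuotientMap hq (ContinuousMap.curry
    ⟨fun p : (Q × I) × I => q (H (p.1.2, p.1.1), p.1.2 * σ p.2), by fun_prop⟩) (by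
    intro p p' hp
    obtain rfl | ⟨h1, h2⟩ := hq2 p p' hp
    · rfl
    · ext t
      simp [h1, h2, H1])
  have hK2 : ∀ p t, K2 (q p) t = q (H (p.2, p.1), p.2 * σ t) := fun p t =>
    DFunLike.congr_fun (hK2' p) t
  have q0 : ∀ w : Q, q (w, 0) = incl h.subset w := fun w => by
    ext1; simp [q, incl]
  refine ⟨h.subset, ρ, fun a => ?_, ?_⟩
  · have := hρ (a, 0)
    rw [q0] at this
    exact this.trans (H0 a)
  · refine (homotopicRel_of_path K1 (g := ⟨fun w => K1 w 1, by fun_prop⟩) ?_ (fun _ => rfl)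
      ?_).trans (homotopicRel_of_path K2 ?_ ?_ ?_)
    · intro w
      obtain ⟨p, rfl⟩ := hq.surjective w
      rw [hK1]; simp [H0]
    · rintro _ ⟨a, rfl⟩ t
      change K1 (incl h.subset a) t = incl h.subset a
      rw [← q0, hK1]; simp [H0]
    · intro w
      obtain ⟨p, rfl⟩ := hq.surjective w
      simp [hK1, hK2]
    · intro w
      obtain ⟨p, rfl⟩ := hq.surjective w
      rw [hK2]
      simp only [symm_one, mul_zero]
      rw [q0]
      change _ = incl h.subset (ρ (q p))
      rw [hρ]
      rfl
    · rintro _ ⟨a, rfl⟩ t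
      change K2 (incl h.subset a) t = K1 (incl h.subset a) 1
      rw [← q0, hK2, hK1]; simp [H0]

end Conical

/-! ### Realizations of simplicial complexes -/

section Realization

variable {X : Type v} [Fintype X]

/-- The vertices with nonzero barycentric coordinate. -/
noncomputable def vsupp (w : X → ℝ) : Finset X := Finset.univ.filter fun v => w v ≠ 0

theorem mem_vsupp {w : X → ℝ} {v : X} : v ∈ vsupp w ↔ w v ≠ 0 := by simp [vsupp]

theorem vsupp_nonempty {w : X → ℝ} (hw : w ∈ stdSimplex ℝ X) : (vsupp w).Nonempty := by
  by_contra h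
  have h0 : ∀ v, w v = 0 := fun v => by
    by_contra hv
    exact h ⟨v, mem_vsupp.2 hv⟩
  have := hw.2
  simp [h0] at this

theorem mem_realization_iff {K : PreAbstractSimplicialComplex X} {w : X → ℝ} :
    w ∈ realization K ↔ w ∈ stdSimplex ℝ X ∧ vsupp w ∈ K.faces := by
  constructor
  · rintro ⟨hw, s, hs, h⟩
    refine ⟨hw, (K.isRelLowerSet_faces hs).2 (fun v hv => ?_) (vsupp_nonempty hw)⟩
    by_contra hvs
    exact mem_vsupp.1 hv (h v hvs)
  · rintro ⟨hw, h⟩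
    exact ⟨hw, _, h, fun v hv => by simpa [mem_vsupp] using hv⟩

theorem isCompact_realization (K : PreAbstractSimplicialComplex X) :
    IsCompact (realization K) := by
  have : realization K = stdSimplex ℝ X ∩
      ⋃ s ∈ K.faces, ⋂ v, ⋂ (_ : v ∉ s), {w : X → ℝ | w v = 0} := by
    ext w
    simp [realization]
  rw [this]
  refine (isCompact_stdSimplex ℝ X).inter_right ?_
  refine Set.Finite.isClosed_biUnion (Set.toFinite _) fun s _ => ?_
  refine isClosed_iInter fun v => isClosed_iInter fun _ => ?_
  exact isClosed_eq (continuous_apply v) continuous_const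

instance (K : PreAbstractSimplicialComplex X) : CompactSpace (realization K) :=
  isCompact_iff_compactSpace.1 (isCompact_realization K)

open Classical in
/-- The barycenter of the simplex with vertex set `s`. -/
noncomputable def barycenter (s : Finset X) : X → ℝ := fun v => if v ∈ s then (s.card : ℝ)⁻¹ else 0

theorem sum_barycenter {s : Finset X} (hs : s.Nonempty) : ∑ v, barycenter s v = 1 := by
  have : (s.card : ℝ) ≠ 0 := by simpa using hs.ne_empty
  simp [barycenter, Finset.sum_ite_mem, mul_inv_cancel₀ this]

/-- A simplicial complex and the complex obtained by removing one maximal face form a conical pair,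
with apex the barycenter of this face. -/
theorem isConical_insert_face {K K' : PreAbstractSimplicialComplex X} {s : Finset X}
    (hs : s.Nonempty) (hK : K.faces = insert s K'.faces) (hsK : s ∉ K'.faces) :
    IsConical (realization K) (realization K') (barycenter s)
      (fun w => s.card * s.inf' hs w) := by
  have hcard : (0 : ℝ) < s.card := by exact_mod_cast hs.card_pos
  have hle : K' ≤ K := fun t ht => by
    rw [hK]; exact .inr ht
  have hmin0 : ∀ w ∈ realization K, 0 ≤ s.inf' hs w := fun w hw =>
    Finset.le_inf' _ _ fun v _ => hw.1.1 v
  have hsupp : ∀ w ∈ realization K, 0 < s.inf' hs w → vsupp w = s := by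
    intro w hw h
    obtain h1 | h1 : vsupp w = s ∨ vsupp w ∈ K'.faces := by
      have := (mem_realization_iff.1 hw).2
      rwa [hK] at this
    · exact h1
    · refine absurd ((K'.isRelLowerSet_faces h1).2 (fun v hv => ?_) hs) hsK
      exact mem_vsupp.2 (h.trans_le (Finset.inf'_le w hv)).ne'
  have hsum : ∀ w ∈ realization K, 0 < s.inf' hs w → ∑ v ∈ s, w v = 1 := by
    intro w hw h
    rw [← hw.1.2, ← hsupp w hw h]
    refine Finset.sum_subset (Finset.subset_univ _) fun v _ hv => ?_
    simpa [mem_vsupp] using hv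
  have hmul : ∀ w ∈ realization K, 0 < s.inf' hs w →
      s.card * s.inf' hs w ≤ 1 := by
    intro w hw h
    rw [← hsum w hw h, ← nsmul_eq_mul]
    exact Finset.card_nsmul_le_sum _ _ _ fun v hv => Finset.inf'_le w hv
  refine ⟨realization_mono hle, ?_, ?_, ?_, ?_, ?_, ?_⟩
  · exact continuous_const.mul
      (Continuous.finset_inf'_apply (f := fun v (w : X → ℝ) => w v) hs
        fun v _ => continuous_apply v)
  · exact fun w hw => mul_nonneg hcard.le (hmin0 w hw)
  · intro w hw
    obtain h | h := (hmin0 w hw).eq_or_lt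
    · rw [← h]; simp
    · exact hmul w hw h
  · intro w hw
    have h0 : (s.card : ℝ) * s.inf' hs w = 0 ↔ s.inf' hs w = 0 := by simp [hcard.ne']
    rw [h0]
    constructor
    · intro hw'
      by_contra h
      have h1 := hsupp w hw (lt_of_le_of_ne (hmin0 w hw) (Ne.symm h))
      exact hsK (h1 ▸ (mem_realization_iff.1 hw').2)
    · intro h
      refine mem_realization_iff.2 ⟨hw.1, ?_⟩
      have h1 := (mem_realization_iff.1 hw).2
      rw [hK] at h1
      refine h1.resolve_left fun h2 => ?_
      obtain ⟨v, hv, hv'⟩ := Finset.exists_mem_eq_inf' hs w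
      rw [h] at hv'
      rw [← h2] at hv
      exact mem_vsupp.1 hv hv'.symm
  · intro w hw h1
    have hpos : 0 < s.inf' hs w := by
      refine lt_of_le_of_ne (hmin0 w hw) fun h => ?_
      rw [← h] at h1
      simp at h1
    have hinf : s.inf' hs w = (s.card : ℝ)⁻¹ := eq_inv_of_mul_eq_one_right h1
    have heq := (Finset.sum_eq_sum_iff_of_le (s := s) (f := fun _ => (s.card : ℝ)⁻¹) (g := w)
      fun v hv => hinf ▸ Finset.inf'_le w hv).1 (by
        rw [hsum w hw hpos]; simp [mul_inv_cancel₀ hcard.ne'])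
    funext v
    by_cases hv : v ∈ s
    · simp [barycenter, hv, ← heq v hv]
    · simp only [barycenter, hv, if_false]
      by_contra h
      exact hv (hsupp w hw hpos ▸ mem_vsupp.2 h)
  · intro w hw h0 h1 a ha
    have hpos : 0 < s.inf' hs w := pos_of_mul_pos_right h0 hcard.le
    set μ := s.inf' hs w with hμ
    have h1' : 0 < 1 - s.card * μ := by linarith
    set k := (1 - a) / (1 - s.card * μ) with hk
    have hk0 : 0 ≤ k := div_nonneg (by linarith [ha.2]) h1'.le
    set w' := k • (w - (s.card * μ) • barycenter s) + a • barycenter s with hw'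
    have hin : ∀ v ∈ s, w' v = k * (w v - μ) + a * (s.card : ℝ)⁻¹ := by
      intro v hv
      simp only [hw', barycenter, Pi.add_apply, Pi.smul_apply, Pi.sub_apply, hv, if_true,
        smul_eq_mul]
      field_simp
    have hout : ∀ v, v ∉ s → w' v = 0 := by
      intro v hv
      have : w v = 0 := by
        by_contra h
        exact hv (hsupp w hw hpos ▸ mem_vsupp.2 h)
      simp [hw', barycenter, hv, this]
    have hge : ∀ v ∈ s, a * (s.card : ℝ)⁻¹ ≤ w' v := by
      intro v hv
      rw [hin v hv]
      have := mul_nonneg hk0 (sub_nonneg.2 (Finset.inf'_le w hv))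
      linarith
    have ha' : 0 ≤ a * (s.card : ℝ)⁻¹ := mul_nonneg ha.1 (by positivity)
    refine ⟨⟨⟨fun v => ?_, ?_⟩, s, ?_, hout⟩, ?_⟩
    · by_cases hv : v ∈ s
      · exact ha'.trans (hge v hv)
      · exact (hout v hv).ge
    · have : ∑ v, w' v = k * (∑ v, w v - s.card * μ * ∑ v, barycenter s v) +
          a * ∑ v, barycenter s v := by
        simp only [hw', Pi.add_apply, Pi.smul_apply, Pi.sub_apply, smul_eq_mul,
          Finset.sum_add_distrib, ← Finset.mul_sum, Finset.sum_sub_distrib]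
      rw [this, sum_barycenter hs, hw.1.2, hk]
      field_simp
      ring
    · rw [hK]; exact .inl rfl
    · obtain ⟨v, hv, hv'⟩ := Finset.exists_mem_eq_inf' hs w
      have : s.inf' hs w' = a * (s.card : ℝ)⁻¹ := by
        refine le_antisymm ?_ (Finset.le_inf' _ _ hge)
        refine (Finset.inf'_le w' hv).trans ?_
        rw [hin v hv, hμ, hv']
        simp
      rw [this]
      field_simp

end Realization

/-! ### Order complexes -/

section OrderComplex

variable {X : Type v} [PartialOrder X]

theorem orderComplex_mono {A B : Set X} (h : A ⊆ B) : orderComplex A ≤ orderComplex B :=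
  fun _ hs => ⟨hs.1, hs.2.1.trans h, hs.2.2⟩

theorem cone_orderComplex {x : X} {L : Set X} (hL : ∀ v ∈ L, v < x) :
    cone x (orderComplex L) = orderComplex (insert x L) := by
  classical
  ext s
  constructor
  · rintro ⟨hs, t, ht, hst⟩
    have htL : (t : Set X) ⊆ L ∧ IsChain (· ≤ ·) (t : Set X) := by
      obtain rfl | ht := ht
      · simp
      · exact ht.2
    refine ⟨hs, hst.trans (Set.insert_subset_insert htL.1), IsChain.mono hst ?_⟩
    exact htL.2.insert fun b hb _ => .inr (hL b (htL.1 hb)).le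
  · rintro ⟨hs, h1, h2⟩
    refine ⟨hs, s.erase x, ?_, ?_⟩
    · obtain h | h := (s.erase x).eq_empty_or_nonempty
      · exact .inl h
      · refine .inr ⟨h, ?_, h2.mono (by simp)⟩
        intro v hv
        simp only [Finset.coe_erase, Set.mem_sdiff, Set.mem_singleton_iff] at hv
        exact (h1 hv.1).resolve_left hv.2
    · intro v hv
      by_cases hvx : v = x
      · exact .inl hvx
      · exact .inr (by simp [hvx]; exact hv)

variable [Fintype X]

/-- The condition that `w` lies in the realization of the order complex of `A`. -/
theorem mem_realization_orderComplex {A : Set X} {w : X → ℝ} :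
    w ∈ realization (orderComplex A) ↔ w ∈ stdSimplex ℝ X ∧ (∀ v, w v ≠ 0 → v ∈ A) ∧
      ∀ u v, w u ≠ 0 → w v ≠ 0 → u ≤ v ∨ v ≤ u := by
  rw [mem_realization_iff]
  refine and_congr_right fun hw => ⟨fun h => ⟨fun v hv => h.2.1 (mem_vsupp.2 hv), ?_⟩, fun h =>
    ⟨vsupp_nonempty hw, fun v hv => h.1 v (mem_vsupp.1 hv), ?_⟩⟩
  · exact fun u v hu hv => h.2.2.total (mem_vsupp.2 hu) (mem_vsupp.2 hv)
  · exact fun u hu v hv _ => h.2 u v (mem_vsupp.1 hu) (mem_vsupp.1 hv)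

theorem realization_orderComplex_mono {A B : Set X} (h : A ⊆ B) :
    realization (orderComplex A) ⊆ realization (orderComplex B) :=
  realization_mono (orderComplex_mono h)

theorem mem_realization_orderComplex_of_subset {A B : Set X} {w : X → ℝ}
    (hw : w ∈ realization (orderComplex A)) (h : ∀ v, w v ≠ 0 → v ∈ B) :
    w ∈ realization (orderComplex B) := by
  rw [mem_realization_orderComplex] at hw ⊢
  exact ⟨hw.1, h, hw.2.2⟩

open Classical in
theorem insert_mem_realization {x : X} {L : Set X} (hL : ∀ v ∈ L, v < x) {w : X → ℝ}
    (hw : w ∈ realization (orderComplex L)) {s : ℝ} (hs : s ∈ Set.Icc (0 : ℝ) 1) :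
    (1 - s) • w + s • Pi.single x 1 ∈ realization (orderComplex (insert x L)) ∧
      ((1 - s) • w + s • (Pi.single x 1 : X → ℝ)) x = s := by
  have hw' := mem_realization_orderComplex.1 hw
  have hx : w x = 0 := by
    by_contra h
    exact lt_irrefl _ (hL x (hw'.2.1 x h))
  have hne : ∀ v, ((1 - s) • w + s • (Pi.single x 1 : X → ℝ)) v ≠ 0 → v = x ∨ w v ≠ 0 := by
    intro v hv
    by_contra hcon
    push Not at hcon
    exact hv (by simp [hcon.1, hcon.2])
  refine ⟨mem_realization_orderComplex.2 ⟨?_, ?_, ?_⟩, by simp [hx]⟩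
  · refine (convex_stdSimplex ℝ X) hw'.1 ?_ (by linarith [hs.2]) hs.1 (by ring)
    exact single_mem_stdSimplex ℝ x
  · intro v hv
    obtain h | h := hne v hv
    · exact .inl h
    · exact .inr (hw'.2.1 v h)
  · intro u v hu hv
    obtain rfl | hu' := hne u hu
    · obtain rfl | hv' := hne v hv
      · exact .inl le_rfl
      · exact .inr (hL _ (hw'.2.1 v hv')).le
    · obtain rfl | hv' := hne v hv
      · exact .inl (hL _ (hw'.2.1 u hu')).le
      · exact hw'.2.2 u v hu' hv'

open Classical in
theorem isConical_insert {x : X} {L : Set X} (hL : ∀ v ∈ L, v < x) :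
    IsConical (realization (orderComplex (insert x L))) (realization (orderComplex L))
      (Pi.single x 1) (fun w => w x) := by
  have hxL : x ∉ L := fun h => lt_irrefl _ (hL x h)
  have key : ∀ w ∈ realization (orderComplex (insert x L)), w x = 0 →
      w ∈ realization (orderComplex L) := by
    intro w hw h0
    refine mem_realization_orderComplex_of_subset hw fun v hv => ?_
    refine ((mem_realization_orderComplex.1 hw).2.1 v hv).resolve_left ?_
    rintro rfl
    exact hv h0
  refine ⟨realization_orderComplex_mono (Set.subset_insert _ _), continuous_apply x,
    fun w hw => hw.1.1 x, ?_, fun w hw => ⟨fun h => ?_, key w hw⟩, ?_, ?_⟩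
  · intro w hw
    rw [← hw.1.2]
    exact Finset.single_le_sum (fun v _ => hw.1.1 v) (Finset.mem_univ x)
  · by_contra hx
    exact hxL ((mem_realization_orderComplex.1 h).2.1 x hx)
  · intro w hw h1
    have h2 := hw.1.2
    rw [← Finset.add_sum_erase _ _ (Finset.mem_univ x), h1] at h2
    have h3 := (Finset.sum_eq_zero_iff_of_nonneg fun v _ => hw.1.1 v).1 (by linarith)
    funext v
    by_cases hv : v = x
    · subst hv; simp [h1]
    · simp [hv, h3 v (by simp [hv])]
  · intro w hw h0 h1 s hs
    have h1' : (1 - w x) ≠ 0 := by linarith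
    -- the projection of `w` to the base
    set w₀ : X → ℝ := (1 - w x)⁻¹ • (w - w x • Pi.single x 1) with hw₀
    have hbase : w₀ ∈ realization (orderComplex L) := by
      have hw₀x : w₀ x = 0 := by simp [hw₀]
      have hw₀v : ∀ v, v ≠ x → w₀ v = (1 - w x)⁻¹ * w v := fun v hv => by simp [hw₀, hv]
      refine key _ (mem_realization_orderComplex.2 ⟨⟨fun v => ?_, ?_⟩, ?_, ?_⟩) hw₀x
      · by_cases hv : v = x
        · rw [hv, hw₀x]
        · rw [hw₀v v hv]
          exact mul_nonneg (inv_nonneg.2 (by linarith)) (hw.1.1 v)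
      · have : ∑ v, w₀ v = (1 - w x)⁻¹ * (∑ v, w v - w x) := by
          simp [hw₀, ← Finset.mul_sum, Finset.sum_sub_distrib]
        rw [this, hw.1.2, inv_mul_cancel₀ h1']
      · intro v hv
        by_cases hvx : v = x
        · exact .inl hvx
        · rw [hw₀v v hvx] at hv
          exact (mem_realization_orderComplex.1 hw).2.1 v (right_ne_zero_of_mul hv)
      · have hne : ∀ v, w₀ v ≠ 0 → w v ≠ 0 := fun v hv => by
          by_cases hvx : v = x
          · subst hvx; exact absurd hw₀x hv
          · rw [hw₀v v hvx] at hv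
            exact right_ne_zero_of_mul hv
        exact fun u v hu hv => (mem_realization_orderComplex.1 hw).2.2 u v (hne u hu) (hne v hv)
    have e : ((1 - s) / (1 - w x)) • (w - w x • (Pi.single x 1 : X → ℝ)) + s • Pi.single x 1 =
        (1 - s) • w₀ + s • Pi.single x 1 := by
      rw [hw₀, smul_smul, div_eq_mul_inv]
    rw [e]
    exact insert_mem_realization hL hbase hs

/-! ### Removing points from a poset -/

theorem isStrongDeformationRetract_insert {x : X} {L : Set X} (hL : ∀ v ∈ L, v < x)
    [ContractibleSpace (realization (orderComplex L))] :
    IsStrongDeformationRetract (realization (orderComplex L))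
      (realization (orderComplex (insert x L))) := by
  classical
  exact (isConical_insert hL).isStrongDeformationRetract (isCompact_realization _)
    fun w hw s hs => insert_mem_realization hL hw hs

/-- Removing a maximal point whose descending link is contractible. -/
theorem isStrongDeformationRetract_remove_maximal {Q L : Set X} {y : X} (hy : y ∈ Q)
    (hmax : ∀ z ∈ Q, ¬ y < z) (hlink : Set.Iio y ∩ Q = L)
    [ContractibleSpace (realization (orderComplex L))] :
    IsStrongDeformationRetract (realization (orderComplex (Q \ {y})))
      (realization (orderComplex Q)) := by
  have hL : ∀ v ∈ L, v < y := fun v hv => by rw [← hlink] at hv; exact hv.1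
  have hLQ : L ⊆ Q \ {y} := by
    rw [← hlink]
    exact fun v hv => ⟨hv.2, fun h => lt_irrefl _ (h ▸ hv.1)⟩
  have e1 : realization (orderComplex Q) = realization (orderComplex (Q \ {y})) ∪
      realization (orderComplex (insert y L)) := by
    ext w
    constructor
    · intro hw
      by_cases h : w y = 0
      · refine .inl (mem_realization_orderComplex_of_subset hw fun v hv =>
          ⟨(mem_realization_orderComplex.1 hw).2.1 v hv, ?_⟩)
        rintro rfl
        exact hv h
      · refine .inr (mem_realization_orderComplex_of_subset hw fun v hv => ?_)
        obtain ⟨-, h2, h3⟩ := mem_realization_orderComplex.1 hw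
        by_cases hvy : v = y
        · exact .inl hvy
        · right
          rw [← hlink]
          refine ⟨?_, h2 v hv⟩
          obtain h4 | h4 := h3 v y hv h
          · exact lt_of_le_of_ne h4 hvy
          · exact absurd (lt_of_le_of_ne h4 (Ne.symm hvy)) (hmax v (h2 v hv))
    · rintro (hw | hw)
      · exact realization_orderComplex_mono Set.sdiff_subset hw
      · refine realization_orderComplex_mono ?_ hw
        exact Set.insert_subset hy (hLQ.trans Set.sdiff_subset)
  have e2 : realization (orderComplex (Q \ {y})) ∩ realization (orderComplex (insert y L)) =
      realization (orderComplex L) := by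
    ext w
    constructor
    · rintro ⟨h1, h2⟩
      refine mem_realization_orderComplex_of_subset h2 fun v hv => ?_
      exact ((mem_realization_orderComplex.1 h2).2.1 v hv).resolve_left
        ((mem_realization_orderComplex.1 h1).2.1 v hv).2
    · exact fun hw => ⟨realization_orderComplex_mono hLQ hw,
        realization_orderComplex_mono (Set.subset_insert _ _) hw⟩
  rw [e1]
  refine IsStrongDeformationRetract.union (isCompact_realization _).isClosed
    (isCompact_realization _).isClosed ?_
  rw [e2]
  exact isStrongDeformationRetract_insert hL

open Classical in
/-- Removing a point `x` that has a least point `y` above it, by the deformation that moves the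
weight of `x` to `y`. -/
theorem isStrongDeformationRetract_remove_beat {Q : Set X} {x y : X} (hy : y ∈ Q) (hxy : x < y)
    (hup : ∀ z ∈ Q, x < z → y ≤ z) :
    IsStrongDeformationRetract (realization (orderComplex (Q \ {x})))
      (realization (orderComplex Q)) := by
  let d : X → ℝ := Pi.single y 1 - Pi.single x 1
  have hdx : d x = -1 := by simp [d, hxy.ne]
  have hdy : d y = 1 := by simp [d, hxy.ne']
  have hdv : ∀ v, v ≠ x → v ≠ y → d v = 0 := fun v h1 h2 => by simp [d, h1, h2]
  have hmem : ∀ w ∈ realization (orderComplex Q), ∀ t ∈ Set.Icc (0 : ℝ) 1,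
      w + (t * w x) • d ∈ realization (orderComplex Q) := by
    intro w hw t ht
    obtain ⟨h1, h2, h3⟩ := mem_realization_orderComplex.1 hw
    have hwx := h1.1 x
    have hne : ∀ v, (w + (t * w x) • d) v ≠ 0 → w v ≠ 0 ∨ (v = y ∧ w x ≠ 0) := by
      intro v hv
      by_contra hcon
      push Not at hcon
      by_cases hvx : v = x
      · subst hvx
        simp [hcon.1] at hv
      by_cases hvy : v = y
      · simp [hcon.1, hcon.2 hvy] at hv
      · simp [hcon.1, hdv v hvx hvy] at hv
    -- a point of the chain is comparable with `y` as soon as `x` belongs to the chain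
    have hcomp : ∀ v, w v ≠ 0 → w x ≠ 0 → v ≤ y ∨ y ≤ v := by
      intro v hv hx
      obtain h | h := h3 v x hv hx
      · exact .inl (h.trans hxy.le)
      · obtain rfl | h := h.eq_or_lt
        · exact .inl hxy.le
        · exact .inr (hup v (h2 v hv) h)
    refine mem_realization_orderComplex.2 ⟨⟨fun v => ?_, ?_⟩, ?_, ?_⟩
    · by_cases hvx : v = x
      · subst hvx
        simp only [Pi.add_apply, Pi.smul_apply, hdx, smul_eq_mul]
        nlinarith [ht.2]
      by_cases hvy : v = y
      · subst hvy
        simp only [Pi.add_apply, Pi.smul_apply, hdy, smul_eq_mul]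
        have := h1.1 v
        have := mul_nonneg ht.1 hwx
        linarith
      · simpa [hdv v hvx hvy] using h1.1 v
    · have : ∑ v, d v = 0 := by simp [d]
      simp only [Pi.add_apply, Pi.smul_apply, smul_eq_mul, Finset.sum_add_distrib,
        ← Finset.mul_sum, this, h1.2]
      simp
    · intro v hv
      obtain h | ⟨rfl, -⟩ := hne v hv
      · exact h2 v h
      · exact hy
    · intro u v hu hv
      obtain hu' | ⟨rfl, hx⟩ := hne u hu
      · obtain hv' | ⟨rfl, hx⟩ := hne v hv
        · exact h3 u v hu' hv'
        · exact hcomp u hu' hx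
      · obtain hv' | ⟨rfl, -⟩ := hne v hv
        · exact (hcomp v hv' hx).symm
        · exact .inl le_rfl
  have hx : Continuous fun w : realization (orderComplex Q) => (w : X → ℝ) x :=
    (continuous_apply x).comp continuous_subtype_val
  refine isStrongDeformationRetract_of_path (realization_orderComplex_mono Set.sdiff_subset)
    (ContinuousMap.curry ⟨fun p : realization (orderComplex Q) × I =>
      ⟨(p.1 : X → ℝ) + ((p.2 : ℝ) * (p.1 : X → ℝ) x) • d, hmem _ p.1.2 _ p.2.2⟩, by
        refine Continuous.subtype_mk ?_ _
        exact (continuous_subtype_val.comp continuous_fst).add (((continuous_subtype_val.comp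
          continuous_snd).mul (hx.comp continuous_fst)).smul continuous_const)⟩)
    (fun w => ?_) (fun w => ?_) (fun w hw t => ?_)
  · ext1; simp
  · have h1 := hmem w w.2 1 ⟨zero_le_one, le_rfl⟩
    refine mem_realization_orderComplex_of_subset (A := Q) (by simpa using h1) fun v hv => ?_
    simp only [ContinuousMap.curry_apply, ContinuousMap.coe_mk, Set.Icc.coe_one, one_mul] at hv h1
    refine ⟨(mem_realization_orderComplex.1 h1).2.1 v hv, ?_⟩
    rintro rfl
    simp [hdx] at hv
  · ext1
    have : (w : X → ℝ) x = 0 := by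
      by_contra h
      exact ((mem_realization_orderComplex.1 hw).2.1 x h).2 rfl
    simp [this]

end OrderComplex

/-! ### Gluing cones over descending links -/

section Cones

variable {X : Type v} [PartialOrder X]

theorem cone_link (x : X) : cone x (orderComplex (Set.Iio x)) = orderComplex (Set.Iic x) := by
  rw [cone_orderComplex (L := Set.Iio x) fun v hv => hv, Set.Iio_insert]

/-- A chain that contains a point of `C`, which is maximal, lies in the closed lower set of this
point. -/
theorem orderComplex_eq_sup_cones {A B C : Set X} (hA : A = B ∪ C)
    (hmax : ∀ x ∈ C, ∀ z ∈ A, ¬ x < z) (hlink : ∀ x ∈ C, Set.Iio x ⊆ B) :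
    orderComplex A = orderComplex B ⊔ ⨆ x ∈ C, cone x (orderComplex (Set.Iio x)) := by
  apply le_antisymm
  · intro s hs
    by_cases h : (s : Set X) ⊆ B
    · exact (le_sup_left : orderComplex B ≤ _) ⟨hs.1, h, hs.2.2⟩
    · obtain ⟨x, hxs, hxB⟩ := Set.not_subset.1 h
      have hxC : x ∈ C := by
        have := hs.2.1 hxs
        rw [hA] at this
        exact this.resolve_left hxB
      refine ((le_iSup₂ (f := fun x (_ : x ∈ C) => cone x (orderComplex (Set.Iio x))) x hxC).trans
        le_sup_right) ?_
      change s ∈ (cone x (orderComplex (Set.Iio x))).faces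
      rw [cone_link]
      refine ⟨hs.1, fun v hv => ?_, hs.2.2⟩
      obtain h | h := hs.2.2.total hv hxs
      · exact h
      · obtain rfl | h := h.eq_or_lt
        · exact le_rfl
        · exact absurd h (hmax x hxC v (hs.2.1 hv))
  · refine sup_le (orderComplex_mono (hA ▸ Set.subset_union_left)) (iSup₂_le fun x hx => ?_)
    rw [cone_link]
    refine orderComplex_mono ?_
    rw [← Set.Iio_insert, hA]
    exact Set.insert_subset (.inr hx) ((hlink x hx).trans Set.subset_union_left)

theorem orderComplex_inf_cone {B C : Set X} (hBC : Disjoint B C)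
    (hlink : ∀ x ∈ C, Set.Iio x ⊆ B) {x : X} (hx : x ∈ C) :
    orderComplex B ⊓ cone x (orderComplex (Set.Iio x)) = orderComplex (Set.Iio x) := by
  apply le_antisymm
  · rintro s ⟨h1, h2⟩
    rw [cone_link] at h2
    refine ⟨h1.1, fun v hv => lt_of_le_of_ne (h2.2.1 hv) ?_, h1.2.2⟩
    rintro rfl
    exact hBC.notMem_of_mem_left (h1.2.1 hv) hx
  · exact le_inf (orderComplex_mono (hlink x hx)) (le_cone _ _)

variable [Fintype X]

theorem linkInclusion_injective (C : Set X) : Function.Injective (linkInclusion C) := by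
  rintro ⟨x, w⟩ ⟨x', w'⟩ h
  obtain rfl : x = x' := congrArg Sigma.fst h
  exact congrArg (Sigma.mk x) (Set.inclusion_injective _ (eq_of_heq (Sigma.mk.inj h).2))

theorem hasExtension_linkInclusion (C : Set X) : HasExtension (linkInclusion C) 0 := by
  classical
  intro T _ c η hη
  have key : ∀ x : C, ∃ E : C(realization (cone (x : X) (orderComplex (Set.Iio (x : X)))) × I, T),
      (∀ z, E (z, 0) = c ⟨x, z⟩) ∧
        ∀ w t, E (incl (realization_mono (le_cone _ _)) w, t) = η (⟨x, w⟩, t) := by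
    intro x
    have h : IsConical (realization (cone (x : X) (orderComplex (Set.Iio (x : X)))))
        (realization (orderComplex (Set.Iio (x : X)))) (Pi.single (x : X) 1) (fun w => w x) := by
      rw [cone_orderComplex (L := Set.Iio (x : X)) fun v hv => hv]
      exact isConical_insert fun v hv => hv
    let inc : C(realization (orderComplex (Set.Iio (x : X))), LinkSum C) :=
      ContinuousMap.sigmaMk (X := fun x : C => realization (orderComplex (Set.Iio (x : X)))) x
    exact h.hasExtension (T := T) ⟨fun z => c ⟨x, z⟩, c.continuous.comp continuous_sigmaMk⟩
      (η.comp (inc.prodMap (.id I))) (fun w => hη ⟨x, w⟩)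
  choose E E0 E1 using key
  let F : C(ConeSum C, C(I, T)) := ContinuousMap.sigma fun x => (E x).curry
  exact ⟨⟨fun p => F p.1 p.2, by fun_prop⟩, fun z => E0 z.1 z.2, fun w t => E1 w.1 w.2 t⟩

/-- The inclusion of the descending links of the points of `C` in the order complex of `B`. -/
def linksTo {B C : Set X} (h : ∀ x ∈ C, Set.Iio x ⊆ B) :
    C(LinkSum C, realization (orderComplex B)) :=
  ContinuousMap.sigma fun x => incl (realization_orderComplex_mono (h x x.2))

theorem realization_cone_link_subset {A C : Set X} (h : ∀ x ∈ C, Set.Iic x ⊆ A) (x : C) :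
    realization (cone (x : X) (orderComplex (Set.Iio (x : X)))) ⊆ realization (orderComplex A) := by
  rw [cone_link]
  exact realization_orderComplex_mono (h x x.2)

/-- The inclusion of the cones over the descending links of the points of `C` in the order complex
of `A`. -/
def conesTo {A C : Set X} (h : ∀ x ∈ C, Set.Iic x ⊆ A) :
    C(ConeSum C, realization (orderComplex A)) :=
  ContinuousMap.sigma fun x => incl (realization_cone_link_subset h x)

theorem mem_link_of_mem_cone {x : X} {w : X → ℝ}
    (hw : w ∈ realization (cone x (orderComplex (Set.Iio x)))) (h : w x = 0) :
    w ∈ realization (orderComplex (Set.Iio x)) := by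
  rw [cone_link] at hw
  refine mem_realization_orderComplex_of_subset hw fun v hv =>
    lt_of_le_of_ne ((mem_realization_orderComplex.1 hw).2.1 v hv) ?_
  rintro rfl
  exact hv h

/-- Adding maximal points to a subposet glues the cones over their descending links. -/
theorem isGlue_cones {A B C : Set X} (hA : A = B ∪ C) (hBC : Disjoint B C)
    (hmax : ∀ x ∈ C, ∀ z ∈ A, ¬ x < z) (hlink : ∀ x ∈ C, Set.Iio x ⊆ B) :
    IsGlue (linkInclusion C) (linksTo hlink)
    (incl (realization_orderComplex_mono (hA ▸ Set.subset_union_left)) :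
      C(realization (orderComplex B), realization (orderComplex A)))
    (conesTo fun x hx => by
      rw [← Set.Iio_insert, hA]
      exact Set.insert_subset (.inr hx) ((hlink x hx).trans Set.subset_union_left)) := by
  have hsub : ∀ x ∈ C, Set.Iic x ⊆ A := fun x hx => by
    rw [← Set.Iio_insert, hA]
    exact Set.insert_subset (.inr hx) ((hlink x hx).trans Set.subset_union_left)
  have hBA : realization (orderComplex B) ⊆ realization (orderComplex A) :=
    realization_orderComplex_mono (hA ▸ Set.subset_union_left)
  have hsurj : ∀ p : realization (orderComplex A), (∃ a, incl hBA a = p) ∨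
      ∃ z, conesTo hsub z = p := by
    rintro ⟨w, hw⟩
    by_cases h : ∀ v, w v ≠ 0 → v ∈ B
    · exact .inl ⟨⟨w, mem_realization_orderComplex_of_subset hw h⟩, rfl⟩
    · push Not at h
      obtain ⟨x, hx, hxB⟩ := h
      obtain ⟨-, h2, h3⟩ := mem_realization_orderComplex.1 hw
      have hxC : x ∈ C := by
        have := h2 x hx
        rw [hA] at this
        exact this.resolve_left hxB
      refine .inr ⟨⟨⟨x, hxC⟩, w, ?_⟩, rfl⟩
      rw [cone_link]
      refine mem_realization_orderComplex_of_subset hw fun v hv => ?_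
      obtain h | h := h3 v x hv hx
      · exact h
      · obtain rfl | h := h.eq_or_lt
        · exact le_rfl
        · exact absurd h (hmax x hxC v (h2 v hv))
  refine ⟨fun w => rfl, ?_, hsurj⟩
  intro T _ a c hac
  let q : C(realization (orderComplex B) ⊕ ConeSum C, realization (orderComplex A)) :=
    ⟨Sum.elim (incl hBA) (conesTo hsub), by fun_prop⟩
  have hq : IsQuotientMap q := by
    refine IsClosedMap.isQuotientMap q.continuous.isClosedMap q.continuous fun w => ?_
    obtain ⟨x, hx⟩ | ⟨z, hz⟩ := hsurj w
    · exact ⟨.inl x, hx⟩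
    · exact ⟨.inr z, hz⟩
  -- a point of a cone with vanishing weight at the apex comes from the base
  have hbase : ∀ (x : C) (w) (hw : w ∈ realization (cone (x : X) (orderComplex (Set.Iio (x : X))))),
      w x = 0 → ∀ hw' : w ∈ realization (orderComplex B), c ⟨x, ⟨w, hw⟩⟩ = a ⟨w, hw'⟩ := by
    intro x w hw h0 hw'
    exact (hac ⟨x, ⟨w, mem_link_of_mem_cone hw h0⟩⟩).symm
  have hzero : ∀ (x : C) (w), w ∈ realization (orderComplex B) → w x = 0 := by
    intro x w hw
    by_contra h
    exact hBC.notMem_of_mem_left ((mem_realization_orderComplex.1 hw).2.1 x h) x.2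
  obtain ⟨k, hk⟩ := exists_lift_of_isQuotientMap hq ⟨Sum.elim a c, by fun_prop⟩ (by
    rintro (⟨w, hw⟩ | ⟨x, w, hw⟩) (⟨w', hw'⟩ | ⟨x', w', hw'⟩) h
    · obtain rfl : w = w' := congrArg Subtype.val h
      rfl
    · obtain rfl : w = w' := congrArg Subtype.val h
      exact (hbase x' w hw' (hzero x' w hw) hw).symm
    · obtain rfl : w = w' := congrArg Subtype.val h
      exact hbase x w hw (hzero x w hw') hw'
    · obtain rfl : w = w' := congrArg Subtype.val h
      by_cases hx : x = x'
      · subst hx; rfl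
      have hx' : (x : X) ≠ x' := fun h => hx (Subtype.ext h)
      have h0 : ∀ y y' : C, (y : X) ≠ y' →
          w ∈ realization (cone (y' : X) (orderComplex (Set.Iio (y' : X)))) → w y = 0 := by
        intro y y' hy hw
        by_contra hcon
        rw [cone_link] at hw
        exact hmax y y.2 y' (hA ▸ .inr y'.2)
          (lt_of_le_of_ne ((mem_realization_orderComplex.1 hw).2.1 y hcon) hy)
      have hx0 := h0 x x' hx' hw'
      have hwB := realization_orderComplex_mono (hlink x x.2) (mem_link_of_mem_cone hw hx0)
      exact (hbase x w hw hx0 hwB).trans (hbase x' w hw' (h0 x' x hx'.symm hw) hwB).symm)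
  exact ⟨k, fun x => hk (.inl x), fun z => hk (.inr z)⟩

end Cones

/-! ### The filtration given by a Morse function and an admissible Morse matching -/

section Filtration

/-- The points of value at most `t` that are not the lower end of an edge of the matching that
starts at the level `t`. -/
def levelSet {X : Type*} (f : X → ℝ) (M : Set (X × X)) (t : ℝ) : Set X :=
  {z | f z ≤ t ∧ ∀ e ∈ M, e.1 = z → f z ≠ t}

/-- The points of value at most `t`, and the upper ends of the edges of the matching that start at
the level `t`. -/
def thickLevelSet {X : Type*} (f : X → ℝ) (M : Set (X × X)) (t : ℝ) : Set X :=
  {z | f z ≤ t ∨ ∃ e ∈ M, e.2 = z ∧ f e.1 = t}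

theorem levelSet_subset_thickLevelSet {X : Type*} {f : X → ℝ} {M : Set (X × X)} (t : ℝ) :
    levelSet f M t ⊆ thickLevelSet f M t :=
  fun _ hz => .inl hz.1

variable {X : Type v} [PartialOrder X] [Fintype X]

theorem IsMorseFunction.strictMono {f : X → ℝ} (hf : IsMorseFunction f) : StrictMono f := by
  classical
  let := Fintype.toLocallyFiniteOrder (α := X)
  exact (strictMono_iff_forall_covBy f).2 hf

variable {f : X → ℝ} {M : Set (X × X)}

/-- The endpoints of a set of edges. -/
def endpoints (N : Set (X × X)) : Set X := {z | ∃ e ∈ N, e.1 = z ∨ e.2 = z}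

/-- Points of `A`, all of value at most `t`, together with the endpoints of edges of the matching
that start at the level `t`: these edges can be removed one after the other. -/
theorem isStrongDeformationRetract_endpoints (hf : IsMorseFunction f)
    (hM : IsAdmissibleMorseMatching f M) {t : ℝ} {A : Set X} (hA : ∀ z ∈ A, f z ≤ t)
    (N : Finset (X × X)) (hN : ∀ e ∈ N, e ∈ M ∧ f e.1 = t)
    (hNA : ∀ e ∈ N, e.1 ∉ A ∧ e.2 ∉ A)
    (hlow : ∀ e ∈ N, ∀ z < e.2, z ∈ A ∪ endpoints (N : Set (X × X))) :
    IsStrongDeformationRetract (realization (orderComplex A))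
      (realization (orderComplex (A ∪ endpoints (N : Set (X × X))))) := by
  classical
  have hmono := hf.strictMono
  induction hn : N.card generalizing N with
  | zero =>
    obtain rfl := Finset.card_eq_zero.1 hn
    have : A ∪ endpoints ((∅ : Finset (X × X)) : Set (X × X)) = A := by simp [endpoints]
    rw [this]
    exact .refl _
  | succ n ih =>
    have hne : N.Nonempty := Finset.card_pos.1 (by omega)
    -- by acyclicity, there is an edge whose lower end lies under no other upper end
    obtain ⟨e, he, hemin⟩ : ∃ e ∈ N, ∀ e' ∈ N, e.1 < e'.2 → e' = e := by
      have : Std.Irrefl (Relation.TransGen (modifiedHasse M)) := ⟨hM.acyclic⟩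
      obtain ⟨_, ⟨e, he, rfl⟩, hmin⟩ := (Finite.wellFounded_of_trans_of_irrefl
        (Relation.TransGen (modifiedHasse M))).has_min (Prod.snd '' (N : Set (X × X)))
        (Set.Nonempty.image _ hne)
      refine ⟨e, he, fun e' he' hlt => ?_⟩
      by_contra hcon
      have hcov : e.1 ⋖ e'.2 := by
        refine ⟨hlt, fun z h1 h2 => (hM.admissible e' (hN e' he').1).no_value_between
          ⟨z, ?_, hmono h2⟩⟩
        rw [(hN e' he').2, ← (hN e he).2]
        exact hmono h1
      refine hmin e'.2 ⟨e', he', rfl⟩ (.head (b := e.1) (.inr ⟨hcov, fun hmem => hcon ?_⟩)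
        (.single (.inl ⟨hM.covBy e (hN e he).1, (hN e he).1⟩)))
      have h1 := hM.eq_of_share _ hmem e (hN e he).1 (.inl rfl)
      have h2 := hM.eq_of_share _ hmem e' (hN e' he').1 (.inr (.inr (.inr rfl)))
      exact h2.symm.trans h1
    obtain ⟨heM, het⟩ := hN e he
    have hadm := hM.admissible e heM
    set Q := A ∪ endpoints (N : Set (X × X)) with hQ
    have he1 : e.1 ∈ Q := .inr ⟨e, he, .inl rfl⟩
    have he2 : e.2 ∈ Q := .inr ⟨e, he, .inr rfl⟩
    have hlt : e.1 < e.2 := hadm.covBy.lt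
    -- the values on `Q` are at most that of the upper end
    have hle : ∀ z ∈ Q, f z ≤ f e.2 := by
      rintro z (hz | ⟨e', he', rfl | rfl⟩)
      · exact (hA z hz).trans (het ▸ (hmono hlt).le)
      · rw [(hN e' he').2, ← het]; exact (hmono hlt).le
      · by_contra hcon
        push Not at hcon
        refine (hM.admissible e' (hN e' he').1).no_value_between ⟨e.2, ?_, hcon⟩
        rw [(hN e' he').2, ← het]; exact hmono hlt
    have hup : ∀ z ∈ Q, e.1 < z → z = e.2 := by
      rintro z (hz | ⟨e', he', rfl | rfl⟩) h
      · exact absurd (hA z hz) (not_le.2 (het ▸ hmono h))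
      · have := hmono h
        rw [(hN e' he').2, het] at this
        exact absurd this (lt_irrefl _)
      · rw [hemin e' he' h]
    have hrem : A ∪ endpoints ((N.erase e : Finset (X × X)) : Set (X × X)) =
        (Q \ {e.1}) \ {e.2} := by
      ext z
      constructor
      · rintro (hz | ⟨e', he', h⟩)
        · exact ⟨⟨.inl hz, fun h => (hNA e he).1 (h ▸ hz)⟩, fun h => (hNA e he).2 (h ▸ hz)⟩
        · simp only [Finset.coe_erase, Set.mem_sdiff, Set.mem_singleton_iff] at he'
          have hshare := fun h => he'.2 (hM.eq_of_share e' (hN e' he'.1).1 e heM h)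
          refine ⟨⟨.inr ⟨e', he'.1, h⟩, ?_⟩, ?_⟩ <;> intro hz <;> rw [Set.mem_singleton_iff] at hz
          · obtain h | h := h
            · exact hshare (.inl (h.trans hz))
            · exact hshare (.inr (.inr (.inl (h.trans hz))))
          · obtain h | h := h
            · exact hshare (.inr (.inl (h.trans hz)))
            · exact hshare (.inr (.inr (.inr (h.trans hz))))
      · rintro ⟨⟨hz | ⟨e', he', h⟩, h1⟩, h2⟩
        · exact .inl hz
        · refine .inr ⟨e', ?_, h⟩
          simp only [Finset.coe_erase, Set.mem_sdiff, Set.mem_singleton_iff]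
          refine ⟨he', ?_⟩
          rintro rfl
          obtain h | h := h
          · exact h1 h.symm
          · exact h2 h.symm
    have step : IsStrongDeformationRetract
        (realization (orderComplex (A ∪ endpoints ((N.erase e : Finset (X × X)) : Set (X × X)))))
        (realization (orderComplex Q)) := by
      rw [hrem]
      have := hadm.contractible
      -- remove the lower end `e.1`, whose only successor in `Q` is `e.2`; then `e.2` is maximal, with
      -- descending link the contractible complex in the definition of admissibility
      refine (isStrongDeformationRetract_remove_maximal (Q := Q \ {e.1})
        (L := Set.Iio e.2 \ {e.1}) ⟨he2, hlt.ne'⟩ (fun z hz h => ?_) ?_).trans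
        (isStrongDeformationRetract_remove_beat he2 hlt fun z hz h => (hup z hz h).ge)
      · exact absurd (hle z hz.1) (not_le.2 (hmono h))
      · ext z
        constructor
        · exact fun h => ⟨h.1, h.2.2⟩
        · exact fun h => ⟨h.1, hlow e he z h.1, h.2⟩
    refine (ih (N.erase e) (fun e' he' => hN e' (Finset.mem_of_mem_erase he'))
      (fun e' he' => hNA e' (Finset.mem_of_mem_erase he')) ?_ ?_).trans step
    · intro e' he' z hz
      have hne' := Finset.ne_of_mem_erase he'
      have he'N := Finset.mem_of_mem_erase he'
      rw [hrem]
      refine ⟨⟨hlow e' he'N z hz, ?_⟩, ?_⟩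
      · rintro rfl
        exact hne' (hemin e' he'N hz)
      · rintro rfl
        exact absurd (hle e'.2 (.inr ⟨e', he'N, .inr rfl⟩)) (not_le.2 (hmono hz))
    · rw [Finset.card_erase_of_mem he, hn]; rfl

/-- The points in which the two level sets differ are the endpoints of the edges of the matching that
start at the level `t`, so removing these edges is a deformation retraction. -/
theorem isStrongDeformationRetract_levelSet (hf : IsMorseFunction f)
    (hM : IsAdmissibleMorseMatching f M) (t : ℝ) :
    IsStrongDeformationRetract (realization (orderComplex (levelSet f M t)))
      (realization (orderComplex (thickLevelSet f M t))) := by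
  classical
  have hmono := hf.strictMono
  let N : Finset (X × X) := Finset.univ.filter fun e => e ∈ M ∧ f e.1 = t
  have hN : ∀ e, e ∈ N ↔ e ∈ M ∧ f e.1 = t := fun e => by simp [N]
  have hlt : ∀ e ∈ N, t < f e.2 := fun e he => by
    rw [← ((hN e).1 he).2]
    exact hmono (hM.covBy e ((hN e).1 he).1).lt
  have hthick : thickLevelSet f M t = levelSet f M t ∪ endpoints (N : Set (X × X)) := by
    ext z
    constructor
    · rintro (hz | ⟨e, he, rfl, het⟩)
      · by_cases h : ∃ e ∈ M, e.1 = z ∧ f z = t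
        · obtain ⟨e, he, rfl, het⟩ := h
          exact .inr ⟨e, (hN e).2 ⟨he, het⟩, .inl rfl⟩
        · push Not at h
          exact .inl ⟨hz, h⟩
      · exact .inr ⟨e, (hN e).2 ⟨he, het⟩, .inr rfl⟩
    · rintro (hz | ⟨e, he, rfl | rfl⟩)
      · exact .inl hz.1
      · exact .inl ((hN e).1 he).2.le
      · exact .inr ⟨e, ((hN e).1 he).1, rfl, ((hN e).1 he).2⟩
  have := isStrongDeformationRetract_endpoints hf hM (t := t) (A := levelSet f M t)
    (fun z hz => hz.1) N (fun e he => (hN e).1 he) (fun e he => ⟨fun h => ?_, fun h => ?_⟩) ?_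
  · rwa [← hthick] at this
  · exact h.2 e ((hN e).1 he).1 rfl ((hN e).1 he).2
  · exact absurd h.1 (not_le.2 (hlt e he))
  · intro e he z hz
    rw [← hthick]
    left
    by_contra hcon
    push Not at hcon
    refine (hM.admissible e ((hN e).1 he).1).no_value_between ⟨z, ?_, hmono hz⟩
    rw [((hN e).1 he).2]; exact hcon

end Filtration

/-! ### Pushing maps off a cell -/

section Push

theorem homotopicRel_mono {X Y : Type*} [TopologicalSpace X] [TopologicalSpace Y] {f g : C(X, Y)}
    {S T : Set X} (h : f.HomotopicRel g T) (hST : S ⊆ T) : f.HomotopicRel g S :=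
  h.map fun F => ⟨F.toHomotopy, fun t x hx => F.prop' t x (hST hx)⟩

variable {Y : Type*} [TopologicalSpace Y] {m : ℕ}

/-- `c` is the characteristic map of an `m`-cell whose boundary lies in the closed set `B` and whose
interior is disjoint from `B`. -/
structure IsCellOver (c : PartialEquiv (Fin m → ℝ) Y) (B : Set Y) : Prop where
  isClosed : IsClosed B
  source_eq : c.source = ball 0 1
  continuousOn : ContinuousOn c (closedBall 0 1)
  continuousOn_symm : ContinuousOn c.symm c.target
  sphere_mem : ∀ u ∈ sphere (0 : Fin m → ℝ) 1, c u ∈ B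
  ball_notMem : ∀ u ∈ ball (0 : Fin m → ℝ) 1, c u ∉ B

theorem IsCellOver.injOn {c : PartialEquiv (Fin m → ℝ) Y} {B : Set Y} (hc : IsCellOver c B)
    {u v : Fin m → ℝ} (hu : ‖u‖ < 1) (hv : ‖v‖ < 1) (h : c u = c v) : u = v :=
  c.injOn (by rw [hc.source_eq]; simpa using hu) (by rw [hc.source_eq]; simpa using hv) h

theorem IsCellOver.norm_eq_one {c : PartialEquiv (Fin m → ℝ) Y} {B : Set Y} (hc : IsCellOver c B)
    {u : Fin m → ℝ} (hu : ‖u‖ ≤ 1) (h : c u ∈ B) : ‖u‖ = 1 := by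
  by_contra hne
  exact hc.ball_notMem u (by simpa using lt_of_le_of_ne hu hne) h

variable [T2Space Y]

/-- A map that misses the center of a cell is pushed radially into the boundary of the cell. -/
theorem IsCellOver.exists_homotopicRel_of_ne_center
    {c : PartialEquiv (Fin m → ℝ) Y} {B : Set Y} (hc : IsCellOver c B)
    {Q : Type*} [TopologicalSpace Q] [CompactSpace Q] [T2Space Q] (g : C(Q, Y))
    (hg : ∀ z, g z ∈ B ∨ ∃ u, ‖u‖ < 1 ∧ u ≠ 0 ∧ c u = g z) :
    ∃ g' : C(Q, Y), g.HomotopicRel g' {z | g z ∈ B} ∧ ∀ z, g' z ∈ B := by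
  -- the points of `Q` mapped to the closed cell, together with their coordinates in the cell
  let T : Set (Q × (Fin m → ℝ)) := {p | p.2 ∈ closedBall 0 1 ∧ c p.2 = g p.1}
  have hT : IsClosed T := by
    have : T = (Set.univ ×ˢ closedBall 0 1) ∩
        (fun p : Q × (Fin m → ℝ) => (c p.2, g p.1)) ⁻¹' {y | y.1 = y.2} := by
      ext p; simp [T]
    rw [this]
    refine ContinuousOn.preimage_isClosed_of_isClosed (ContinuousOn.prodMk ?_ ?_)
      (isClosed_univ.prod isClosed_closedBall) (isClosed_eq continuous_fst continuous_snd)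
    · exact hc.continuousOn.comp continuous_snd.continuousOn fun p hp => hp.2
    · exact (g.continuous.comp continuous_fst).continuousOn
  have hTc : IsCompact T := (isCompact_univ.prod (isCompact_closedBall 0 1)).of_isClosed_subset hT
    fun p hp => ⟨trivial, hp.1⟩
  have : CompactSpace T := isCompact_iff_compactSpace.1 hTc
  have hF : IsClosed {z | g z ∈ B} := hc.isClosed.preimage g.continuous
  have : CompactSpace {z | g z ∈ B} := isCompact_iff_compactSpace.1 hF.isCompact
  have hTle : ∀ p : T, ‖p.1.2‖ ≤ 1 := fun p => by simpa using p.2.1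
  have hTne : ∀ p : T, p.1.2 ≠ 0 := by
    intro p h0
    obtain h | ⟨u, hu, hu0, h⟩ := hg p.1.1
    · have := hc.norm_eq_one (hTle p) (by rw [p.2.2]; exact h)
      simp [h0] at this
    · refine hu0 (hc.injOn hu (v := p.1.2) (by simp [h0]) (h.trans p.2.2.symm) |>.trans h0)
  let q : C({z | g z ∈ B} ⊕ T, Q) := ⟨Sum.elim (fun z => z) (fun p => p.1.1), by fun_prop⟩
  have hq : IsQuotientMap q := by
    refine IsClosedMap.isQuotientMap q.continuous.isClosedMap q.continuous fun z => ?_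
    obtain h | ⟨u, hu, hu0, h⟩ := hg z
    · exact ⟨.inl ⟨z, h⟩, rfl⟩
    · exact ⟨.inr ⟨(z, u), by simpa using hu.le, h⟩, rfl⟩
  let rad : T × I → (Fin m → ℝ) := fun p =>
    ((1 - (p.2 : ℝ)) + p.2 * ‖p.1.1.2‖⁻¹) • p.1.1.2
  have hrad : Continuous rad := by
    have h1 : Continuous fun p : T × I => p.1.1.2 := by fun_prop
    have h2 : Continuous fun p : T × I => ‖p.1.1.2‖⁻¹ :=
      h1.norm.inv₀ fun p => norm_ne_zero_iff.2 (hTne p.1)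
    fun_prop
  have hradn : ∀ p : T × I, ‖rad p‖ = (1 - p.2) * ‖p.1.1.2‖ + p.2 := by
    intro p
    have h0 : ‖p.1.1.2‖ ≠ 0 := norm_ne_zero_iff.2 (hTne p.1)
    have h1 : 0 ≤ (1 - (p.2 : ℝ)) + p.2 * ‖p.1.1.2‖⁻¹ :=
      add_nonneg (by linarith [p.2.2.2]) (mul_nonneg p.2.2.1 (by positivity))
    simp only [rad, norm_smul, Real.norm_of_nonneg h1]
    field_simp
  have hradb : ∀ p, rad p ∈ closedBall 0 1 := by
    intro p
    rw [mem_closedBall_zero_iff, hradn]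
    nlinarith [hTle p.1, p.2.2.1, p.2.2.2]
  have hrad1 : ∀ p : T × I, ‖p.1.1.2‖ = 1 → rad p = p.1.1.2 := by
    intro p h
    simp [rad, h]
  let K : C(T, C(I, Y)) := ContinuousMap.curry
    ⟨fun p => c (rad p), hc.continuousOn.comp_continuous hrad hradb⟩
  let L : C({z | g z ∈ B}, C(I, Y)) := ContinuousMap.curry
    ⟨fun p : {z | g z ∈ B} × I => g p.1, by fun_prop⟩
  have hLK : ∀ (z : {z | g z ∈ B}) (p : T), z.1 = p.1.1 → L z = K p := by
    intro z p h
    ext t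
    change g z = c (rad (p, t))
    have := hc.norm_eq_one (hTle p) (by rw [p.2.2, ← h]; exact z.2)
    rw [hrad1 _ this, h, p.2.2]
  obtain ⟨H, hH⟩ := exists_lift_of_isQuotientMap hq ⟨Sum.elim L K, by fun_prop⟩ (by
    rintro (z | p) (z' | p') h
    · have : z = z' := Subtype.ext h
      rw [this]
    · exact hLK z p' h
    · exact (hLK z' p h.symm).symm
    · have h' : p.1.1 = p'.1.1 := h
      by_cases hB : g p.1.1 ∈ B
      · exact (hLK ⟨_, hB⟩ p rfl).symm.trans (hLK ⟨_, hB⟩ p' h')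
      · have h1 : ∀ p : T, g p.1.1 ∉ B → ‖p.1.2‖ < 1 := by
          intro p hp
          refine lt_of_le_of_ne (hTle p) fun h1 => hp ?_
          rw [← p.2.2]
          exact hc.sphere_mem _ (by simpa using h1)
        have : p = p' := Subtype.ext (Prod.ext h' (hc.injOn (h1 p hB) (h1 p' (h' ▸ hB))
          (by rw [p.2.2, p'.2.2, h'])))
        rw [this])
  have hH1 : ∀ z : {z | g z ∈ B}, H z = L z := fun z => hH (.inl z)
  have hH2 : ∀ p : T, H p.1.1 = K p := fun p => hH (.inr p)
  refine ⟨⟨fun z => H z 1, by fun_prop⟩, homotopicRel_of_path H (fun z => ?_) (fun z => rfl)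
    (fun z hz t => ?_), fun z => ?_⟩
  · obtain ⟨z | p, rfl⟩ := hq.surjective z
    · exact congrArg (fun k => k 0) (hH1 z)
    · refine (congrArg (fun k => k 0) (hH2 p)).trans ?_
      change c (rad (p, 0)) = g p.1.1
      rw [← p.2.2]; simp [rad]
  · exact congrArg (fun k => k t) (hH1 ⟨z, hz⟩)
  · obtain ⟨z | p, rfl⟩ := hq.surjective z
    · exact (congrArg (fun k => k 1) (hH1 z)).symm ▸ z.2
    · refine (congrArg (fun k => k 1) (hH2 p)).symm ▸ hc.sphere_mem _ ?_
      simp [hradn (p, 1)]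

/-- A map from a compact set of dimension less than `m` can be pushed off an `m`-cell. On the part
of the cell near its center the map is replaced by a `C¹` approximation, whose image misses points
arbitrarily near the center. After a small translation it misses the center, and the radial push
applies. -/
theorem IsCellOver.exists_homotopicRel {c : PartialEquiv (Fin m → ℝ) Y} {B : Set Y}
    (hc : IsCellOver c B) {E : Type*} [NormedAddCommGroup E] [NormedSpace ℝ E]
    [FiniteDimensional ℝ E] {Q : Set E} (hQ : IsCompact Q) (hdim : dimH Q < m) (g : C(Q, Y))
    (hg : ∀ z, g z ∈ B ∨ ∃ u, ‖u‖ < 1 ∧ c u = g z) :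
    ∃ g' : C(Q, Y), g.HomotopicRel g' {z | g z ∈ B} ∧ ∀ z, g' z ∈ B := by
  have : CompactSpace Q := isCompact_iff_compactSpace.1 hQ
  have hcomp : ∀ s : Set (Fin m → ℝ), IsClosed s → s ⊆ closedBall 0 1 → IsClosed (c '' s) :=
    fun s hs hs1 => (((isCompact_closedBall (0 : Fin m → ℝ) 1).of_isClosed_subset hs
      hs1).image_of_continuousOn (hc.continuousOn.mono hs1)).isClosed
  let F : Set Q := {z | g z ∈ c '' closedBall 0 (1 / 2)}
  let G : Set Q := {z | g z ∈ B ∪ c '' (closedBall 0 1 ∩ {u | 1 / 2 ≤ ‖u‖})}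
  have hF : IsClosed F := (hcomp _ isClosed_closedBall
    (closedBall_subset_closedBall (by norm_num))).preimage g.continuous
  have hG : IsClosed G := (hc.isClosed.union (hcomp _ (isClosed_closedBall.inter
    (isClosed_le continuous_const continuous_norm)) Set.inter_subset_left)).preimage g.continuous
  have hFG : ∀ z, z ∈ F ∨ z ∈ G := by
    intro z
    obtain h | ⟨u, hu, h⟩ := hg z
    · exact .inr (.inl h)
    · obtain h2 | h2 := le_total ‖u‖ (1 / 2)
      · exact .inl ⟨u, by simpa using h2, h⟩
      · exact .inr (.inr ⟨u, ⟨by simpa using hu.le, h2⟩, h⟩)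
  -- the coordinates, on the part of `Q` mapped near the center
  have hFt : ∀ z : F, g z ∈ c.target ∧ ‖c.symm (g z)‖ ≤ 1 / 2 := by
    rintro ⟨z, u, hu, h⟩
    rw [mem_closedBall_zero_iff] at hu
    have hus : u ∈ c.source := by rw [hc.source_eq]; simp; linarith
    simp only
    rw [← h, c.left_inv hus]
    exact ⟨c.map_source hus, hu⟩
  let u : C(F, Fin m → ℝ) := ⟨fun z => c.symm (g z), hc.continuousOn_symm.comp_continuous
    (by fun_prop) fun z => (hFt z).1⟩
  have hcu : ∀ z : F, c (u z) = g z := fun z => c.right_inv (hFt z).1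
  have hun : ∀ z : F, ‖u z‖ ≤ 1 / 2 := fun z => (hFt z).2
  obtain ⟨V₀, hV₀⟩ := u.exists_restrict_eq hF
  obtain ⟨V, hV⟩ := V₀.exists_restrict_eq hQ.isClosed
  have hVu : ∀ z : F, V z = u z := fun z =>
    (DFunLike.congr_fun hV (z : Q)).trans (DFunLike.congr_fun hV₀ z)
  obtain ⟨p₀, hp₀, hp₀V, -⟩ := V.continuous.exists_contDiff_approx 1 (ε := fun _ => 1 / 16)
    continuous_const (fun _ => by norm_num)
  have hdense : Dense (p₀ '' Q)ᶜ := ContDiffOn.dense_compl_image_of_dimH_lt_finrank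
    (s := Set.univ) (contDiffOn_univ.2 (by exact_mod_cast hp₀)) convex_univ (Set.subset_univ _)
    (by simpa using hdim)
  obtain ⟨q, hq, hqball⟩ := hdense.exists_mem_open
    (isOpen_ball (x := (0 : Fin m → ℝ)) (ε := 1 / 16)) ⟨0, by simp⟩
  rw [mem_ball_zero_iff] at hqball
  let p : C(Q, Fin m → ℝ) := ⟨fun z => p₀ z - q, by have := hp₀.continuous; fun_prop⟩
  have hp0 : ∀ z, p z ≠ 0 := fun z h => hq ⟨z, z.2, sub_eq_zero.1 h⟩
  have hpu : ∀ z : F, ‖p z - u z‖ < 1 / 8 := by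
    intro z
    have h1 := hp₀V z
    rw [dist_eq_norm, hVu] at h1
    calc ‖p z - u z‖ = ‖(p₀ z - u z) - q‖ := by
          change ‖p₀ z - q - u z‖ = _; congr 1; abel
      _ ≤ ‖p₀ z - u z‖ + ‖q‖ := norm_sub_le _ _
      _ < 1 / 8 := by linarith
  -- the cutoff is `1` up to the radius `1/4`, and `0` from the radius `1/2` on
  let cut : ℝ → ℝ := fun r => max 0 (min 1 (2 - 4 * r))
  have hcut : Continuous cut := by fun_prop
  have cut0 : ∀ r, 0 ≤ cut r := fun r => le_max_left _ _
  have cut1 : ∀ r, cut r ≤ 1 := fun r => max_le zero_le_one (min_le_left _ _)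
  let mv : F × I → (Fin m → ℝ) := fun x => u x.1 + ((x.2 : ℝ) * cut ‖u x.1‖) • (p x.1 - u x.1)
  have hmv : Continuous mv := by fun_prop
  have hmvb : ∀ x, ‖mv x‖ < 1 := by
    intro x
    have h1 := hun x.1
    have h2 := hpu x.1
    have h3 : ‖((x.2 : ℝ) * cut ‖u x.1‖) • (p x.1 - u x.1)‖ ≤ 1 / 8 := by
      rw [norm_smul, Real.norm_of_nonneg (mul_nonneg x.2.2.1 (cut0 _))]
      have := mul_le_one₀ x.2.2.2 (cut0 ‖u x.1‖) (cut1 _)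
      have := norm_nonneg (p x.1 - u x.1)
      have := mul_nonneg x.2.2.1 (cut0 ‖u x.1‖)
      nlinarith
    have := norm_add_le (u x.1) (((x.2 : ℝ) * cut ‖u x.1‖) • (p x.1 - u x.1))
    change ‖u x.1 + _‖ < 1
    linarith
  -- on the overlap of the two closed pieces the cutoff vanishes
  have hov : ∀ z : F, (z : Q) ∈ G → cut ‖u z‖ = 0 := by
    rintro z (h | ⟨v, ⟨hv, hv2⟩, h⟩)
    · exact absurd h (hcu z ▸ hc.ball_notMem _ (by simpa using (hun z).trans_lt (by norm_num)))
    · have huz : ‖u z‖ < 1 := (hun z).trans_lt (by norm_num)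
      have hv1 : ‖v‖ < 1 := by
        rw [mem_closedBall_zero_iff] at hv
        refine lt_of_le_of_ne hv fun h1 => hc.ball_notMem (u z) (by simpa using huz) ?_
        rw [hcu, ← h]
        exact hc.sphere_mem v (by simpa using h1)
      have : v = u z := hc.injOn hv1 huz (h.trans (hcu z).symm)
      subst this
      simp only [Set.mem_ofPred_eq] at hv2
      simp only [cut]
      rw [max_eq_left]
      exact (min_le_right _ _).trans (by linarith)
  obtain ⟨H, hH1, hH2⟩ := exists_glue_of_isClosed hF hG hFG
    (ContinuousMap.curry ⟨fun x => c (mv x), hc.continuousOn.comp_continuous hmv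
      fun x => by simpa using (hmvb x).le⟩)
    (ContinuousMap.curry ⟨fun x : G × I => g x.1, by fun_prop⟩) (by
      intro z h1 h2
      ext t
      change c (mv (⟨z, h1⟩, t)) = g z
      have := hov ⟨z, h1⟩ h2
      simp only [mv, this, mul_zero, zero_smul, add_zero]
      exact hcu _)
  have hHF : ∀ (z : F) t, H z t = c (mv (z, t)) := fun z t => congrArg (fun k => k t) (hH1 z)
  have hHG : ∀ (z : G) t, H z t = g z := fun z t => congrArg (fun k => k t) (hH2 z)
  let g₁ : C(Q, Y) := ⟨fun z => H z 1, by fun_prop⟩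
  have hrel : g.HomotopicRel g₁ {z | g z ∈ B} := by
    refine homotopicRel_of_path H (fun z => ?_) (fun z => rfl) (fun z hz t => ?_)
    · obtain hz | hz := hFG z
      · rw [hHF ⟨z, hz⟩]
        simp only [mv]
        simp [hcu]
      · exact hHG ⟨z, hz⟩ 0
    · exact hHG ⟨z, .inl hz⟩ t
  obtain ⟨g', hg', hg'B⟩ := hc.exists_homotopicRel_of_ne_center g₁ (by
    intro z
    by_cases hz : z ∈ G
    · rw [show g₁ z = g z from hHG ⟨z, hz⟩ 1]
      obtain h | ⟨v, ⟨hv, hv2⟩, h⟩ := hz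
      · exact .inl h
      · rw [mem_closedBall_zero_iff] at hv
        obtain h1 | h1 := hv.lt_or_eq
        · refine .inr ⟨v, h1, ?_, h⟩
          rintro rfl
          simp only [Set.mem_ofPred_eq, norm_zero] at hv2
          norm_num at hv2
        · exact .inl (h ▸ hc.sphere_mem v (by simpa using h1))
    · have hzF := (hFG z).resolve_right hz
      rw [show g₁ z = _ from hHF ⟨z, hzF⟩ 1]
      refine .inr ⟨_, hmvb _, fun h0 => ?_, rfl⟩
      set zF : F := ⟨z, hzF⟩
      simp only [mv, Set.Icc.coe_one, one_mul] at h0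
      obtain h4 | h4 := le_total ‖u zF‖ (1 / 4)
      · have : cut ‖u zF‖ = 1 := by
          simp only [cut]
          rw [min_eq_left (by linarith)]; simp
        rw [this, one_smul, add_sub_cancel] at h0
        exact hp0 z h0
      · have h5 : ‖u zF‖ = ‖cut ‖u zF‖ • (p zF - u zF)‖ :=
          (congrArg norm (eq_neg_of_add_eq_zero_left h0)).trans (norm_neg _)
        rw [norm_smul, Real.norm_of_nonneg (cut0 _)] at h5
        have := hpu zF
        have := norm_nonneg (p zF - u zF)
        have := cut1 ‖u zF‖
        have := cut0 ‖u zF‖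
        nlinarith)
  refine ⟨g', hrel.trans (homotopicRel_mono hg' fun z hz => ?_), hg'B⟩
  change g₁ z ∈ B
  rw [show g₁ z = g z from hHG ⟨z, .inl hz⟩ 1]
  exact hz

end Push

/-! ### Cellular approximation -/

section SkeletonPush

variable {Y : Type*} [TopologicalSpace Y] [T2Space Y] [CWComplex (Set.univ : Set Y)]

/-- An `n`-cell lies over the union of the lower-dimensional cells and of any other cells of
dimension `n`. -/
theorem isCellOver_map {n : ℕ} (G : Finset (RelCWComplex.cell (Set.univ : Set Y) n))
    {e : RelCWComplex.cell (Set.univ : Set Y) n} (he : e ∉ G) :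
    IsCellOver (RelCWComplex.map n e)
      ((CWComplex.skeletonLT (Set.univ : Set Y) n : Set Y) ∪
        ⋃ e' ∈ G, CWComplex.closedCell n e') where
  isClosed := (CWComplex.Subcomplex.closed _).union
    (G.finite_toSet.isClosed_biUnion fun _ _ => CWComplex.isClosed_closedCell)
  source_eq := RelCWComplex.source_eq n e
  continuousOn := RelCWComplex.continuousOn n e
  continuousOn_symm := RelCWComplex.continuousOn_symm n e
  sphere_mem u hu := .inl (CWComplex.cellFrontier_subset_skeletonLT n e ⟨u, hu, rfl⟩)
  ball_notMem u hu := by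
    have hmem : RelCWComplex.map n e u ∈ CWComplex.openCell n e := ⟨u, hu, rfl⟩
    have hskel : RelCWComplex.map n e u ∉ (CWComplex.skeletonLT (Set.univ : Set Y) n : Set Y) :=
      fun h => (CWComplex.disjoint_skeletonLT_openCell le_rfl).le_bot ⟨h, hmem⟩
    rintro (h | h)
    · exact hskel h
    · simp only [Set.mem_iUnion] at h
      obtain ⟨e', he', h⟩ := h
      rw [← CWComplex.cellFrontier_union_openCell_eq_closedCell] at h
      obtain h | h := h
      · exact hskel (CWComplex.cellFrontier_subset_skeletonLT n e' h)
      · refine (CWComplex.disjoint_openCell_of_ne (C := (Set.univ : Set Y)) (i := e) (j := e')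
          fun heq => ?_).le_bot ⟨hmem, h⟩
        cases heq
        exact he he'

variable [CWComplex.Finite (Set.univ : Set Y)]
  {E : Type*} [NormedAddCommGroup E] [NormedSpace ℝ E] [FiniteDimensional ℝ E] {Q : Set E}

/-- A map from a set of dimension less than `n` can be pushed off the cells of dimension `n`. -/
theorem exists_homotopicRel_skeletonLT_of_succ {n : ℕ} (hQ : IsCompact Q) (hdim : dimH Q < n)
    (g : C(Q, Y)) (hg : ∀ z, g z ∈ (CWComplex.skeletonLT (Set.univ : Set Y) (n + 1 : ℕ) : Set Y)) :
    ∃ g' : C(Q, Y), g.HomotopicRel g' {z | g z ∈ CWComplex.skeletonLT (Set.univ : Set Y) n} ∧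
      ∀ z, g' z ∈ CWComplex.skeletonLT (Set.univ : Set Y) n := by
  classical
  have key : ∀ (G : Finset (RelCWComplex.cell (Set.univ : Set Y) n)) (g : C(Q, Y)),
      (∀ z, g z ∈ (CWComplex.skeletonLT (Set.univ : Set Y) n : Set Y) ∪
        ⋃ e' ∈ G, CWComplex.closedCell n e') →
      ∃ g' : C(Q, Y), g.HomotopicRel g' {z | g z ∈ CWComplex.skeletonLT (Set.univ : Set Y) n} ∧
        ∀ z, g' z ∈ CWComplex.skeletonLT (Set.univ : Set Y) n := by
    intro G
    induction G using Finset.induction_on with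
    | empty => exact fun g hg => ⟨g, .refl g, fun z => by simpa using hg z⟩
    | insert e G he ih =>
      intro g hg
      obtain ⟨g₁, h₁, hg₁⟩ := (isCellOver_map G he).exists_homotopicRel hQ hdim g (by
        intro z
        have hz := hg z
        rw [Finset.set_biUnion_insert, Set.union_left_comm] at hz
        obtain hz | hz := hz
        · rw [← CWComplex.cellFrontier_union_openCell_eq_closedCell] at hz
          obtain hz | ⟨u, hu, hz⟩ := hz
          · exact .inl (.inl (CWComplex.cellFrontier_subset_skeletonLT n e hz))
          · exact .inr ⟨u, by simpa using hu, hz⟩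
        · exact .inl hz)
      obtain ⟨g₂, h₂, hg₂⟩ := ih g₁ hg₁
      have hsub : {z | g z ∈ CWComplex.skeletonLT (Set.univ : Set Y) n} ⊆
          {z | g₁ z ∈ CWComplex.skeletonLT (Set.univ : Set Y) n} := by
        intro z hz
        have : g₁ z = g z := (h₁.some.eq_snd 1 (.inl hz)).symm.trans
          (h₁.some.eq_fst 1 (x := z) (.inl hz))
        change g₁ z ∈ CWComplex.skeletonLT (Set.univ : Set Y) n
        rw [this]
        exact hz
      exact ⟨g₂, (homotopicRel_mono h₁ fun z hz => .inl hz).trans (homotopicRel_mono h₂ hsub), hg₂⟩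
  have hfin : Finite (RelCWComplex.cell (Set.univ : Set Y) n) := CWComplex.FiniteType.finite_cell n
  have := Fintype.ofFinite (RelCWComplex.cell (Set.univ : Set Y) n)
  refine key Finset.univ g fun z => ?_
  have := hg z
  rw [Nat.cast_add, Nat.cast_one,
    ← CWComplex.skeletonLT_union_iUnion_closedCell_eq_skeletonLT_succ] at this
  simpa using this

/-- A map from a set of dimension less than `n` to a finite CW complex is homotopic, relative to the
preimage of the cells of dimension less than `n`, to a map to these cells. -/
theorem exists_homotopicRel_skeletonLT {n : ℕ} (hQ : IsCompact Q) (hdim : dimH Q < n)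
    (g : C(Q, Y)) :
    ∃ g' : C(Q, Y), g.HomotopicRel g' {z | g z ∈ CWComplex.skeletonLT (Set.univ : Set Y) n} ∧
      ∀ z, g' z ∈ CWComplex.skeletonLT (Set.univ : Set Y) n := by
  have key : ∀ (k : ℕ) (g : C(Q, Y)),
      (∀ z, g z ∈ CWComplex.skeletonLT (Set.univ : Set Y) (n + k : ℕ)) →
      ∃ g' : C(Q, Y), g.HomotopicRel g' {z | g z ∈ CWComplex.skeletonLT (Set.univ : Set Y) n} ∧
        ∀ z, g' z ∈ CWComplex.skeletonLT (Set.univ : Set Y) n := by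
    intro k
    induction k with
    | zero => exact fun g hg => ⟨g, .refl g, hg⟩
    | succ k ih =>
      intro g hg
      obtain ⟨g₁, h₁, hg₁⟩ := exists_homotopicRel_skeletonLT_of_succ (n := n + k) hQ
        (hdim.trans_le (by exact_mod_cast Nat.le_add_right n k)) g hg
      obtain ⟨g₂, h₂, hg₂⟩ := ih g₁ hg₁
      have hle : CWComplex.skeletonLT (Set.univ : Set Y) n ≤
          CWComplex.skeletonLT (Set.univ : Set Y) (n + k : ℕ) :=
        CWComplex.skeletonLT_mono (by exact_mod_cast Nat.le_add_right n k)
      have hsub : {z | g z ∈ CWComplex.skeletonLT (Set.univ : Set Y) n} ⊆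
          {z | g₁ z ∈ CWComplex.skeletonLT (Set.univ : Set Y) n} := by
        intro z hz
        have : g₁ z = g z := (h₁.some.eq_snd 1 (hle hz)).symm.trans
          (h₁.some.eq_fst 1 (x := z) (hle hz))
        change g₁ z ∈ CWComplex.skeletonLT (Set.univ : Set Y) n
        rw [this]
        exact hz
      exact ⟨g₂, (homotopicRel_mono h₁ fun z hz => hle hz).trans (homotopicRel_mono h₂ hsub), hg₂⟩
  obtain ⟨N, hN⟩ := Filter.eventually_atTop.1
    (RelCWComplex.FiniteDimensional.eventually_isEmpty_cell (C := (Set.univ : Set Y)) (D := ∅))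
  refine key N g fun z => CWComplex.mem_skeletonLT_iff.2 ?_
  have hz : g z ∈ (Set.univ : Set Y) := trivial
  rw [← CWComplex.iUnion_openCell_eq_complex (C := (Set.univ : Set Y))] at hz
  simp only [Set.mem_iUnion] at hz
  obtain ⟨m, j, hz⟩ := hz
  refine ⟨m, ?_, j, hz⟩
  by_contra hm
  exact (hN m (by
    have : ¬ m < n + N := fun h => hm (by exact_mod_cast h)
    omega)).false j

end SkeletonPush

section Simplex

variable {X : Type v} {n : ℕ}

open Classical in
/-- The affine parametrization of the simplex with vertex set `s ∪ {x}`, where `x ∉ s`, by the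
barycentric coordinates of the vertices in `s`. -/
noncomputable def simplexParam (x : X) {s : Finset X} (ε : s ≃ Fin n) (u : Fin n → ℝ) : X → ℝ :=
  fun v => if h : v ∈ s then u (ε ⟨v, h⟩) else if v = x then 1 - ∑ k, u k else 0

variable {x : X} {s : Finset X} (ε : s ≃ Fin n)

theorem simplexParam_of_mem (u : Fin n → ℝ) {v : X} (hv : v ∈ s) :
    simplexParam x ε u v = u (ε ⟨v, hv⟩) := dif_pos hv

theorem simplexParam_apex (hx : x ∉ s) (u : Fin n → ℝ) :
    simplexParam x ε u x = 1 - ∑ k, u k := by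
  simp [simplexParam, hx]

theorem simplexParam_of_notMem (u : Fin n → ℝ) {v : X} (hv : v ∉ s) (hvx : v ≠ x) :
    simplexParam x ε u v = 0 := by
  simp [simplexParam, hv, hvx]

theorem sum_simplexParam_coord (u : Fin n → ℝ) : ∑ v ∈ s, simplexParam x ε u v = ∑ k, u k := by
  rw [← Finset.sum_coe_sort, ← Equiv.sum_comp ε]
  exact Finset.sum_congr rfl fun v _ => simplexParam_of_mem ε u v.2

variable [Fintype X]

theorem contDiff_simplexParam : ContDiff ℝ 1 (simplexParam x ε) := by
  refine contDiff_pi.2 fun v => ?_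
  unfold simplexParam
  split_ifs
  · fun_prop
  · fun_prop
  · fun_prop

theorem sum_add_apex_eq_one (hx : x ∉ s) {w : X → ℝ} (hw : w ∈ stdSimplex ℝ X)
    (hws : ∀ v ∈ vsupp w, v ∈ s ∨ v = x) : ∑ v ∈ s, w v + w x = 1 := by
  classical
  rw [← hw.2, add_comm, ← Finset.sum_insert hx]
  refine Finset.sum_subset (Finset.subset_univ _) fun v _ hv => ?_
  by_contra h
  exact hv (Finset.mem_insert.2 (hws v (mem_vsupp.2 h)).symm)

theorem simplexParam_coordinates (hx : x ∉ s) {w : X → ℝ} (hw : w ∈ stdSimplex ℝ X)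
    (hws : ∀ v ∈ vsupp w, v ∈ s ∨ v = x) :
    simplexParam x ε (fun k => w (ε.symm k)) = w := by
  funext v
  by_cases hv : v ∈ s
  · rw [simplexParam_of_mem ε _ hv]
    simp
  · by_cases hvx : v = x
    · subst hvx
      rw [simplexParam_apex ε hx, ← sum_add_apex_eq_one hx hw hws, ← Finset.sum_coe_sort s,
        Equiv.sum_comp ε.symm fun v : s => w v]
      ring
    · rw [simplexParam_of_notMem ε _ hv hvx]
      by_contra h
      exact (hws v (mem_vsupp.2 (Ne.symm h))).elim hv hvx

/-- A closed simplex has dimension less than its number of vertices. -/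
theorem dimH_lt_card {S : Finset X} (hS : S.Nonempty) {Q : Set (X → ℝ)}
    (hQ : ∀ w ∈ Q, w ∈ stdSimplex ℝ X ∧ vsupp w ⊆ S) : dimH Q < S.card := by
  classical
  obtain ⟨x, hx⟩ := hS
  have hsub : Q ⊆ Set.range (simplexParam x (S.erase x).equivFin) := fun w hw =>
    ⟨_, simplexParam_coordinates _ (Finset.notMem_erase x S) (hQ w hw).1 fun v hv => by
      by_cases h : v = x
      · exact .inr h
      · exact .inl (Finset.mem_erase.2 ⟨h, (hQ w hw).2 hv⟩)⟩
  refine ((dimH_mono hsub).trans (contDiff_simplexParam _).dimH_range_le).trans_lt ?_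
  rw [Module.finrank_fintype_fun_eq_card, Fintype.card_fin]
  exact_mod_cast Finset.card_erase_lt_of_mem hx

end Simplex

section SubcomplexExtension

theorem HasExtension.incl_trans {E : Type v} [TopologicalSpace E] {A B D : Set E} (h₁ : A ⊆ B)
    (h₂ : B ⊆ D) {e : I} (H₁ : HasExtension (incl h₁) e) (H₂ : HasExtension (incl h₂) e) :
    HasExtension (incl (h₁.trans h₂)) e := by
  intro T _ c η hη
  obtain ⟨F, F1, F2⟩ := H₁ (c.comp (incl h₂)) η hη
  obtain ⟨G, G1, G2⟩ := H₂ c F F1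
  exact ⟨G, G1, fun w t => (G2 (incl h₁ w) t).trans (F2 w t)⟩

variable {X : Type v}

/-- The complex obtained by removing a maximal face. -/
def eraseFace (K : PreAbstractSimplicialComplex X) (s : Finset X)
    (hs : ∀ t ∈ K.faces, s ⊆ t → t = s) : PreAbstractSimplicialComplex X where
  faces := K.faces \ {s}
  isRelLowerSet_faces := by
    rintro t ⟨ht, hts⟩
    refine ⟨(K.isRelLowerSet_faces ht).1, fun t' ht' hne =>
      ⟨(K.isRelLowerSet_faces ht).2 ht' hne, fun h => hts ?_⟩⟩
    exact hs t ht (by rw [← Set.mem_singleton_iff.1 h]; exact ht')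

theorem faces_eq_insert_eraseFace {K : PreAbstractSimplicialComplex X} {s : Finset X}
    (hs : ∀ t ∈ K.faces, s ⊆ t → t = s) (hsK : s ∈ K.faces) :
    K.faces = insert s (eraseFace K s hs).faces := by
  simp [eraseFace, Set.insert_eq_of_mem hsK]

variable [Fintype X]

/-- The inclusion of a subcomplex has the homotopy extension property: the other faces are removed one
at a time, in order of decreasing dimension, and every removal is that of a conical pair. -/
theorem hasExtension_realization {K K' : PreAbstractSimplicialComplex X} (h : K' ≤ K) :
    HasExtension (incl (realization_mono h)) 0 := by
  induction hn : (K.faces \ K'.faces).ncard using Nat.strong_induction_on generalizing K with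
  | _ n ih =>
    obtain he | hne := (K.faces \ K'.faces).eq_empty_or_nonempty
    · have hle : K ≤ K' := Set.sdiff_eq_empty.1 he
      intro T _ c η hη
      refine ⟨⟨fun p => η (incl (realization_mono hle) p.1, p.2), by fun_prop⟩, fun z => ?_,
        fun w t => rfl⟩
      exact hη _
    · obtain ⟨s, hs, hmax⟩ := Set.exists_max_image _ Finset.card (Set.toFinite _) hne
      have hmax' : ∀ t ∈ K.faces, s ⊆ t → t = s := by
        intro t ht hst
        have htK : t ∉ K'.faces := fun h' =>
          hs.2 ((K'.isRelLowerSet_faces h').2 hst (K.isRelLowerSet_faces hs.1).1)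
        exact (Finset.eq_of_subset_of_card_le hst (hmax t ⟨ht, htK⟩)).symm
      have hle : K' ≤ eraseFace K s hmax' := fun t ht =>
        ⟨h ht, fun h' => hs.2 (Set.mem_singleton_iff.1 h' ▸ ht)⟩
      have hcon := isConical_insert_face (K.isRelLowerSet_faces hs.1).1
        (faces_eq_insert_eraseFace hmax' hs.1) (fun h' => h'.2 rfl)
      have hlt : ((eraseFace K s hmax').faces \ K'.faces).ncard < n := by
        rw [← hn]
        refine Set.ncard_lt_ncard ⟨fun t ht => ⟨ht.1.1, ht.2⟩, fun hsub => ?_⟩ (Set.toFinite _)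
        exact (hsub hs).1.2 rfl
      intro T _
      exact HasExtension.incl_trans (realization_mono hle) hcon.subset (@ih _ hlt _ hle rfl)
        (@hcon.hasExtension)

end SubcomplexExtension

section CellularApproximation

variable {X : Type v} [Fintype X] {Y : Type v} [TopologicalSpace Y] [T2Space Y]
  [CWComplex (Set.univ : Set Y)]

/-- A map from a simplicial complex to a CW complex is cellular if it maps every simplex to the
cells of at most its dimension. A simplex of dimension `n` has `n + 1` vertices, and `skeletonLT n`
consists of the cells of dimension less than `n`. -/
def IsCellular {K : PreAbstractSimplicialComplex X} (φ : C(realization K, Y)) : Prop :=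
  ∀ w : realization K, φ w ∈ CWComplex.skeletonLT (Set.univ : Set Y) (vsupp w.1).card

variable [CWComplex.Finite (Set.univ : Set Y)]

/-- **Cellular approximation** for maps from a finite simplicial complex to a finite CW complex, by
induction on the subcomplexes on which the map is cellular. -/
theorem exists_homotopic_isCellular {K : PreAbstractSimplicialComplex X} (φ : C(realization K, Y)) :
    ∃ φ' : C(realization K, Y), φ.Homotopic φ' ∧ IsCellular φ' := by
  suffices key : ∀ K' : PreAbstractSimplicialComplex X, K' ≤ K →
      ∃ φ' : C(realization K, Y), φ.Homotopic φ' ∧ ∀ w : realization K, vsupp w.1 ∈ K'.faces →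
        φ' w ∈ CWComplex.skeletonLT (Set.univ : Set Y) (vsupp w.1).card by
    obtain ⟨φ', h, h'⟩ := key K le_rfl
    exact ⟨φ', h, fun w => h' w (mem_realization_iff.1 w.2).2⟩
  intro K' hle
  induction hn : K'.faces.ncard using Nat.strong_induction_on generalizing K' with
  | _ n ih =>
    obtain he | hne := K'.faces.eq_empty_or_nonempty
    · exact ⟨φ, .refl φ, fun w hw => by simp [he] at hw⟩
    obtain ⟨s, hs, hmax⟩ := Set.exists_max_image _ Finset.card (Set.toFinite _) hne
    have hsne : s.Nonempty := (K'.isRelLowerSet_faces hs).1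
    have hmax' : ∀ t ∈ K'.faces, s ⊆ t → t = s := fun t ht hst =>
      (Finset.eq_of_subset_of_card_le hst (hmax t ht)).symm
    set L := eraseFace K' s hmax' with hL
    have hLK' : L ≤ K' := fun t ht => ht.1
    obtain ⟨φ₁, h₁, hφ₁⟩ := ih _ (by
      rw [← hn]
      exact Set.ncard_lt_ncard ⟨hLK', fun hsub => (hsub hs).2 rfl⟩ (Set.toFinite _)) L
      (hLK'.trans hle) rfl
    -- push the maximal simplex into the skeleton
    let Q : Set (X → ℝ) := {w | w ∈ stdSimplex ℝ X ∧ vsupp w ⊆ s}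
    have hQeq : Q = stdSimplex ℝ X ∩ ⋂ v, ⋂ (_ : v ∉ s), {w : X → ℝ | w v = 0} := by
      ext w
      simp only [Q, Set.mem_ofPred_eq, Set.mem_inter_iff, Set.mem_iInter]
      refine and_congr_right fun _ => ⟨fun h v hv => ?_, fun h v hv => ?_⟩
      · by_contra hw
        exact hv (h (mem_vsupp.2 hw))
      · by_contra hvs
        exact mem_vsupp.1 hv (h v hvs)
    have hQcl : IsClosed (⋂ v, ⋂ (_ : v ∉ s), {w : X → ℝ | w v = 0}) :=
      isClosed_iInter fun v => isClosed_iInter fun _ =>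
        isClosed_eq (continuous_apply v) continuous_const
    have hQ : IsCompact Q := hQeq ▸ (isCompact_stdSimplex ℝ X).inter_right hQcl
    have hQK' : Q ⊆ realization K' := fun w hw => mem_realization_iff.2
      ⟨hw.1, (K'.isRelLowerSet_faces hs).2 hw.2 (vsupp_nonempty hw.1)⟩
    have hK'K := realization_mono hle
    obtain ⟨g, ⟨H⟩, hg⟩ := exists_homotopicRel_skeletonLT hQ (dimH_lt_card hsne fun w hw => hw)
      (φ₁.comp (incl (hQK'.trans hK'K)))
    -- extend the homotopy by the constant homotopy to the subcomplex, then to everything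
    let F : Set (realization K' × I) := {p | (p.1 : X → ℝ) ∈ realization L}
    let G : Set (realization K' × I) := {p | (p.1 : X → ℝ) ∈ Q}
    have hF : IsClosed F := (isCompact_realization L).isClosed.preimage
      (continuous_subtype_val.comp continuous_fst)
    have hG : IsClosed G := hQ.isClosed.preimage (continuous_subtype_val.comp continuous_fst)
    have hFG : ∀ p, p ∈ F ∨ p ∈ G := by
      intro p
      obtain ⟨h1, h2⟩ := mem_realization_iff.1 p.1.2
      by_cases h : vsupp p.1.1 = s
      · exact .inr ⟨h1, h.le⟩
      · exact .inl (mem_realization_iff.2 ⟨h1, h2, h⟩)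
    obtain ⟨η, η1, η2⟩ := exists_glue_of_isClosed hF hG hFG
      (T := Y) ⟨fun p => φ₁ (incl hK'K p.1.1), by fun_prop⟩
      ⟨fun p => H (p.1.2, ⟨p.1.1, p.2⟩), by fun_prop⟩ (by
        intro p hp1 hp2
        refine (H.eq_fst p.2 (x := ⟨p.1, hp2⟩) ?_).symm
        exact CWComplex.skeletonLT_mono (by exact_mod_cast Finset.card_le_card hp2.2)
          (hφ₁ (incl hK'K p.1) (mem_realization_iff.1 hp1).2))
    obtain ⟨E, E1, E2⟩ := hasExtension_realization hle φ₁ η (by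
      intro w
      obtain h | h := hFG (w, 0)
      · exact η1 ⟨(w, 0), h⟩
      · exact (η2 ⟨(w, 0), h⟩).trans (H.apply_zero _))
    refine ⟨⟨fun z => E (z, 1), by fun_prop⟩, h₁.trans ⟨⟨⟨fun p => E (p.2, p.1), by fun_prop⟩,
      E1, fun _ => rfl⟩⟩, fun w hw => ?_⟩
    have hwK' : (w : X → ℝ) ∈ realization K' :=
      mem_realization_iff.2 ⟨(mem_realization_iff.1 w.2).1, hw⟩
    change E (incl hK'K ⟨w, hwK'⟩, 1) ∈ CWComplex.skeletonLT (Set.univ : Set Y) (vsupp w.1).card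
    rw [E2]
    by_cases h : vsupp w.1 = s
    · have hwG : ((⟨w, hwK'⟩, 1) : realization K' × I) ∈ G := ⟨(mem_realization_iff.1 w.2).1, h.le⟩
      rw [η2 ⟨_, hwG⟩, h]
      have := H.apply_one ⟨w, hwG⟩
      change H (1, ⟨w, hwG⟩) ∈ _
      rw [this]
      exact hg _
    · have hwF : ((⟨w, hwK'⟩, 1) : realization K' × I) ∈ F :=
        mem_realization_iff.2 ⟨(mem_realization_iff.1 w.2).1, hw, h⟩
      rw [η1 ⟨_, hwF⟩]
      exact hφ₁ w ⟨hw, h⟩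

end CellularApproximation

/-! ### Separation of spaces obtained by gluing -/

section Separation

variable {W Z A : Type v} [TopologicalSpace W] [TopologicalSpace Z] [TopologicalSpace A]

/-- Gluing a compact Hausdorff space to a compact Hausdorff space along a closed subspace produces a
Hausdorff space: any two points are separated by a real-valued function. -/
theorem Adj.t2Space [CompactSpace W] [CompactSpace Z] [T2Space Z] [CompactSpace A] [T2Space A]
    {i : C(W, Z)} (f : C(W, A)) (hi : Function.Injective i) [T2Space W] : T2Space (Adj i f) := by
  have G := Adj.isGlue f hi
  have hemb : IsClosedEmbedding i := i.continuous.isClosedEmbedding hi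
  -- the target of `IsGlue.lift` has to live in the universe of the spaces, hence `ULift`
  have glue : ∀ (a : C(A, ℝ)) (c : C(Z, ℝ)), (∀ w, a (f w) = c (i w)) →
      ∃ h : C(Adj i f, ℝ), (∀ x, h (Adj.inA i f x) = a x) ∧ ∀ z, h (Adj.inZ i f z) = c z := by
    intro a c hac
    obtain ⟨h, h1, h2⟩ := G.lift (T := ULift.{v} ℝ) ⟨fun x => ⟨a x⟩, by fun_prop⟩
      ⟨fun x => ⟨c x⟩, by fun_prop⟩ (fun w => congrArg ULift.up (hac w))
    exact ⟨⟨fun p => (h p).down, by fun_prop⟩, fun x => congrArg ULift.down (h1 x),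
      fun z => congrArg ULift.down (h2 z)⟩
  have bump : ∀ z, z ∉ Set.range i → ∀ S : Set Z, IsClosed S → z ∉ S →
      ∃ h : C(Adj i f, ℝ), (∀ x, h (Adj.inA i f x) = 0) ∧ h (Adj.inZ i f z) = 1 ∧
        ∀ z' ∈ S, h (Adj.inZ i f z') = 0 := by
    intro z hz S hS hzS
    obtain ⟨c, c0, c1, -⟩ := exists_continuous_zero_one_of_isClosed
      (hS.union hemb.isClosed_range) isClosed_singleton
      (Set.disjoint_singleton_right.2 fun h => h.elim hzS hz)
    obtain ⟨h, h1, h2⟩ := glue 0 c fun w => (c0 (.inr ⟨w, rfl⟩)).symm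
    exact ⟨h, h1, (h2 z).trans (c1 rfl), fun z' hz' => (h2 z').trans (c0 (.inl hz'))⟩
  have key : ∀ z, z ∉ Set.range i → ∀ q, q ≠ Adj.inZ i f z →
      ∃ h : C(Adj i f, ℝ), h (Adj.inZ i f z) ≠ h q := by
    intro z hz q hq
    obtain ⟨a, rfl⟩ | ⟨z', rfl⟩ := G.surj q
    · obtain ⟨h, h1, h2, -⟩ := bump z hz ∅ isClosed_empty (by simp)
      exact ⟨h, by rw [h1, h2]; exact one_ne_zero⟩
    · obtain ⟨h, -, h2, h3⟩ := bump z hz {z'} isClosed_singleton fun h' => hq (by rw [h'])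
      exact ⟨h, by rw [h2, h3 z' rfl]; exact one_ne_zero⟩
  have cases : ∀ p : Adj i f, (∃ a, Adj.inA i f a = p) ∨ ∃ z ∉ Set.range i, Adj.inZ i f z = p := by
    intro p
    obtain h | ⟨z, rfl⟩ := G.surj p
    · exact .inl h
    · by_cases hz : z ∈ Set.range i
      · obtain ⟨w, rfl⟩ := hz
        exact .inl ⟨f w, G.comm w⟩
      · exact .inr ⟨z, hz, rfl⟩
  refine ⟨fun p q hpq => ?_⟩
  suffices ∃ h : C(Adj i f, ℝ), h p ≠ h q by
    obtain ⟨h, hh⟩ := this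
    exact separated_by_continuous h.continuous hh
  obtain ⟨a, rfl⟩ | ⟨z, hz, rfl⟩ := cases p
  · obtain ⟨a', rfl⟩ | ⟨z, hz, rfl⟩ := cases q
    · obtain ⟨c, c0, c1, -⟩ := exists_continuous_zero_one_of_isClosed (isClosed_singleton (x := a))
        (isClosed_singleton (x := a')) (by simpa using fun h : a = a' => hpq (by rw [h]))
      obtain ⟨e, he⟩ := (c.comp f).exists_extension' hemb
      obtain ⟨h, h1, -⟩ := glue c e fun w => (congrFun he w).symm
      exact ⟨h, by rw [h1, h1, c0 rfl, c1 rfl]; exact zero_ne_one⟩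
    · obtain ⟨h, hh⟩ := key z hz _ hpq
      exact ⟨h, hh.symm⟩
  · exact key z hz q hpq.symm

end Separation

/-! ### CW structures with finitely many cells -/

section FiniteCW

/-- A continuous map on a compact set `K` that is injective on a saturated subset `U` of `K` is a
homeomorphism from `U` to its image. -/
theorem continuousOn_symm_toPartialEquiv {E Z : Type*} [TopologicalSpace E] [Nonempty E]
    [TopologicalSpace Z] [T2Space Z] {f : E → Z} {K U : Set E} (hK : IsCompact K)
    (hf : ContinuousOn f K) (hUK : U ⊆ K) (hU : Set.InjOn f U)
    (hsat : ∀ u ∈ K, f u ∈ f '' U → u ∈ U) :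
    ContinuousOn (hU.toPartialEquiv).symm (f '' U) := by
  rw [continuousOn_iff_isClosed]
  intro t ht
  refine ⟨f '' (K ∩ t), ((hK.inter_right ht).image_of_continuousOn
    (hf.mono Set.inter_subset_left)).isClosed, ?_⟩
  have hinv : ∀ u ∈ U, hU.toPartialEquiv.symm (f u) = u := fun u hu =>
    hU.toPartialEquiv.left_inv hu
  ext y
  constructor
  · rintro ⟨h1, u, hu, rfl⟩
    refine ⟨⟨u, ⟨hUK hu, ?_⟩, rfl⟩, u, hu, rfl⟩
    rw [← hinv u hu]
    exact h1
  · rintro ⟨⟨u, ⟨huK, hut⟩, rfl⟩, h⟩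
    refine ⟨?_, h⟩
    change hU.toPartialEquiv.symm (f u) ∈ t
    rwa [hinv u (hsat u huK h)]

variable {Z : Type v} [TopologicalSpace Z] [T2Space Z]

/-- Finitely many cells, given by maps defined on closed cubes, that form a CW structure on `Z`: the
images of the open cubes partition `Z`, and the boundary of a cube is mapped to the cells of lower
dimension. -/
structure IsCellFamily {J : ℕ → Type v} (c : ∀ n, J n → (Fin n → ℝ) → Z) : Prop where
  eventually_isEmpty : ∀ᶠ n in Filter.atTop, IsEmpty (J n)
  finite : ∀ n, Finite (J n)
  continuousOn : ∀ n j, ContinuousOn (c n j) (closedBall 0 1)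
  injOn : ∀ n j, Set.InjOn (c n j) (ball 0 1)
  eq_of_mem : ∀ n j n' j', ∀ u ∈ ball (0 : Fin n → ℝ) 1, ∀ u' ∈ ball (0 : Fin n' → ℝ) 1,
    c n j u = c n' j' u' → (⟨n, j⟩ : Σ n, J n) = ⟨n', j'⟩
  exists_of_sphere : ∀ n j, ∀ u ∈ sphere (0 : Fin n → ℝ) 1,
    ∃ m < n, ∃ j', ∃ u' ∈ ball (0 : Fin m → ℝ) 1, c m j' u' = c n j u
  surj : ∀ z, ∃ n j, ∃ u ∈ ball (0 : Fin n → ℝ) 1, c n j u = z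

/-- The CW structure given by a family of cells; its subcomplexes are the closed unions of open
cells. -/
theorem IsCellFamily.exists_cwComplex {J : ℕ → Type v} {c : ∀ n, J n → (Fin n → ℝ) → Z}
    (h : IsCellFamily c) : ∃ (_ : CWComplex (Set.univ : Set Z))
      (_ : CWComplex.Finite (Set.univ : Set Z)),
      ∀ (S : ∀ n, Set (J n)) (P : Set Z), IsClosed P →
        (∀ z, z ∈ P ↔ ∃ n, ∃ j ∈ S n, ∃ u ∈ ball (0 : Fin n → ℝ) 1, c n j u = z) →
        ∃ E : CWComplex.Subcomplex (Set.univ : Set Z), (E : Set Z) = P := by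
  -- the boundary of a cell is disjoint from its interior, having image in other open cells
  have hsat : ∀ n j, ∀ u ∈ closedBall (0 : Fin n → ℝ) 1, c n j u ∈ c n j '' ball 0 1 →
      u ∈ ball (0 : Fin n → ℝ) 1 := by
    rintro n j u hu ⟨v, hv, hvu⟩
    by_contra hne
    have hs : u ∈ sphere (0 : Fin n → ℝ) 1 := by
      simp only [mem_closedBall, mem_ball, mem_sphere, not_lt] at *
      exact le_antisymm hu hne
    obtain ⟨m, hm, j', u', hu', hc⟩ := h.exists_of_sphere n j u hs
    have := congrArg Sigma.fst (h.eq_of_mem m j' n j u' hu' v hv (hc.trans hvu.symm))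
    exact hm.ne this
  let map : ∀ n, J n → PartialEquiv (Fin n → ℝ) Z := fun n j => (h.injOn n j).toPartialEquiv
  have p1 : ∀ n (j : J n), (map n j).source = ball 0 1 := fun n j => rfl
  have p2 : ∀ n (j : J n), ContinuousOn (map n j) (closedBall 0 1) := h.continuousOn
  have p3 : ∀ n (j : J n), ContinuousOn (map n j).symm (map n j).target := fun n j =>
    continuousOn_symm_toPartialEquiv (isCompact_closedBall _ _) (h.continuousOn n j)
      ball_subset_closedBall (h.injOn n j) (hsat n j)
  have p4 : (Set.univ : Set (Σ n, J n)).PairwiseDisjoint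
      (fun nj ↦ map nj.1 nj.2 '' ball 0 1) := by
    rintro ⟨n, j⟩ - ⟨n', j'⟩ - hne
    refine Set.disjoint_left.2 ?_
    rintro _ ⟨u, hu, rfl⟩ ⟨u', hu', he⟩
    exact hne (h.eq_of_mem n j n' j' u hu u' hu' he.symm)
  have p5 : ∀ n (j : J n), Set.MapsTo (map n j) (sphere 0 1)
      (⋃ (m < n) (j : J m), map m j '' closedBall 0 1) := by
    intro n j u hu
    obtain ⟨m, hm, j', u', hu', hc⟩ := h.exists_of_sphere n j u hu
    exact Set.mem_biUnion hm (Set.mem_iUnion.2 ⟨j', u', ball_subset_closedBall hu', hc⟩)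
  have p6 : ⋃ (n : ℕ) (j : J n), map n j '' closedBall 0 1 = Set.univ := by
    refine Set.eq_univ_of_forall fun z => ?_
    obtain ⟨n, j, u, hu, hc⟩ := h.surj z
    exact Set.mem_iUnion₂.2 ⟨n, j, u, ball_subset_closedBall hu, hc⟩
  refine ⟨CWComplex.mkFinite Set.univ J map h.eventually_isEmpty h.finite p1 p2 p3 p4 p5 p6,
    CWComplex.finite_mkFinite Set.univ J map h.eventually_isEmpty h.finite p1 p2 p3 p4 p5 p6, ?_⟩
  intro S P hP hS
  let _ := CWComplex.mkFinite Set.univ J map h.eventually_isEmpty h.finite p1 p2 p3 p4 p5 p6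
  refine ⟨⟨P, S, hP, ?_⟩, rfl⟩
  rw [Set.empty_union]
  ext z
  rw [hS]
  simp only [Set.mem_iUnion]
  constructor
  · rintro ⟨n, ⟨j, hj⟩, u, hu, rfl⟩
    exact ⟨n, j, hj, u, hu, rfl⟩
  · rintro ⟨n, j, hj, u, hu, rfl⟩
    exact ⟨n, ⟨j, hj⟩, u, hu, rfl⟩

variable {Y : Type v} [TopologicalSpace Y] [CWComplex (Set.univ : Set Y)]

theorem compactSpace_of_finite_cwComplex [CWComplex.Finite (Set.univ : Set Y)] :
    CompactSpace Y := by
  have := RelCWComplex.finite_cells_of_finite (C := (Set.univ : Set Y)) (D := ∅)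
  refine ⟨?_⟩
  rw [← CWComplex.union (C := (Set.univ : Set Y)), ← Set.iUnion_sigma
    (fun p : Σ n, RelCWComplex.cell (Set.univ : Set Y) n => CWComplex.closedCell p.1 p.2)]
  exact isCompact_iUnion fun p => CWComplex.isCompact_closedCell

end FiniteCW

/-! ### Cubical charts of simplices -/

section Chart

variable {n : ℕ}

theorem interior_corner : interior {u : Fin n → ℝ | (∀ k, 0 ≤ u k) ∧ ∑ k, u k ≤ 1} =
    {u | (∀ k, 0 < u k) ∧ ∑ k, u k < 1} := by
  apply Set.Subset.antisymm
  · intro u hu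
    -- an interior point can be moved a little in every direction
    have move : ∀ v : Fin n → ℝ, ∃ t : ℝ, 0 < t ∧
        u + t • v ∈ {u : Fin n → ℝ | (∀ k, 0 ≤ u k) ∧ ∑ k, u k ≤ 1} := by
      intro v
      have hc : Filter.Tendsto (fun t : ℝ => u + t • v) (𝓝[>] 0) (𝓝 u) := by
        have : Continuous fun t : ℝ => u + t • v := by fun_prop
        simpa using this.continuousWithinAt (s := Set.Ioi 0) (x := 0) |>.tendsto
      obtain ⟨t, ht, ht0⟩ := ((hc.eventually_mem
        (mem_interior_iff_mem_nhds.1 hu)).and self_mem_nhdsWithin).exists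
      exact ⟨t, ht0, ht⟩
    have hu' := interior_subset hu
    constructor
    · intro k
      obtain ⟨t, ht, h1, -⟩ := move (-Pi.single k 1)
      have := h1 k
      simp at this
      linarith
    · obtain ⟨t, ht, -, h2⟩ := move u
      simp only [Pi.add_apply, Pi.smul_apply, smul_eq_mul, Finset.sum_add_distrib,
        ← Finset.mul_sum] at h2
      by_contra hge
      nlinarith [hu'.2]
  · refine interior_maximal (fun u hu => ⟨fun k => (hu.1 k).le, hu.2.le⟩) ?_
    have : {u : Fin n → ℝ | (∀ k, 0 < u k) ∧ ∑ k, u k < 1} =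
        (⋂ k, {u | 0 < u k}) ∩ {u | ∑ k, u k < 1} := by
      ext u; simp
    rw [this]
    exact (isOpen_iInter_of_finite fun k => isOpen_lt continuous_const (continuous_apply k)).inter
      (isOpen_lt (by fun_prop) continuous_const)

/-- The corner simplex is a convex body, so it is homeomorphic to the unit ball, which for the
supremum norm is a cube. -/
theorem exists_homeomorph_corner : ∃ h : (Fin n → ℝ) ≃ₜ (Fin n → ℝ),
    h '' {u | (∀ k, 0 < u k) ∧ ∑ k, u k < 1} = ball 0 1 ∧
    h '' {u | (∀ k, 0 ≤ u k) ∧ ∑ k, u k ≤ 1} = closedBall 0 1 := by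
  have hclosed : IsClosed {u : Fin n → ℝ | (∀ k, 0 ≤ u k) ∧ ∑ k, u k ≤ 1} := by
    have : {u : Fin n → ℝ | (∀ k, 0 ≤ u k) ∧ ∑ k, u k ≤ 1} =
        (⋂ k, {u | 0 ≤ u k}) ∩ {u | ∑ k, u k ≤ 1} := by
      ext u; simp
    rw [this]
    exact (isClosed_iInter fun k => isClosed_le continuous_const (continuous_apply k)).inter
      (isClosed_le (by fun_prop) continuous_const)
  have hconv : Convex ℝ {u : Fin n → ℝ | (∀ k, 0 ≤ u k) ∧ ∑ k, u k ≤ 1} := by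
    rintro u ⟨hu1, hu2⟩ v ⟨hv1, hv2⟩ a b ha hb hab
    refine ⟨fun k => ?_, ?_⟩
    · have := hu1 k
      have := hv1 k
      simp only [Pi.add_apply, Pi.smul_apply, smul_eq_mul]
      positivity
    · simp only [Pi.add_apply, Pi.smul_apply, smul_eq_mul, Finset.sum_add_distrib,
        ← Finset.mul_sum]
      nlinarith
  have hne : (interior {u : Fin n → ℝ | (∀ k, 0 ≤ u k) ∧ ∑ k, u k ≤ 1}).Nonempty := by
    rw [interior_corner]
    refine ⟨fun _ => 1 / (n + 1), fun k => by positivity, ?_⟩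
    rw [Finset.sum_const, Finset.card_univ, Fintype.card_fin, nsmul_eq_mul, mul_one_div,
      div_lt_one (by positivity)]
    linarith
  have hb : Bornology.IsBounded {u : Fin n → ℝ | (∀ k, 0 ≤ u k) ∧ ∑ k, u k ≤ 1} := by
    refine (isBounded_closedBall (x := (0 : Fin n → ℝ)) (r := 1)).subset fun u hu => ?_
    rw [mem_closedBall_zero_iff, pi_norm_le_iff_of_nonneg zero_le_one]
    intro k
    rw [Real.norm_of_nonneg (hu.1 k)]
    exact (Finset.single_le_sum (fun k _ => hu.1 k) (Finset.mem_univ k)).trans hu.2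
  obtain ⟨h, h1, h2, -⟩ :=
    exists_homeomorph_image_interior_closure_frontier_eq_unitBall hconv hne hb
  rw [interior_corner] at h1
  rw [hclosed.closure_eq] at h2
  exact ⟨h, h1, h2⟩

variable {X : Type v} [Fintype X]

/-- A simplex with `n + 1` vertices is parametrized by the cube of dimension `n`. -/
theorem exists_simplexChart {S : Finset X} (hS : S.card = n + 1) :
    ∃ γ : (Fin n → ℝ) → X → ℝ, Continuous γ ∧ Function.Injective γ ∧
      γ '' closedBall 0 1 = {w | w ∈ stdSimplex ℝ X ∧ vsupp w ⊆ S} ∧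
      γ '' ball 0 1 = {w | w ∈ stdSimplex ℝ X ∧ vsupp w = S} := by
  classical
  obtain ⟨x, hxS⟩ : S.Nonempty := Finset.card_pos.1 (by omega)
  set s := S.erase x with hs
  have hx : x ∉ s := Finset.notMem_erase x S
  have hmem : ∀ v, v ∈ S ↔ v ∈ s ∨ v = x := fun v => by
    rw [← Finset.insert_erase hxS, Finset.mem_insert, or_comm]
  let ε : s ≃ Fin n := s.equivFinOfCardEq (by rw [hs, Finset.card_erase_of_mem hxS, hS]; rfl)
  let F := simplexParam x ε
  have hcoord : ∀ u k, F u (ε.symm k) = u k := fun u k => by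
    simp [F, simplexParam_of_mem ε u (ε.symm k).2]
  have hinj : Function.Injective F := fun u u' h => funext fun k => by
    rw [← hcoord u, ← hcoord u', h]
  have hzero : ∀ u v, v ∉ S → F u v = 0 := fun u v hv => by
    rw [hmem, not_or] at hv
    exact simplexParam_of_notMem ε u hv.1 hv.2
  have hstd : ∀ u, (∀ k, 0 ≤ u k) → ∑ k, u k ≤ 1 → F u ∈ stdSimplex ℝ X := by
    intro u h1 h2
    constructor
    · intro v
      by_cases hv : v ∈ S
      · obtain hv | rfl := (hmem v).1 hv
        · exact (h1 _).trans_eq (simplexParam_of_mem ε u hv).symm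
        · exact (sub_nonneg.2 h2).trans_eq (simplexParam_apex ε hx u).symm
      · exact (hzero u v hv).ge
    · rw [← Finset.sum_subset (Finset.subset_univ S) fun v _ hv => hzero u v hv,
        ← Finset.insert_erase hxS, Finset.sum_insert hx, sum_simplexParam_coord]
      change simplexParam x ε u x + _ = 1
      rw [simplexParam_apex ε hx]
      ring
  have hsupp : ∀ u, vsupp (F u) ⊆ S := fun u v hv => by
    by_contra h
    exact mem_vsupp.1 hv (hzero u v h)
  have hback : ∀ w ∈ stdSimplex ℝ X, vsupp w ⊆ S → ∃ u, F u = w ∧ (∀ k, u k = w (ε.symm k)) ∧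
      ∑ k, u k + w x = 1 := by
    intro w hw hwS
    have hws : ∀ v ∈ vsupp w, v ∈ s ∨ v = x := fun v hv => (hmem v).1 (hwS hv)
    refine ⟨_, simplexParam_coordinates ε hx hw hws, fun _ => rfl, ?_⟩
    rw [← sum_add_apex_eq_one hx hw hws, ← Finset.sum_coe_sort s,
      Equiv.sum_comp ε.symm fun v : s => w v]
  obtain ⟨h, h1, h2⟩ := exists_homeomorph_corner (n := n)
  have himage : ∀ (P : Set (Fin n → ℝ)) Q, h '' P = Q → (F ∘ h.symm) '' Q = F '' P := by
    rintro P _ rfl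
    rw [Set.image_comp, Set.image_image h.symm]
    simp
  refine ⟨F ∘ h.symm, (contDiff_simplexParam ε).continuous.comp h.symm.continuous,
    hinj.comp h.symm.injective, ?_, ?_⟩
  · rw [himage _ _ h2]
    ext w
    constructor
    · rintro ⟨u, hu, rfl⟩
      exact ⟨hstd u hu.1 hu.2, hsupp u⟩
    · rintro ⟨hw, hwS⟩
      obtain ⟨u, hu, hk, hsum⟩ := hback w hw hwS
      exact ⟨u, ⟨fun k => hk k ▸ hw.1 _, by linarith [hw.1 x]⟩, hu⟩
  · rw [himage _ _ h1]
    ext w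
    constructor
    · rintro ⟨u, hu, rfl⟩
      refine ⟨hstd u (fun k => (hu.1 k).le) hu.2.le, (hsupp u).antisymm fun v hv => ?_⟩
      rw [mem_vsupp]
      obtain hv | rfl := (hmem v).1 hv
      · exact (simplexParam_of_mem ε u hv).trans_ne (hu.1 _).ne'
      · exact (simplexParam_apex ε hx u).trans_ne (sub_pos.2 hu.2).ne'
    · rintro ⟨hw, hwS⟩
      obtain ⟨u, hu, hk, hsum⟩ := hback w hw hwS.le
      have hpos : ∀ v ∈ S, 0 < w v := fun v hv =>
        lt_of_le_of_ne (hw.1 v) (Ne.symm (mem_vsupp.1 (hwS ▸ hv)))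
      refine ⟨u, ⟨fun k => hk k ▸ hpos _ ((hmem _).2 (.inl (ε.symm k).2)), ?_⟩, hu⟩
      linarith [hpos x hxS]

end Chart

/-! ### The CW structure on a complex with cones glued to it -/

section ConeCells

variable {X : Type v} [Fintype X]

/-- The characteristic map of the open simplex of a face of a simplicial complex, with values in its
realization. -/
theorem exists_faceChart {K : PreAbstractSimplicialComplex X} {S : Finset X} (hS : S ∈ K.faces)
    {n : ℕ} (hn : S.card = n + 1) :
    ∃ γ : (Fin n → ℝ) → realization K, ContinuousOn γ (closedBall 0 1) ∧
      Set.InjOn γ (ball 0 1) ∧ (∀ u ∈ ball (0 : Fin n → ℝ) 1, vsupp (γ u).1 = S) ∧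
      (∀ u ∈ sphere (0 : Fin n → ℝ) 1, vsupp (γ u).1 ⊂ S) ∧
      ∀ w : realization K, vsupp w.1 = S → ∃ u ∈ ball (0 : Fin n → ℝ) 1, γ u = w := by
  classical
  obtain ⟨γ, hγ, hinj, himc, himb⟩ := exists_simplexChart hn
  have hc : ∀ u ∈ closedBall (0 : Fin n → ℝ) 1, γ u ∈ stdSimplex ℝ X ∧ vsupp (γ u) ⊆ S :=
    fun u hu => himc.le ⟨u, hu, rfl⟩
  have hK : ∀ u ∈ closedBall (0 : Fin n → ℝ) 1, γ u ∈ realization K := fun u hu =>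
    mem_realization_iff.2 ⟨(hc u hu).1,
      (K.isRelLowerSet_faces hS).2 (hc u hu).2 (vsupp_nonempty (hc u hu).1)⟩
  let γ' : (Fin n → ℝ) → realization K := fun u =>
    if h : u ∈ closedBall (0 : Fin n → ℝ) 1 then ⟨γ u, hK u h⟩ else ⟨γ 0, hK 0 (by simp)⟩
  have hγ' : ∀ u ∈ closedBall (0 : Fin n → ℝ) 1, (γ' u : X → ℝ) = γ u := fun u hu => by
    simp only [γ']
    rw [dif_pos hu]
  refine ⟨γ', ?_, ?_, ?_, ?_, ?_⟩
  · rw [IsInducing.subtypeVal.continuousOn_iff]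
    exact hγ.continuousOn.congr hγ'
  · intro u hu v hv h
    refine hinj ?_
    rw [← hγ' u (ball_subset_closedBall hu), ← hγ' v (ball_subset_closedBall hv), h]
  · intro u hu
    rw [hγ' u (ball_subset_closedBall hu)]
    exact (himb.le ⟨u, hu, rfl⟩).2
  · intro u hu
    rw [hγ' u (sphere_subset_closedBall hu)]
    obtain ⟨h1, h2⟩ := hc u (sphere_subset_closedBall hu)
    refine h2.ssubset_of_ne fun h => ?_
    obtain ⟨u', hu', he⟩ := himb.ge ⟨h1, h⟩
    rw [hinj he, mem_ball] at hu'
    exact hu'.ne hu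
  · intro w hw
    obtain ⟨u, hu, he⟩ := himb.ge ⟨(mem_realization_iff.1 w.2).1, hw⟩
    exact ⟨u, hu, Subtype.ext ((hγ' u (ball_subset_closedBall hu)).trans he)⟩

variable [PartialOrder X]

/-- The cells of dimension `n` contributed by the cones over the descending links of the points of
`C`: the faces of these cones that contain the apex. -/
def ConeCell (C : Set X) (n : ℕ) : Type v :=
  {p : C × Finset X // (p.1 : X) ∈ p.2 ∧ p.2.card = n + 1 ∧
    p.2 ∈ (cone (p.1 : X) (orderComplex (Set.Iio (p.1 : X)))).faces}

theorem mem_range_linkInclusion {C : Set X} {x : C}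
    {w : realization (cone (x : X) (orderComplex (Set.Iio (x : X))))} :
    (⟨x, w⟩ : ConeSum C) ∈ Set.range (linkInclusion C) ↔ (x : X) ∉ vsupp w.1 := by
  rw [mem_vsupp, not_not]
  constructor
  · rintro ⟨⟨x', w'⟩, h⟩
    obtain rfl : x' = x := congrArg Sigma.fst h
    have h2 : w'.1 = w.1 := congrArg Subtype.val (eq_of_heq (Sigma.mk.inj h).2)
    rw [← h2]
    by_contra h3
    exact lt_irrefl _ ((mem_realization_orderComplex.1 w'.2).2.1 _ h3)
  · intro h
    exact ⟨⟨x, w.1, mem_link_of_mem_cone w.2 h⟩, rfl⟩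

variable {C : Set X} {Y : Type v} [TopologicalSpace Y] [T2Space Y]
  [CWComplex (Set.univ : Set Y)] [CWComplex.Finite (Set.univ : Set Y)] {φ : C(LinkSum C, Y)}

theorem t2Space_adj_linkInclusion (φ : C(LinkSum C, Y)) : T2Space (Adj (linkInclusion C) φ) := by
  have : CompactSpace Y := compactSpace_of_finite_cwComplex
  exact Adj.t2Space φ (linkInclusion_injective C)

/-- If the descending links are attached by cellular maps, then the resulting space is a finite CW
complex. Its cells are those of `Y` and the open simplices of the cones that contain the apex, and
subcomplexes of `Y` remain subcomplexes. -/
theorem exists_cwComplex_adj (hφ : ∀ (x : C) (w : realization (orderComplex (Set.Iio (x : X)))),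
      φ ⟨x, w⟩ ∈ CWComplex.skeletonLT (Set.univ : Set Y) (vsupp w.1).card) :
    ∃ (_ : CWComplex (Set.univ : Set (Adj (linkInclusion C) φ)))
      (_ : CWComplex.Finite (Set.univ : Set (Adj (linkInclusion C) φ))),
      ∀ E : CWComplex.Subcomplex (Set.univ : Set Y),
        ∃ E' : CWComplex.Subcomplex (Set.univ : Set (Adj (linkInclusion C) φ)),
          (E' : Set (Adj (linkInclusion C) φ)) = Adj.inA (linkInclusion C) φ '' E := by
  classical
  have hcomp : CompactSpace Y := compactSpace_of_finite_cwComplex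
  have hT2 := t2Space_adj_linkInclusion φ
  have hi := linkInclusion_injective C
  have hinA := Adj.inA_injective (linkInclusion C) φ
  have hclosed : IsClosedEmbedding (Adj.inA (linkInclusion C) φ) :=
    (Adj.inA (linkInclusion C) φ).continuous.isClosedEmbedding hinA
  -- the characteristic maps of the cells of the cones
  choose γ γcont γinj γball γsphere γsurj using fun (n : ℕ) (j : ConeCell C n) =>
    exists_faceChart j.2.2.2 j.2.2.1
  let jA := Adj.inA (linkInclusion C) φ
  let jZ := Adj.inZ (linkInclusion C) φ
  -- the points of the cones with nonzero weight at the apex are not identified with other points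
  have hout : ∀ (x : C) w, (x : X) ∈ vsupp w.1 →
      (⟨x, w⟩ : ConeSum C) ∉ Set.range (linkInclusion C) :=
    fun x w h h' => mem_range_linkInclusion.1 h' h
  have hZA : ∀ (x : C) w a, (x : X) ∈ vsupp w.1 → jZ ⟨x, w⟩ ≠ jA a := by
    intro x w a h he
    rw [show jZ ⟨x, w⟩ = Sum.inr ⟨_, hout x w h⟩ from Adj.inZ_eq_inr φ _] at he
    exact Sum.inr_ne_inl he
  have hZZ : ∀ (x : C) w (x' : C) w', (x : X) ∈ vsupp w.1 → (x' : X) ∈ vsupp w'.1 →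
      jZ ⟨x, w⟩ = jZ ⟨x', w'⟩ → (⟨x, w⟩ : ConeSum C) = ⟨x', w'⟩ := by
    intro x w x' w' h h' he
    rw [show jZ ⟨x, w⟩ = Sum.inr ⟨_, hout x w h⟩ from Adj.inZ_eq_inr φ _,
      show jZ ⟨x', w'⟩ = Sum.inr ⟨_, hout x' w' h'⟩ from Adj.inZ_eq_inr φ _] at he
    exact congrArg Subtype.val (Sum.inr_injective he)
  let J : ℕ → Type v := fun n => RelCWComplex.cell (Set.univ : Set Y) n ⊕ ConeCell C n
  let c : ∀ n, J n → (Fin n → ℝ) → Adj (linkInclusion C) φ := fun n =>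
    Sum.elim (fun i u => jA (RelCWComplex.map n i u)) (fun j u => jZ ⟨j.1.1, γ n j u⟩)
  have hmemball : ∀ n (j : ConeCell C n), ∀ u ∈ ball (0 : Fin n → ℝ) 1,
      (j.1.1 : X) ∈ vsupp (γ n j u).1 := fun n j u hu => γball n j u hu ▸ j.2.1
  have hlow : ∀ (n : ℕ) (y : Y), y ∈ CWComplex.skeletonLT (Set.univ : Set Y) n →
      ∃ m < n, ∃ j', ∃ u' ∈ ball (0 : Fin m → ℝ) 1, c m j' u' = jA y := by
    intro n y hy
    obtain ⟨m, hm, i, u, hu, rfl⟩ := CWComplex.mem_skeletonLT_iff.1 hy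
    exact ⟨m, by exact_mod_cast hm, .inl i, u, hu, rfl⟩
  have hcone : ∀ (x : C) w, (x : X) ∈ vsupp w.1 → ∃ m, (vsupp w.1).card = m + 1 ∧
      ∃ j', ∃ u' ∈ ball (0 : Fin m → ℝ) 1, c m j' u' = jZ ⟨x, w⟩ := by
    intro x w hx
    obtain ⟨m, hm⟩ : ∃ m, (vsupp w.1).card = m + 1 :=
      Nat.exists_eq_succ_of_ne_zero (Finset.card_pos.2 ⟨_, hx⟩).ne'
    let j : ConeCell C m := ⟨(x, vsupp w.1), hx, hm, (mem_realization_iff.1 w.2).2⟩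
    obtain ⟨u, hu, he⟩ := γsurj m j w rfl
    exact ⟨m, hm, .inr j, u, hu, congrArg (fun w => jZ ⟨x, w⟩) he⟩
  have hfam : IsCellFamily c := by
    refine ⟨?_, ?_, ?_, ?_, ?_, ?_, ?_⟩
    · filter_upwards [RelCWComplex.FiniteDimensional.eventually_isEmpty_cell
        (C := (Set.univ : Set Y)) (D := ∅), Filter.eventually_ge_atTop (Fintype.card X)] with n h1 h2
      have : IsEmpty (ConeCell C n) := ⟨fun j => by
        have h3 := j.2.2.1
        have := Finset.card_le_univ j.1.2
        omega⟩
      exact inferInstanceAs (IsEmpty (_ ⊕ _))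
    · intro n
      have h1 : Finite (RelCWComplex.cell (Set.univ : Set Y) n) :=
        CWComplex.FiniteType.finite_cell n
      have h2 : Finite (ConeCell C n) := Subtype.finite
      exact inferInstanceAs (Finite (_ ⊕ _))
    · rintro n (i | j)
      · exact jA.continuous.comp_continuousOn (RelCWComplex.continuousOn n i)
      · exact (jZ.continuous.comp continuous_sigmaMk).comp_continuousOn (γcont n j)
    · rintro n (i | j)
      · intro u hu v hv h
        rw [← RelCWComplex.source_eq n i] at hu hv
        exact (RelCWComplex.map n i).injOn hu hv (hinA h)
      · intro u hu v hv h
        have := hZZ _ _ _ _ (hmemball n j u hu) (hmemball n j v hv) h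
        exact γinj n j hu hv (eq_of_heq (Sigma.mk.inj this).2)
    · rintro n (i | j) n' (i' | j') u hu u' hu' h
      · by_contra hne
        have h' : RelCWComplex.map n i u = RelCWComplex.map n' i' u' := hinA h
        refine (CWComplex.disjoint_openCell_of_ne (C := (Set.univ : Set Y)) (i := i) (j := i')
          fun heq => hne ?_).le_bot ⟨⟨u, hu, rfl⟩, u', hu', h'.symm⟩
        cases heq
        rfl
      · exact absurd h.symm (hZA _ _ _ (hmemball n' j' u' hu'))
      · exact absurd h (hZA _ _ _ (hmemball n j u hu))
      · have hz := hZZ _ _ _ _ (hmemball n j u hu) (hmemball n' j' u' hu') h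
        have hS : j.1.2 = j'.1.2 := by
          rw [← γball n j u hu, ← γball n' j' u' hu']
          exact congrArg (fun z : ConeSum C => vsupp z.2.1) hz
        have hx : j.1.1 = j'.1.1 := congrArg Sigma.fst hz
        obtain rfl : n = n' := by
          have h1 := j.2.2.1
          have h2 := j'.2.2.1
          rw [hS] at h1
          omega
        obtain rfl : j = j' := Subtype.ext (Prod.ext hx hS)
        rfl
    -- the boundary of a cell: a face of the simplex contains the apex and is then a cell of lower
    -- dimension, or lies in the base and is mapped by the cellular map `φ` to such cells
    · rintro n (i | j) u hu
      · exact hlow n _ (CWComplex.cellFrontier_subset_skeletonLT n i ⟨u, hu, rfl⟩)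
      · have hlt := γsphere n j u hu
        have hcard : (vsupp (γ n j u).1).card < n + 1 := (Finset.card_lt_card hlt).trans_eq j.2.2.1
        by_cases hx : (j.1.1 : X) ∈ vsupp (γ n j u).1
        · obtain ⟨m, hm, h⟩ := hcone _ _ hx
          exact ⟨m, by omega, h⟩
        · obtain ⟨w, hw⟩ := mem_range_linkInclusion.2 hx
          obtain ⟨x', w⟩ := w
          obtain rfl : x' = j.1.1 := congrArg Sigma.fst hw
          have hval : w.1 = (γ n j u).1 :=
            congrArg Subtype.val (eq_of_heq (Sigma.mk.inj hw).2)
          change ∃ m < n, ∃ j', ∃ u' ∈ ball (0 : Fin m → ℝ) 1, c m j' u' = jZ ⟨j.1.1, γ n j u⟩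
          rw [← hw, show jZ (linkInclusion C ⟨j.1.1, w⟩) = jA (φ ⟨j.1.1, w⟩) from
            Adj.inZ_range φ hi _]
          refine hlow n _ (CWComplex.skeletonLT_mono ?_ (hφ _ w))
          rw [hval]
          exact_mod_cast Nat.lt_succ_iff.1 hcard
    · intro p
      obtain ⟨y, rfl⟩ | ⟨⟨x, w⟩, rfl⟩ := (Adj.isGlue φ hi).surj p
      · have hy : y ∈ (Set.univ : Set Y) := trivial
        rw [← CWComplex.iUnion_openCell_eq_complex (C := (Set.univ : Set Y))] at hy
        simp only [Set.mem_iUnion] at hy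
        obtain ⟨m, i, u, hu, rfl⟩ := hy
        exact ⟨m, .inl i, u, hu, rfl⟩
      · by_cases hx : (x : X) ∈ vsupp w.1
        · obtain ⟨m, -, h⟩ := hcone x w hx
          exact ⟨m, h⟩
        · obtain ⟨w', hw'⟩ := mem_range_linkInclusion.2 hx
          rw [← hw', Adj.inZ_range φ hi]
          obtain ⟨m, -, h⟩ := hlow _ _ (hφ w'.1 w'.2)
          exact ⟨m, h⟩
  obtain ⟨h1, h2, h3⟩ := hfam.exists_cwComplex
  refine ⟨h1, h2, fun E => h3 (fun n => Sum.inl '' E.I n) _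
    (hclosed.isClosedMap _ (CWComplex.Subcomplex.closed E)) fun z => ?_⟩
  constructor
  · rintro ⟨y, hy, rfl⟩
    rw [← CWComplex.Subcomplex.union] at hy
    simp only [Set.mem_iUnion] at hy
    obtain ⟨n, ⟨i, hi⟩, u, hu, rfl⟩ := hy
    exact ⟨n, .inl i, ⟨i, hi, rfl⟩, u, hu, rfl⟩
  · rintro ⟨n, _, ⟨i, hi, rfl⟩, u, hu, rfl⟩
    exact ⟨_, CWComplex.Subcomplex.openCell_subset_of_mem E hi ⟨u, hu, rfl⟩, rfl⟩

end ConeCells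

/-! ### The tower of complexes -/

section Tower

variable {X : Type v} [Fintype X] [PartialOrder X] {C : Set X}

/-- A pushout square of attached cones can be replaced by a homeomorphic square of subspaces. -/
theorem isGluingOfCones_of_isPushout {A T Y : Type v} [TopologicalSpace A] [TopologicalSpace T]
    [TopologicalSpace Y] {f : C(LinkSum C, A)} {a : C(A, T)} {b : C(ConeSum C, T)}
    (h : CategoryTheory.IsPushout (TopCat.ofHom f) (TopCat.ofHom (linkInclusion C))
      (TopCat.ofHom a) (TopCat.ofHom b))
    {P Q : Set Y} (hPQ : P ⊆ Q) (eA : A ≃ₜ P) (eT : T ≃ₜ Q) (hc : ∀ x, (eT (a x) : Y) = eA x) :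
    IsGluingOfCones C P Q := by
  refine ⟨hPQ, (eA : C(A, P)).comp f, (eT : C(T, Q)).comp b,
    h.of_iso (.refl _) (TopCat.isoOfHomeo eA) (.refl _) (TopCat.isoOfHomeo eT) ?_ ?_ ?_ ?_⟩
  · rfl
  · rfl
  · exact TopCat.hom_ext (ContinuousMap.ext fun x => Subtype.ext (hc x))
  · rfl

theorem IsGluingOfCones.image {Y Z : Type v} [TopologicalSpace Y] [TopologicalSpace Z] {P Q : Set Y}
    (h : IsGluingOfCones C P Q) {g : Y → Z} (hg : IsEmbedding g) :
    IsGluingOfCones C (g '' P) (g '' Q) := by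
  obtain ⟨hPQ, φ, Φ, h⟩ := h
  exact isGluingOfCones_of_isPushout h (Set.image_mono hPQ) (hg.homeomorphImage P)
    (hg.homeomorphImage Q) fun x => rfl

variable {A Y : Type v} [TopologicalSpace A] [TopologicalSpace Y] [T2Space Y]
  [CWComplex (Set.univ : Set Y)] [CWComplex.Finite (Set.univ : Set Y)]

/-- If `A` is equivalent to a finite CW complex `Y`, then attaching cones to `A` amounts to
attaching them to `Y` along cellular maps. -/
theorem RetractEquiv.exists_adj_cellular (h : RetractEquiv (TopCat.of A) (TopCat.of Y))
    (f : C(LinkSum C, A)) :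
    ∃ φ : C(LinkSum C, Y), (∀ (x : C) (w : realization (orderComplex (Set.Iio (x : X)))),
        φ ⟨x, w⟩ ∈ CWComplex.skeletonLT (Set.univ : Set Y) (vsupp w.1).card) ∧
      RetractEquiv (TopCat.of (Adj (linkInclusion C) f))
        (TopCat.of (Adj (linkInclusion C) φ)) := by
  have hi := linkInclusion_injective C
  have he := @hasExtension_linkInclusion _ _ _ C
  obtain ⟨φ₀, h₀⟩ := RetractEquiv.exists_adj hi he h f
  let φ₁ : C(LinkSum C, Y) := φ₀
  choose ψ hψ hcell using fun x : C =>
    exists_homotopic_isCellular (φ₁.comp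
      (ContinuousMap.sigmaMk (X := fun x : C => realization (orderComplex (Set.Iio (x : X)))) x))
  refine ⟨ContinuousMap.sigma ψ, fun x w => hcell x w,
    h₀.trans (retractEquiv_adj_of_homotopic hi he ?_)⟩
  have F := fun x => (hψ x).some
  let G : C(LinkSum C, C(I, Y)) := ContinuousMap.sigma fun x =>
    ((F x).toContinuousMap.comp ContinuousMap.prodSwap).curry
  exact ⟨⟨⟨fun p => G p.2 p.1, by fun_prop⟩, fun z => (F z.1).apply_zero z.2,
    fun z => (F z.1).apply_one z.2⟩⟩

end Tower

section Tower

variable {X : Type v} [Fintype X] [PartialOrder X]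

/-- A filtration of subposets in which one alternately adds cones over descending links (passing
from `B j` to `A j`) and enlarges the order complex to one that deformation retracts to it (passing
from `A j` to `B (j + 1)`) is modelled by a filtered finite CW complex. -/
theorem exists_cwComplex_tower {r : ℕ} {A B C : ℕ → Set X} (hB : B 0 = ∅)
    (hA : ∀ j ≤ r, A j = B j ∪ C j) (hBC : ∀ j ≤ r, Disjoint (B j) (C j))
    (hmax : ∀ j ≤ r, ∀ x ∈ C j, ∀ z ∈ A j, ¬ x < z) (hlink : ∀ j ≤ r, ∀ x ∈ C j, Set.Iio x ⊆ B j)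
    (hdef : ∀ j < r, IsStrongDeformationRetract (realization (orderComplex (A j)))
      (realization (orderComplex (B (j + 1))))) (n : ℕ) (hn : n ≤ r + 1) :
    ∃ (Y : Type v) (_ : TopologicalSpace Y) (_ : T2Space Y) (_ : CWComplex (Set.univ : Set Y))
      (_ : CWComplex.Finite (Set.univ : Set Y)) (E : ℕ → CWComplex.Subcomplex (Set.univ : Set Y)),
      (E 0 : Set Y) = ∅ ∧ (E n : Set Y) = Set.univ ∧
      ∀ j < n, IsGluingOfCones (C j) (E j : Set Y) (E (j + 1) : Set Y) ∧
        RetractEquiv (TopCat.of (realization (orderComplex (A j)))) (TopCat.of (E (j + 1) : Set Y))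
    := by
  induction n with
  | zero =>
    have h : IsCellFamily (Z := PEmpty.{v + 1}) (J := fun _ => PEmpty.{v + 1})
        (fun _ j => j.elim) :=
      ⟨.of_forall fun _ => inferInstance, fun _ => inferInstance, fun _ j => j.elim,
        fun _ j => j.elim, fun _ j => j.elim, fun _ j => j.elim, fun z => z.elim⟩
    obtain ⟨h1, h2, -⟩ := h.exists_cwComplex
    exact ⟨PEmpty.{v + 1}, inferInstance, inferInstance, h1, h2,
      fun _ => CWComplex.skeletonLT Set.univ 0, Set.eq_empty_of_isEmpty _,
      Subsingleton.elim _ _, fun j hj => absurd hj (Nat.not_lt_zero j)⟩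
  | succ n ih =>
    obtain ⟨Y, _, _, _, _, E, hE0, hEn, hE⟩ := ih (by omega)
    have hnr : n ≤ r := by omega
    -- `Y` models `B n`, so the cones that are added to `B n` can be attached to `Y` instead
    have hBY : RetractEquiv (TopCat.of (realization (orderComplex (B n)))) (TopCat.of Y) := by
      cases n with
      | zero =>
        have h1 : IsEmpty Y := ⟨fun y => by
          have hy : y ∈ (Set.univ : Set Y) := trivial
          rw [← hEn, hE0] at hy
          exact hy⟩
        have h2 : IsEmpty (realization (orderComplex (B 0))) := ⟨fun w => by
          obtain ⟨v, hv⟩ := vsupp_nonempty (mem_realization_iff.1 w.2).1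
          have := (mem_realization_orderComplex.1 w.2).2.1 v (mem_vsupp.1 hv)
          rw [hB] at this
          exact this⟩
        exact .of_homeomorph ⟨Equiv.equivOfIsEmpty _ _, continuous_of_discreteTopology,
          continuous_of_discreteTopology⟩
      | succ j =>
        refine (RetractEquiv.of_isRetractInclusion
          (hdef j (by omega)).isRetractInclusion).symm.trans ((hE j (by omega)).2.trans ?_)
        exact RetractEquiv.of_homeomorph ((Homeomorph.setCongr hEn).trans (Homeomorph.Set.univ Y))
    obtain ⟨φ, hφ, hAdj⟩ := hBY.exists_adj_cellular (linksTo (hlink n hnr))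
    obtain ⟨e⟩ := (isGlue_cones (hA n hnr) (hBC n hnr) (hmax n hnr)
      (hlink n hnr)).nonempty_homeomorph
      (Adj.isGlue (linksTo (hlink n hnr)) (linkInclusion_injective (C n)))
    have hi := linkInclusion_injective (C n)
    have hcomp : CompactSpace Y := compactSpace_of_finite_cwComplex
    have hT2 := t2Space_adj_linkInclusion φ
    obtain ⟨h1, h2, hsub⟩ := exists_cwComplex_adj hφ
    choose sub hsub using hsub
    let jA := Adj.inA (linkInclusion (C n)) φ
    have hemb : IsEmbedding jA :=
      (jA.continuous.isClosedEmbedding (Adj.inA_injective _ _)).isEmbedding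
    -- the new filtration consists of the images of the old one and, after these, the whole space
    let E' : ℕ → CWComplex.Subcomplex (Set.univ : Set (Adj (linkInclusion (C n)) φ)) := fun j =>
      if j ≤ n then sub (E j) else CWComplex.skeletonLT Set.univ ⊤
    have hE' : ∀ j ≤ n, (E' j : Set (Adj (linkInclusion (C n)) φ)) = jA '' E j := fun j hj => by
      simp only [E', if_pos hj]
      exact hsub _
    have hEn' : (E' (n + 1) : Set (Adj (linkInclusion (C n)) φ)) = Set.univ := by
      simp only [E', if_neg (Nat.not_succ_le_self n)]
      exact CWComplex.skeletonLT_top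
    refine ⟨_, inferInstance, hT2, h1, h2, E', ?_, hEn', fun j hj => ?_⟩
    · rw [hE' 0 n.zero_le, hE0, Set.image_empty]
    obtain hj | rfl := (Nat.lt_succ_iff.1 hj).lt_or_eq
    · rw [hE' j hj.le, hE' (j + 1) hj]
      exact ⟨(hE j hj).1.image hemb,
        (hE j hj).2.trans (RetractEquiv.of_homeomorph (hemb.homeomorphImage _))⟩
    · rw [hE' j le_rfl, hEn', hEn]
      refine ⟨isGluingOfCones_of_isPushout (Adj.isGlue φ hi).isPushout (Set.subset_univ _)
        ((Homeomorph.Set.univ Y).symm.trans (hemb.homeomorphImage Set.univ))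
        (Homeomorph.Set.univ _).symm fun x => rfl, ?_⟩
      exact (RetractEquiv.of_homeomorph e).trans (hAdj.trans
        (RetractEquiv.of_homeomorph (Homeomorph.Set.univ _).symm))

end Tower

/-! ### Consecutive levels of a Morse function -/

section Levels

theorem disjoint_thickLevelSet_critical {X : Type*} {f : X → ℝ} {M : Set (X × X)} {s t : ℝ}
    (hst : s < t) :
    Disjoint (thickLevelSet f M s) {x | IsCritical M x ∧ f x = t} := by
  refine Set.disjoint_left.2 ?_
  rintro z (hz | ⟨e, he, rfl, -⟩) ⟨hc, hzt⟩
  · exact absurd (hzt ▸ hz) (not_le.2 hst)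
  · exact (hc e he).2 rfl

variable {X : Type v} [PartialOrder X]

theorem orderComplex_empty : orderComplex (∅ : Set X) = ⊥ :=
  le_bot_iff.1 fun _ hs => absurd (hs.2.1 hs.1.choose_spec) (Set.notMem_empty _)

variable {f : X → ℝ} {M : Set (X × X)}

variable [Fintype X]

/-- Passing from the thickened level `s` to the next level `t` adds the critical points of value
`t`: a point of value `t` that is an upper end of an edge of the matching is already there, because
the lower end of an admissible edge must have value `s`. -/
theorem levelSet_eq_union (hf : IsMorseFunction f) (hM : IsAdmissibleMorseMatching f M) {s t : ℝ}
    (hst : s < t) (hs : s ∈ Set.range f) (ht : t ∈ Set.range f)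
    (hgap : ∀ z, f z < t → f z ≤ s) :
    levelSet f M t = thickLevelSet f M s ∪ {x | IsCritical M x ∧ f x = t} := by
  ext z
  constructor
  · rintro ⟨hz, hlow⟩
    obtain hz | hz := hz.lt_or_eq
    · exact .inl (.inl (hgap z hz))
    by_cases hc : IsCritical M z
    · exact .inr ⟨hc, hz⟩
    · simp only [IsCritical, not_forall] at hc
      obtain ⟨e, he, hc⟩ := hc
      have h1 : e.1 ≠ z := fun h => hlow e he h hz
      have h2 : e.2 = z := by
        by_contra h2
        exact hc ⟨h1, h2⟩
      have hlt : f e.1 < t := hz ▸ h2 ▸ hf _ _ (hM.covBy e he)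
      refine .inl (.inr ⟨e, he, h2, le_antisymm (hgap _ hlt) (not_lt.1 fun h => ?_)⟩)
      obtain ⟨y, rfl⟩ := hs
      exact (hM.admissible e he).no_value_between ⟨y, h, by rwa [h2, hz]⟩
  · rintro ((hz | ⟨e, he, rfl, hes⟩) | ⟨hc, hz⟩)
    · exact ⟨hz.trans hst.le, fun e he hez => (hz.trans_lt hst).ne⟩
    · refine ⟨not_lt.1 fun h => ?_, fun e' he' hee => ?_⟩
      · obtain ⟨y, rfl⟩ := ht
        exact (hM.admissible e he).no_value_between ⟨y, hes ▸ hst, h⟩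
      · obtain rfl := hM.eq_of_share e' he' e he (.inr (.inl hee))
        exact absurd hee (hM.covBy e' he').lt.ne
    · exact ⟨hz.le, fun e he hez => absurd hez (hc e he).1⟩

/-- At the lowest level there are only critical points and lower ends of edges. -/
theorem levelSet_eq_critical (hf : IsMorseFunction f) (hM : IsAdmissibleMorseMatching f M) {t : ℝ}
    (hmin : ∀ z, t ≤ f z) : levelSet f M t = {x | IsCritical M x ∧ f x = t} := by
  ext z
  constructor
  · rintro ⟨hz, hlow⟩
    have hzt := le_antisymm hz (hmin z)
    refine ⟨fun e he => ⟨fun h => hlow e he h hzt, fun h => ?_⟩, hzt⟩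
    have := hf _ _ (hM.covBy e he)
    rw [h, hzt] at this
    exact absurd this (not_lt.2 (hmin _))
  · rintro ⟨hc, hz⟩
    exact ⟨hz.le, fun e he hez => absurd hez (hc e he).1⟩

/-- No edge of the matching starts at the highest level. -/
theorem levelSet_eq_univ (hf : IsMorseFunction f) (hM : IsAdmissibleMorseMatching f M) {t : ℝ}
    (hmax : ∀ z, f z ≤ t) : levelSet f M t = Set.univ := by
  refine Set.eq_univ_of_forall fun z => ⟨hmax z, ?_⟩
  rintro e he rfl h
  have := hf _ _ (hM.covBy e he)
  rw [h] at this
  exact absurd this (not_lt.2 (hmax _))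

end Levels

end PosetMorse

open PosetMorse in
theorem theorem3p2 {X : Type u} [PartialOrder X] [Fintype X]
    (f : X → ℝ) (hf : PosetMorse.IsMorseFunction f)
    (M : Set (X × X)) (hM : PosetMorse.IsAdmissibleMorseMatching f M)
    (r : ℕ) (t : Fin (r + 1) → ℝ) (ht : StrictMono t) (htf : Set.range t = Set.range f)
    (C : Fin (r + 1) → Set X) (hC : ∀ i, C i = {x | PosetMorse.IsCritical M x ∧ f x = t i}) :
    -- the subposets `A i`, for `i ≤ r`, and `B i` (written with a tilde), for `i < r`
    ∃ (A : Fin (r + 1) → Set X) (B : Fin r → Set X),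
      (∀ i : Fin r, A i.castSucc ⊆ B i ∧ B i ⊆ A i.succ) ∧
      A (Fin.last r) = Set.univ ∧
      PosetMorse.orderComplex (A 0) =
        ⨆ x ∈ C 0, PosetMorse.cone x (PosetMorse.orderComplex (Set.Iio x)) ∧
      (∀ i : Fin r, PosetMorse.orderComplex (A i.succ) = PosetMorse.orderComplex (B i) ⊔
        ⨆ x ∈ C i.succ, PosetMorse.cone x (PosetMorse.orderComplex (Set.Iio x))) ∧
      -- each cone meets the previous complex exactly in its base
      (∀ x ∈ C 0, PosetMorse.orderComplex (Set.Iio x) = ⊥) ∧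
      (∀ i : Fin r, ∀ x ∈ C i.succ,
        PosetMorse.orderComplex (B i) ⊓ PosetMorse.cone x (PosetMorse.orderComplex (Set.Iio x)) =
          PosetMorse.orderComplex (Set.Iio x)) ∧
      (∀ i : Fin r, PosetMorse.IsStrongDeformationRetract
        (PosetMorse.realization (PosetMorse.orderComplex (A i.castSucc)))
        (PosetMorse.realization (PosetMorse.orderComplex (B i)))) ∧
      -- a finite CW complex `Y`, filtered by subcomplexes, built by gluing cones over the
      -- descending links of the critical points, whose stages are homotopy equivalent to the
      -- order complexes of the `A i`; the last stages are `Y` and the order complex of `X`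
      ∃ (Y : Type u) (_ : TopologicalSpace Y) (_ : T2Space Y)
        (_ : Topology.CWComplex (Set.univ : Set Y))
        (_ : Topology.CWComplex.Finite (Set.univ : Set Y))
        (E : Fin (r + 1) → Topology.CWComplex.Subcomplex (Set.univ : Set Y)),
        PosetMorse.IsGluingOfCones (C 0) (∅ : Set Y) (E 0 : Set Y) ∧
        (∀ i : Fin r, PosetMorse.IsGluingOfCones (C i.succ)
          (E i.castSucc : Set Y) (E i.succ : Set Y)) ∧
        (E (Fin.last r) : Set Y) = Set.univ ∧
        (∀ i, Nonempty (ContinuousMap.HomotopyEquiv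
          (PosetMorse.realization (PosetMorse.orderComplex (A i))) (E i : Set Y))) := by
  obtain rfl : C = fun i => {x | IsCritical M x ∧ f x = t i} := funext hC
  have hmono := hf.strictMono
  have hval : ∀ i, t i ∈ Set.range f := fun i => htf ▸ Set.mem_range_self i
  have hval' : ∀ z, ∃ i, t i = f z := fun z => htf.ge (Set.mem_range_self z)
  have hmin : ∀ z, t 0 ≤ f z := fun z => by
    obtain ⟨i, hi⟩ := hval' z
    exact hi ▸ ht.monotone (Fin.zero_le i)
  have hmax : ∀ z, f z ≤ t (Fin.last r) := fun z => by
    obtain ⟨i, hi⟩ := hval' z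
    exact hi ▸ ht.monotone (Fin.le_last i)
  have hgap : ∀ (i : Fin r) z, f z < t i.succ → f z ≤ t i.castSucc := fun i z hz => by
    obtain ⟨j, hj⟩ := hval' z
    rw [← hj] at hz ⊢
    exact ht.monotone (Fin.le_castSucc_iff.2 (ht.lt_iff_lt.1 hz))
  have hst : ∀ i : Fin r, t i.castSucc < t i.succ := fun i => ht Fin.castSucc_lt_succ
  -- the filtration: `B 0 = ∅`, and `B (j + 1)` is the thickening of `A j`
  let A : Fin (r + 1) → Set X := fun i => levelSet f M (t i)
  let B : Fin (r + 1) → Set X := Fin.cases ∅ fun i => thickLevelSet f M (t i.castSucc)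
  let C : Fin (r + 1) → Set X := fun i => {x | IsCritical M x ∧ f x = t i}
  have hA : ∀ i, A i = B i ∪ C i := by
    intro i
    cases i using Fin.cases with
    | zero => exact (levelSet_eq_critical hf hM hmin).trans (Set.empty_union _).symm
    | succ i => exact levelSet_eq_union hf hM (hst i) (hval _) (hval _) (hgap i)
  have hBC : ∀ i, Disjoint (B i) (C i) := by
    intro i
    cases i using Fin.cases with
    | zero => exact Set.empty_disjoint _
    | succ i => exact disjoint_thickLevelSet_critical (hst i)
  have htop : ∀ i, ∀ x ∈ C i, ∀ z ∈ A i, ¬ x < z := fun i x hx z hz hxz =>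
    absurd (hx.2 ▸ hmono hxz) (not_lt.2 hz.1)
  have hlink : ∀ i, ∀ x ∈ C i, Set.Iio x ⊆ B i := by
    intro i x hx y hy
    have hlt : f y < t i := hx.2 ▸ hmono hy
    cases i using Fin.cases with
    | zero => exact absurd hlt (not_lt.2 (hmin y))
    | succ i => exact .inl (hgap i y hlt)
  have hdef : ∀ i : Fin r, IsStrongDeformationRetract (realization (orderComplex (A i.castSucc)))
      (realization (orderComplex (B i.succ))) := fun i =>
    isStrongDeformationRetract_levelSet hf hM _
  refine ⟨A, fun i => B i.succ, fun i => ⟨levelSet_subset_thickLevelSet _, ?_⟩,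
    levelSet_eq_univ hf hM hmax, ?_, fun i => orderComplex_eq_sup_cones (hA _) (htop _) (hlink _),
    fun x hx => ?_, fun i x hx => orderComplex_inf_cone (hBC _) (hlink _) hx, hdef, ?_⟩
  · rw [hA]
    exact Set.subset_union_left
  · rw [orderComplex_eq_sup_cones (hA 0) (htop 0) (hlink 0)]
    change orderComplex ∅ ⊔ _ = _
    rw [orderComplex_empty, bot_sup_eq]
  · rw [Set.subset_eq_empty (hlink 0 x hx) rfl, orderComplex_empty]
  -- sequences indexed by the natural numbers, constant from `r` on
  let k : ℕ → Fin (r + 1) := fun j => ⟨min j r, by omega⟩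
  have hk : ∀ i : Fin (r + 1), k i = i := fun i => Fin.ext (min_eq_left (by omega))
  obtain ⟨Y, h1, h2, h3, h4, E, hE0, hEr, hE⟩ := exists_cwComplex_tower (r := r)
    (A := fun j => A (k j)) (B := fun j => B (k j)) (C := fun j => C (k j))
    (by
      rw [show k 0 = 0 from hk 0]
      rfl)
    (fun j _ => hA _) (fun j _ => hBC _) (fun j _ => htop _) (fun j _ => hlink _)
    (fun j hj => by
      have e1 : k j = Fin.castSucc ⟨j, hj⟩ := hk (Fin.castSucc ⟨j, hj⟩)
      have e2 : k (j + 1) = Fin.succ ⟨j, hj⟩ := hk (Fin.succ ⟨j, hj⟩)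
      rw [e1, e2]
      exact hdef _) (r + 1) le_rfl
  refine ⟨Y, h1, h2, h3, h4, fun i => E (i + 1), ?_, fun i => ?_, hEr, fun i => ?_⟩
  · have := (hE 0 (Nat.succ_pos r)).1
    rw [hE0, show k 0 = 0 from hk 0] at this
    exact this
  · have := (hE (i + 1) (by omega)).1
    rw [show k (i + 1) = i.succ from hk i.succ] at this
    exact this
  · have := (hE i i.2).2.nonempty_homotopyEquiv
    rw [hk i] at this
    exact this
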